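/- Let $M^n\subset S^{n+1}(1)$ be an isoparametric hypersurface of the unit sphere, that is, a nonempty smooth immersed hypersurface with a smooth unit normal field $\xi$ whose principal curvatures are constant; let $\lambda_1>\dots>\lambda_g$ be its distinct principal curvatures and $m_1,\dots,m_g$ their multiplicities. For real $t$ such that for all $s$ between $0$ and $t$ the map $x\mapsto \cos s\,x+\sin s\,\xi(x)$ is an immersion, let $M_t$ be the parallel hypersurface given by $x\mapsto\cos t\,x+\sin t\,\xi(x)$; these $M_t$ form the family of parallel hypersurfaces of $M=M_0$. All Ricci curvatures are those of the induced Riemannian metrics. When $g=3$ or $g=6$ all multiplicities are known to coincide, and we write $m=m_1$ for their common value. (i) Let $g=3$. If $m=1$, the Ricci curvature of $M$ is not non-negative. If $m>1$, the family contains exactly one minimal hypersurface $M_{t_0}$, and $M_t$ has positive Ricci curvature if it is close to the minimal one: there is $\varepsilon>0$, depending only on the multiplicities, such that the Ricci curvature of $M_t$ is positive for every $M_t$ in the family with $|t-t_0|<\varepsilon$. (ii) Let $g=4$. If $m_1=1$ or $m_2=1$, the Ricci curvature of $M$ is not non-negative. If $m_1,m_2\ge 2$, the family contains exactly one minimal hypersurface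 $M_{t_0}$, and there is $\varepsilon>0$, depending only on the multiplicities, such that the Ricci curvature of $M_t$ is positive for every $M_t$ in the family with $|t-t_0|<\varepsilon$. (iii) Let $g=6$. If $m=1$, the Ricci curvature of $M$ is not non-negative. If $m=2$, the family contains exactly one minimal hypersurface $M_{t_0}$, and there is $\varepsilon>0$, depending only on the multiplicities, such that the Ricci curvature of $M_t$ is not non-negative for every $M_t$ in the family with $|t-t_0|<\varepsilon$. -/

import Mathlib

open scoped Manifold ContDiff

universe u

noncomputable section

/-! ### Riemannian geometry in coordinates -/

namespace LocalGeometry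

/-- The partial derivative `∂ᵢ f` at `x`. -/
def pderiv {n : ℕ} {F : Type*} [NormedAddCommGroup F] [NormedSpace ℝ F] (i : Fin n)
    (f : EuclideanSpace ℝ (Fin n) → F) (x : EuclideanSpace ℝ (Fin n)) : F :=
  fderiv ℝ f x (EuclideanSpace.single i 1)

/-- The Christoffel symbol `Γᵏᵢⱼ` of the Levi-Civita connection of the metric `G`. -/
def christoffel {n : ℕ} (G : EuclideanSpace ℝ (Fin n) → Matrix (Fin n) (Fin n) ℝ)
    (k i j : Fin n) (x : EuclideanSpace ℝ (Fin n)) : ℝ :=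
  (1 / 2) * ∑ l, (G x)⁻¹ k l *
    (pderiv i (fun y => G y j l) x + pderiv j (fun y => G y i l) x - pderiv l (fun y => G y i j) x)

/-- The component `Rˡₖᵢⱼ` of the Riemann curvature tensor of the metric `G`:
`R(∂ᵢ, ∂ⱼ) ∂ₖ = ∇ᵢ ∇ⱼ ∂ₖ - ∇ⱼ ∇ᵢ ∂ₖ = ∑ l, Rˡₖᵢⱼ ∂ₗ`. -/
def riemann {n : ℕ} (G : EuclideanSpace ℝ (Fin n) → Matrix (Fin n) (Fin n) ℝ)
    (l k i j : Fin n) (x : EuclideanSpace ℝ (Fin n)) : ℝ :=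
  pderiv i (christoffel G l j k) x - pderiv j (christoffel G l i k) x +
    ∑ q, (christoffel G l i q x * christoffel G q j k x -
      christoffel G l j q x * christoffel G q i k x)

/-- The Ricci tensor `Ricⱼₖ` of the metric `G`: the trace of `X ↦ R(X, ∂ⱼ) ∂ₖ`. -/
def ricci {n : ℕ} (G : EuclideanSpace ℝ (Fin n) → Matrix (Fin n) (Fin n) ℝ)
    (j k : Fin n) (x : EuclideanSpace ℝ (Fin n)) : ℝ :=
  ∑ i, riemann G i k i j x

/-- The first fundamental form (induced metric) `⟪∂ᵢ f, ∂ⱼ f⟫` of a parametrization `f`. -/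
def firstForm {n N : ℕ} (f : EuclideanSpace ℝ (Fin n) → EuclideanSpace ℝ (Fin N))
    (x : EuclideanSpace ℝ (Fin n)) : Matrix (Fin n) (Fin n) ℝ :=
  Matrix.of fun i j => inner ℝ (pderiv i f x) (pderiv j f x)

/-- The second fundamental form `-⟪∂ᵢ f, ∂ⱼ ξ⟫` of `f` with respect to the unit normal `ξ`. -/
def secondForm {n N : ℕ} (f ξ : EuclideanSpace ℝ (Fin n) → EuclideanSpace ℝ (Fin N))
    (x : EuclideanSpace ℝ (Fin n)) : Matrix (Fin n) (Fin n) ℝ :=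
  Matrix.of fun i j => -inner ℝ (pderiv i f x) (pderiv j ξ x)

/-- The matrix of the shape operator `A`, where `⟪A X, Y⟫ = II(X, Y)`, i.e. `dξ = -df ∘ A`. -/
def weingarten {n N : ℕ} (f ξ : EuclideanSpace ℝ (Fin n) → EuclideanSpace ℝ (Fin N))
    (x : EuclideanSpace ℝ (Fin n)) : Matrix (Fin n) (Fin n) ℝ :=
  (firstForm f x)⁻¹ * secondForm f ξ x

end LocalGeometry

/-! ### Hypersurfaces of the unit sphere -/

/-- A (nonempty, smooth, immersed) hypersurface of dimension `n` in the unit sphere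
`S^{n+1}(1) ⊆ ℝ^{n+2}`, together with a smooth unit normal field tangent to the sphere.
Neither compactness nor connectedness nor injectivity of the immersion is required. -/
structure SphereHypersurface (n : ℕ) where
  /-- the underlying manifold -/
  carrier : Type u
  [top : TopologicalSpace carrier]
  [charted : ChartedSpace (EuclideanSpace ℝ (Fin n)) carrier]
  [manifold : IsManifold (𝓡 n) ∞ carrier]
  [nonempty : Nonempty carrier]
  /-- the immersion into the ambient Euclidean space -/
  toFun : carrier → EuclideanSpace ℝ (Fin (n + 2))
  /-- the unit normal field -/
  normal : carrier → EuclideanSpace ℝ (Fin (n + 2))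
  smooth_toFun : ContMDiff (𝓡 n) (𝓡 (n + 2)) ∞ toFun
  smooth_normal : ContMDiff (𝓡 n) (𝓡 (n + 2)) ∞ normal
  immersion : ∀ p, Function.Injective (mfderiv (𝓡 n) (𝓡 (n + 2)) toFun p)
  norm_toFun : ∀ p, ‖toFun p‖ = 1
  norm_normal : ∀ p, ‖normal p‖ = 1
  inner_toFun_normal : ∀ p, inner ℝ (toFun p) (normal p) = 0
  inner_normal_mfderiv : ∀ p (v : TangentSpace (𝓡 n) p),
    inner ℝ (normal p)
      (mfderiv (𝓡 n) (𝓡 (n + 2)) toFun p v : EuclideanSpace ℝ (Fin (n + 2))) = 0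

namespace SphereHypersurface

attribute [instance] top charted manifold nonempty

variable {n : ℕ}

/-- The immersion in the preferred chart around `p`. -/
def param (M : SphereHypersurface.{u} n) (p : M.carrier) :
    EuclideanSpace ℝ (Fin n) → EuclideanSpace ℝ (Fin (n + 2)) :=
  M.toFun ∘ (extChartAt (𝓡 n) p).symm

/-- The unit normal field in the preferred chart around `p`. -/
def normalParam (M : SphereHypersurface.{u} n) (p : M.carrier) :
    EuclideanSpace ℝ (Fin n) → EuclideanSpace ℝ (Fin (n + 2)) :=
  M.normal ∘ (extChartAt (𝓡 n) p).symm

/-- The shape operator at `p`, on `T_p M` written in the coordinates of the chart at `p`. -/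
def shapeMatrix (M : SphereHypersurface.{u} n) (p : M.carrier) : Matrix (Fin n) (Fin n) ℝ :=
  LocalGeometry.weingarten (M.param p) (M.normalParam p) (extChartAt (𝓡 n) p p)

/-- `c` is a principal curvature at `p`. -/
def IsPrincipalCurvature (M : SphereHypersurface.{u} n) (p : M.carrier) (c : ℝ) : Prop :=
  Module.End.HasEigenvalue (Matrix.toLin' (M.shapeMatrix p)) c

/-- The multiplicity of `c` as a principal curvature at `p`. -/
def multiplicity (M : SphereHypersurface.{u} n) (p : M.carrier) (c : ℝ) : ℕ :=
  Module.finrank ℝ (Module.End.eigenspace (Matrix.toLin' (M.shapeMatrix p)) c)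

/-- The mean curvature at `p`: the trace of the shape operator. -/
def meanCurvature (M : SphereHypersurface.{u} n) (p : M.carrier) : ℝ :=
  (M.shapeMatrix p).trace

/-- The hypersurface is minimal. -/
def IsMinimal (M : SphereHypersurface.{u} n) : Prop :=
  ∀ p, M.meanCurvature p = 0

/-- The Ricci tensor of the induced Riemannian metric at `p`. A tangent vector at `p` is given by
its coordinates in the preferred chart at `p`, as everywhere in Mathlib. -/
def ricci (M : SphereHypersurface.{u} n) (p : M.carrier) (v w : EuclideanSpace ℝ (Fin n)) : ℝ :=
  ∑ j, ∑ k,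
    LocalGeometry.ricci (LocalGeometry.firstForm (M.param p)) j k (extChartAt (𝓡 n) p p) * v j * w k

/-- The Ricci curvature is positive. -/
def RicciPositive (M : SphereHypersurface.{u} n) : Prop :=
  ∀ p (v : TangentSpace (𝓡 n) p), v ≠ 0 → 0 < M.ricci p v v

/-- The Ricci curvature is non-negative. -/
def RicciNonneg (M : SphereHypersurface.{u} n) : Prop :=
  ∀ p (v : TangentSpace (𝓡 n) p), 0 ≤ M.ricci p v v

/-- `M` is isoparametric with exactly `g` distinct principal curvatures: they are the constants
`κ 0 > κ 1 > ⋯ > κ (g - 1)`, with the constant multiplicities `m 0, m 1, …, m (g - 1)`. -/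
structure IsIsoparametric (M : SphereHypersurface.{u} n) {g : ℕ} (κ : Fin g → ℝ) (m : Fin g → ℕ) :
    Prop where
  strictAnti : StrictAnti κ
  principalCurvature_iff : ∀ p c, M.IsPrincipalCurvature p c ↔ ∃ i, c = κ i
  multiplicity_eq : ∀ p i, M.multiplicity p (κ i) = m i

/-- The map `x ↦ cos t · x + sin t · ξ(x)` to distance `t` along the normal geodesics. -/
def parallelMap (M : SphereHypersurface.{u} n) (t : ℝ) (p : M.carrier) :
    EuclideanSpace ℝ (Fin (n + 2)) :=
  Real.cos t • M.toFun p + Real.sin t • M.normal p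

/-- The velocity of the normal geodesics at distance `t`, which is normal to the parallel
hypersurface. -/
def parallelNormal (M : SphereHypersurface.{u} n) (t : ℝ) (p : M.carrier) :
    EuclideanSpace ℝ (Fin (n + 2)) :=
  (-Real.sin t) • M.toFun p + Real.cos t • M.normal p

/-- The parameters `t` such that no focal point is met up to distance `t`: the parallel maps at all
distances between `0` and `t` are immersions. They parametrize the family of parallel hypersurfaces
of `M`. -/
def familyParams (M : SphereHypersurface.{u} n) : Set ℝ :=
  {t | ∀ s ∈ Set.uIcc 0 t, ∀ p,
    Function.Injective (mfderiv (𝓡 n) (𝓡 (n + 2)) (M.parallelMap s) p)}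

theorem mdifferentiableAt_toFun (M : SphereHypersurface.{u} n) (p : M.carrier) :
    MDifferentiableAt (𝓡 n) (𝓡 (n + 2)) M.toFun p :=
  (M.smooth_toFun p).mdifferentiableAt (by simp)

theorem mdifferentiableAt_normal (M : SphereHypersurface.{u} n) (p : M.carrier) :
    MDifferentiableAt (𝓡 n) (𝓡 (n + 2)) M.normal p :=
  (M.smooth_normal p).mdifferentiableAt (by simp)

theorem contMDiff_combination (M : SphereHypersurface.{u} n) (a b : ℝ) :
    ContMDiff (𝓡 n) (𝓡 (n + 2)) ∞ fun p => a • M.toFun p + b • M.normal p := by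
  have ha : ContMDiff (𝓡 n) 𝓘(ℝ, ℝ) ∞ fun _ : M.carrier => a := contMDiff_const
  have hb : ContMDiff (𝓡 n) 𝓘(ℝ, ℝ) ∞ fun _ : M.carrier => b := contMDiff_const
  exact (ha.smul M.smooth_toFun).add (hb.smul M.smooth_normal)

/-- Differentiating a constant inner product. -/
theorem inner_hasMFDerivAt_of_const (M : SphereHypersurface.{u} n) (p : M.carrier)
    {f h : M.carrier → EuclideanSpace ℝ (Fin (n + 2))}
    {f' h' : EuclideanSpace ℝ (Fin n) →L[ℝ] EuclideanSpace ℝ (Fin (n + 2))}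
    (hf : HasMFDerivAt (𝓡 n) (𝓡 (n + 2)) f p f') (hh : HasMFDerivAt (𝓡 n) (𝓡 (n + 2)) h p h')
    (c : ℝ) (hc : ∀ q, inner ℝ (f q) (h q) = c) (v : EuclideanSpace ℝ (Fin n)) :
    inner ℝ (f p) (h' v) + inner ℝ (f' v) (h p) = 0 := by
  have h3 := HasFDerivWithinAt.inner ℝ hf.2 hh.2
  have hconst : (fun t => inner ℝ (writtenInExtChartAt (𝓡 n) (𝓡 (n + 2)) p f t)
      (writtenInExtChartAt (𝓡 n) (𝓡 (n + 2)) p h t)) = fun _ => c := by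
    funext t
    exact hc _
  rw [hconst] at h3
  have h4 := hasFDerivWithinAt_const (𝕜 := ℝ) c ((extChartAt (𝓡 n) p) p) (Set.range (𝓡 n))
  simp only [modelWithCornersSelf_coe, Set.range_id, hasFDerivWithinAt_univ] at h3 h4
  have h5 := congrArg (fun L => L v) (h3.unique h4)
  have e : (extChartAt (𝓡 n) p).symm (extChartAt (𝓡 n) p p) = p := extChartAt_to_inv p
  simp only [writtenInExtChartAt, Function.comp_apply, e] at h5
  exact h5

/-- The parallel hypersurface of `M` at distance `t`. -/
def parallel (M : SphereHypersurface.{u} n) (t : M.familyParams) : SphereHypersurface.{u} n where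
  carrier := M.carrier
  toFun := M.parallelMap t
  normal := M.parallelNormal t
  smooth_toFun := M.contMDiff_combination (Real.cos t) (Real.sin t)
  smooth_normal := M.contMDiff_combination (-Real.sin t) (Real.cos t)
  immersion := t.2 t Set.right_mem_uIcc
  norm_toFun p := by
    have h := norm_add_sq_real (Real.cos t • M.toFun p) (Real.sin t • M.normal p)
    rw [real_inner_smul_left, real_inner_smul_right, M.inner_toFun_normal, norm_smul, norm_smul,
      M.norm_toFun, M.norm_normal] at h
    have h' : ‖M.parallelMap t p‖ ^ 2 = 1 := by
      rw [parallelMap, h]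
      simp
    exact (pow_eq_one_iff_of_nonneg (norm_nonneg _) two_ne_zero).1 h'
  norm_normal p := by
    have h := norm_add_sq_real ((-Real.sin t) • M.toFun p) (Real.cos t • M.normal p)
    rw [real_inner_smul_left, real_inner_smul_right, M.inner_toFun_normal, norm_smul, norm_smul,
      M.norm_toFun, M.norm_normal] at h
    have h' : ‖M.parallelNormal t p‖ ^ 2 = 1 := by
      rw [parallelNormal, h]
      simp
    exact (pow_eq_one_iff_of_nonneg (norm_nonneg _) two_ne_zero).1 h'
  inner_toFun_normal p := by
    have h1 := real_inner_self_eq_norm_sq (M.toFun p)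
    have h2 := real_inner_self_eq_norm_sq (M.normal p)
    rw [M.norm_toFun] at h1
    rw [M.norm_normal] at h2
    have h3 := M.inner_toFun_normal p
    have h4 := real_inner_comm (M.toFun p) (M.normal p)
    simp only [parallelMap, parallelNormal, inner_add_left, inner_add_right, real_inner_smul_left,
      real_inner_smul_right, h1, h2, h3, h4]
    ring
  inner_normal_mfderiv p v := by
    have hx := (M.mdifferentiableAt_toFun p).hasMFDerivAt
    have hy := (M.mdifferentiableAt_normal p).hasMFDerivAt
    have h1 := M.inner_hasMFDerivAt_of_const p hx hx 1
      (fun q => by rw [real_inner_self_eq_norm_sq, M.norm_toFun]; norm_num) v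
    have h2 := M.inner_hasMFDerivAt_of_const p hy hy 1
      (fun q => by rw [real_inner_self_eq_norm_sq, M.norm_normal]; norm_num) v
    have h3 := M.inner_hasMFDerivAt_of_const p hx hy 0 M.inner_toFun_normal v
    have h4 := M.inner_normal_mfderiv p v
    have hd := ((hx.const_smul (Real.cos t)).add (hy.const_smul (Real.sin t))).mfderiv
    change mfderiv (𝓡 n) (𝓡 (n + 2)) (M.parallelMap t) p = _ at hd
    rw [hd]
    generalize mfderiv (𝓡 n) (𝓡 (n + 2)) M.toFun p = a' at *
    generalize mfderiv (𝓡 n) (𝓡 (n + 2)) M.normal p = b' at *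
    change EuclideanSpace ℝ (Fin n) →L[ℝ] EuclideanSpace ℝ (Fin (n + 2)) at a' b'
    change inner ℝ _ (Real.cos t • a' v + Real.sin t • b' v) = 0
    generalize a' v = a at *
    generalize b' v = b at *
    rw [real_inner_comm] at h1 h2
    have h5 : inner ℝ a (M.normal p) = 0 := by rw [real_inner_comm]; exact h4
    have h6 := real_inner_comm a (M.toFun p)
    have h7 := real_inner_comm b (M.normal p)
    simp only [parallelNormal, inner_add_left, inner_add_right, real_inner_smul_left,
      real_inner_smul_right, h4]
    rw [h5] at h3
    have e1 : inner ℝ (M.toFun p) a = 0 := by linarith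
    have e2 : inner ℝ (M.normal p) b = 0 := by linarith
    have e3 : inner ℝ (M.toFun p) b = 0 := by linarith
    rw [e1, e2, e3]
    ring

end SphereHypersurface

end

/-! Write the principal curvatures as `κ i = cot (α i)` with `0 < α 0 < ⋯ < π`. By the Gauss
equation the Ricci tensor is diagonal in a principal frame, with entry `n - 1 + H c - c ^ 2` for the
principal curvature `c`, where `H` is the trace of the shape operator (`sum_ricci_firstForm`,
`IsIsoparametric.ricci_self`). The sign of the Ricci curvature is thus a question about the numbers
`κ i` and `m i`. Münzner's theorem (`IsIsoparametric.exists_spaced`) leaves one free angle in them: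
`κ i = cot (θ + i π / g)`, and `m (i + 2) = m i` with indices mod `g`.

Münzner's theorem is proved locally. The focal map `κ i₀ f + ξ` is constant in the directions of the
`i₀`-th principal distribution. Its image is a submanifold with normal vectors `-f + κ i₀ ξ`, whose
shape operators have the eigenvalues `(1 + κ i₀ κ i) / (κ i₀ - κ i) = cot (α i - α i₀)`, the same
along the whole fibre. A coordinate line of the fibre gives an arc of a great circle of normal
vectors. The characteristic polynomial of the shape operator is analytic along the full circle and
constant on the arc, hence constant, so a normal vector `η` and `-η` give the same spectrum
(`IsFocalChart.prod_sub_eq`). The spectrum is therefore symmetric about zero: reflection in `α i₀`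
modulo `π` permutes the angles and preserves multiplicities. An increasing periodic sequence
symmetric about each of its terms is equally spaced (`equally_spaced_of_reflection`). Analytic
continuation replaces any global argument about the fibres.

Moving by `t` along the normals replaces `θ` by `θ - t`, and `H` is strictly decreasing in the
angle. A zero `φ` of `H`, which depends on `m` only, is thus the angle of the unique minimal member.
A strict inequality between the numbers at `φ` persists near `φ`, which gives an `ε` depending on
`m` only.

What remains is algebra in `x = cot θ`. A principal curvature of multiplicity one has its square
cancelled in `H c - c ^ 2`, and what is left is too negative. At the minimal angle `cot (3 φ) = 0`
for `g = 3`, `cot (2 φ) ^ 2 = m 1 / m 0` for `g = 4`, and `cot (3 φ) ^ 2 = m 1 / m 0` for `g = 6`.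
For `g = 6` only `m (i + 2) = m i` is used; `m 1` may be any positive number. -/

/-! ### Linear algebra of principal frames -/

/-- A basis of `V`, with `m i` vectors for each index `i`, that the map `a` makes orthonormal and
that diagonalizes `b` relative to `a`, with the eigenvalues `-κ i`. -/
def IsEigenFrame {V F : Type*} [AddCommGroup V] [Module ℝ V] [NormedAddCommGroup F]
    [InnerProductSpace ℝ F] (a b : V → F) {g : ℕ} (κ : Fin g → ℝ) (m : Fin g → ℕ)
    (e : Module.Basis (Σ i, Fin (m i)) ℝ V) : Prop :=
  Orthonormal ℝ (fun l => a (e l)) ∧ ∀ l, b (e l) = -κ l.1 • a (e l)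

/-- Dimension count: the range of `a` has dimension `n` and lies in the orthogonal complement of the
orthonormal pair `u`, `v`, which also has dimension `n`. -/
theorem exists_apply_eq_of_orthogonal {n : ℕ}
    {a : EuclideanSpace ℝ (Fin n) →L[ℝ] EuclideanSpace ℝ (Fin (n + 2))}
    (ha : Function.Injective a) {u v : EuclideanSpace ℝ (Fin (n + 2))} (hu : ‖u‖ = 1)
    (hv : ‖v‖ = 1) (huv : inner ℝ u v = 0) (hau : ∀ w, inner ℝ u (a w) = 0)
    (hav : ∀ w, inner ℝ v (a w) = 0) {z : EuclideanSpace ℝ (Fin (n + 2))}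
    (hzu : inner ℝ u z = 0) (hzv : inner ℝ v z = 0) : ∃ w, a w = z := by
  set S : Submodule ℝ (EuclideanSpace ℝ (Fin (n + 2))) := Submodule.span ℝ (Set.range ![u, v])
  have hon : Orthonormal ℝ ![u, v] := by
    rw [orthonormal_iff_ite]
    intro i j
    fin_cases i <;> fin_cases j <;>
      simp [huv, hu, hv, (real_inner_comm u v).trans huv]
  have hS : Module.finrank ℝ S = 2 := by
    simpa using finrank_span_eq_card hon.linearIndependent
  have hSo : Module.finrank ℝ Sᗮ = n := by
    have := S.finrank_add_finrank_orthogonal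
    rw [hS, finrank_euclideanSpace_fin] at this
    omega
  have mem : ∀ z, inner ℝ u z = 0 → inner ℝ v z = 0 → z ∈ Sᗮ := by
    intro z h1 h2
    rw [Submodule.mem_orthogonal]
    intro s hs
    induction hs using Submodule.span_induction with
    | mem x hx =>
      obtain ⟨i, rfl⟩ := hx
      fin_cases i
      · exact h1
      · exact h2
    | zero => simp
    | add x y _ _ hx hy => rw [inner_add_left, hx, hy, add_zero]
    | smul c x _ hx => rw [real_inner_smul_left, hx, mul_zero]
  have hle : LinearMap.range a.toLinearMap ≤ Sᗮ := by
    rintro _ ⟨w, rfl⟩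
    exact mem _ (hau w) (hav w)
  have hr : Module.finrank ℝ (LinearMap.range a.toLinearMap) = n := by
    rw [LinearMap.finrank_range_of_inj (f := a.toLinearMap) ha, finrank_euclideanSpace_fin]
  have heq := Submodule.eq_of_le_of_finrank_eq hle (hr.trans hSo.symm)
  have := mem z hzu hzv
  rw [← heq] at this
  exact this

/-- The inner product pulled back along the injective `a` makes `A` self-adjoint, so the spectral
theorem applies; grouping the eigenvectors by eigenvalue gives the index type. -/
theorem exists_orthonormal_eigenbasis {V F : Type*} [AddCommGroup V] [Module ℝ V]
    [FiniteDimensional ℝ V] [NormedAddCommGroup F] [InnerProductSpace ℝ F] {a : V →ₗ[ℝ] F}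
    (ha : Function.Injective a) {A : Module.End ℝ V}
    (hA : ∀ v w, inner ℝ (a (A v)) (a w) = inner ℝ (a v) (a (A w))) {g : ℕ} {κ : Fin g → ℝ}
    {m : Fin g → ℕ} (hκ : Function.Injective κ) (heig : ∀ c, A.HasEigenvalue c → ∃ i, c = κ i)
    (hm : ∀ i, Module.finrank ℝ (A.eigenspace (κ i)) = m i) :
    ∃ e : Module.Basis (Σ i, Fin (m i)) ℝ V, Orthonormal ℝ (fun l => a (e l)) ∧
      ∀ l, A (e l) = κ l.1 • e l := by
  classical
  let core : InnerProductSpace.Core ℝ V :=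
    { inner := fun v w => inner ℝ (a v) (a w)
      conj_inner_symm := fun v w => by simp [real_inner_comm]
      re_inner_nonneg := fun v => by simp
      add_left := fun u v w => by simp [inner_add_left]
      smul_left := fun u v r => by simp [real_inner_smul_left]
      definite := fun v hv => ha (by simpa using hv) }
  let _ : NormedAddCommGroup V := core.toNormedAddCommGroup
  let _ : InnerProductSpace ℝ V := InnerProductSpace.ofCore core.toCore
  have hin : ∀ v w : V, inner ℝ v w = inner ℝ (a v) (a w) := fun _ _ => rfl
  have hsym : A.IsSymmetric := fun v w => hA v w
  have hfam := hsym.orthogonalFamily_eigenspaces.comp hκ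
  have hint : DirectSum.IsInternal fun i => A.eigenspace (κ i) := by
    rw [hfam.isInternal_iff]
    rw [← hsym.orthogonalComplement_iSup_eigenspaces_eq_bot]
    congr 1
    apply le_antisymm
    · exact iSup_le fun i => le_iSup (fun c => A.eigenspace c) (κ i)
    · refine iSup_le fun c => ?_
      by_cases hc : A.HasEigenvalue c
      · obtain ⟨i, rfl⟩ := heig c hc
        exact le_iSup (fun i => A.eigenspace (κ i)) i
      · rw [Module.End.hasEigenvalue_iff, not_not] at hc
        rw [hc]
        exact bot_le
  let v : ∀ i, OrthonormalBasis (Fin (m i)) ℝ (A.eigenspace (κ i)) := fun i =>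
    (stdOrthonormalBasis ℝ (A.eigenspace (κ i))).reindex (finCongr (hm i))
  let e := hint.collectedOrthonormalBasis hfam v
  refine ⟨e.toBasis, ?_, fun l => ?_⟩
  · have := e.orthonormal
    rw [orthonormal_iff_ite] at this ⊢
    intro i j
    rw [← hin]
    simpa using this i j
  · have := hint.collectedOrthonormalBasis_mem hfam v l
    simpa using Module.End.mem_eigenspace_iff.1 this

section Diagonal

variable {V : Type*} [AddCommGroup V] [Module ℝ V] {ι : Type*}

theorem repr_apply_of_diagonal [Finite ι] {A : Module.End ℝ V} (e : Module.Basis ι ℝ V) {μ : ι → ℝ}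
    (hA : ∀ l, A (e l) = μ l • e l) (v : V) (l : ι) : e.repr (A v) l = μ l * e.repr v l := by
  have := Fintype.ofFinite ι
  classical
  have h : A v = ∑ k, (e.repr v k * μ k) • e k := by
    conv_lhs => rw [← e.sum_repr v]
    rw [map_sum]
    exact Finset.sum_congr rfl fun k _ => by rw [map_smul, hA, smul_smul]
  rw [h, e.repr_sum_self, mul_comm]

theorem mem_eigenspace_iff_of_diagonal [Finite ι] {A : Module.End ℝ V} (e : Module.Basis ι ℝ V)
    {μ : ι → ℝ} (hA : ∀ l, A (e l) = μ l • e l) {c : ℝ} {v : V} :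
    v ∈ A.eigenspace c ↔ ∀ l, μ l ≠ c → e.repr v l = 0 := by
  rw [Module.End.mem_eigenspace_iff, e.ext_elem_iff]
  refine forall_congr' fun l => ?_
  rw [repr_apply_of_diagonal e hA]
  simp only [map_smul, Finsupp.smul_apply, smul_eq_mul, mul_eq_mul_right_iff]
  tauto

theorem hasEigenvalue_iff_of_diagonal [Finite ι] {A : Module.End ℝ V} (e : Module.Basis ι ℝ V)
    {μ : ι → ℝ} (hA : ∀ l, A (e l) = μ l • e l) {c : ℝ} : A.HasEigenvalue c ↔ ∃ l, c = μ l := by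
  constructor
  · intro h
    obtain ⟨v, hv, hv0⟩ := h.exists_hasEigenvector
    by_contra! hc
    exact hv0 (e.ext_elem_iff.2 fun l => by
      simpa using (mem_eigenspace_iff_of_diagonal e hA).1 hv l (hc l).symm)
  · rintro ⟨l, rfl⟩
    exact Module.End.hasEigenvalue_of_hasEigenvector
      ⟨Module.End.mem_eigenspace_iff.2 (hA l), e.ne_zero l⟩

theorem finrank_eigenspace_of_diagonal [Fintype ι] {A : Module.End ℝ V} (e : Module.Basis ι ℝ V)
    {μ : ι → ℝ} (hA : ∀ l, A (e l) = μ l • e l) (c : ℝ) :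
    Module.finrank ℝ (A.eigenspace c) = Nat.card {l // μ l = c} := by
  classical
  have : A.eigenspace c = Submodule.span ℝ (Set.range fun l : {l // μ l = c} => e l) := by
    apply le_antisymm
    · intro v hv
      rw [mem_eigenspace_iff_of_diagonal e hA] at hv
      rw [← e.sum_repr v]
      refine Submodule.sum_mem _ fun l _ => ?_
      by_cases h : μ l = c
      · exact Submodule.smul_mem _ _ (Submodule.subset_span ⟨⟨l, h⟩, rfl⟩)
      · rw [hv l h, zero_smul]
        exact Submodule.zero_mem _
    · rw [Submodule.span_le]
      rintro _ ⟨⟨l, rfl⟩, rfl⟩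
      exact Module.End.mem_eigenspace_iff.2 (hA l)
  have h := finrank_span_eq_card
    (e.linearIndependent.comp (fun l : {l // μ l = c} => (l : ι)) Subtype.val_injective)
  rw [this, Nat.card_eq_fintype_card]
  exact h

theorem trace_of_diagonal [Fintype ι] {A : Module.End ℝ V} (e : Module.Basis ι ℝ V)
    {μ : ι → ℝ} (hA : ∀ l, A (e l) = μ l • e l) : LinearMap.trace ℝ V A = ∑ l, μ l := by
  classical
  rw [LinearMap.trace_eq_matrix_trace ℝ e, Matrix.trace]
  refine Finset.sum_congr rfl fun l _ => ?_
  rw [Matrix.diag_apply, LinearMap.toMatrix_apply, hA]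
  simp

end Diagonal

/-! ### Immersions into the unit sphere -/

/-- `f` is a smooth immersion of the open set `U` into the unit sphere, with smooth unit normal
field `ξ`. -/
structure IsSphereImmersion {n : ℕ} (f ξ : EuclideanSpace ℝ (Fin n) → EuclideanSpace ℝ (Fin (n + 2)))
    (U : Set (EuclideanSpace ℝ (Fin n))) : Prop where
  isOpen : IsOpen U
  contDiffOn : ContDiffOn ℝ ∞ f U
  contDiffOn_normal : ContDiffOn ℝ ∞ ξ U
  norm_eq : ∀ x ∈ U, ‖f x‖ = 1
  norm_normal : ∀ x ∈ U, ‖ξ x‖ = 1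
  inner_normal : ∀ x ∈ U, inner ℝ (f x) (ξ x) = 0
  inner_normal_fderiv : ∀ x ∈ U, ∀ v, inner ℝ (ξ x) (fderiv ℝ f x v) = 0
  injective : ∀ x ∈ U, Function.Injective (fderiv ℝ f x)

theorem inner_fderiv_add_eq_zero {E F : Type*} [NormedAddCommGroup E] [NormedSpace ℝ E]
    [NormedAddCommGroup F] [InnerProductSpace ℝ F] {f h : E → F} {x : E} {c : ℝ}
    (hf : DifferentiableAt ℝ f x) (hh : DifferentiableAt ℝ h x)
    (hc : ∀ᶠ y in nhds x, inner ℝ (f y) (h y) = c) (v : E) :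
    inner ℝ (f x) (fderiv ℝ h x v) + inner ℝ (fderiv ℝ f x v) (h x) = 0 := by
  rw [← fderiv_inner_apply ℝ hf hh, Filter.EventuallyEq.fderiv_eq hc]
  simp

namespace IsSphereImmersion

variable {n : ℕ} {f ξ : EuclideanSpace ℝ (Fin n) → EuclideanSpace ℝ (Fin (n + 2))}
  {U : Set (EuclideanSpace ℝ (Fin n))} {x : EuclideanSpace ℝ (Fin n)}

theorem contDiffAt (h : IsSphereImmersion f ξ U) (hx : x ∈ U) : ContDiffAt ℝ ∞ f x :=
  h.contDiffOn.contDiffAt (h.isOpen.mem_nhds hx)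

theorem contDiffAt_normal (h : IsSphereImmersion f ξ U) (hx : x ∈ U) : ContDiffAt ℝ ∞ ξ x :=
  h.contDiffOn_normal.contDiffAt (h.isOpen.mem_nhds hx)

theorem contDiffAt_fderiv (h : IsSphereImmersion f ξ U) (hx : x ∈ U) :
    ContDiffAt ℝ ∞ (fderiv ℝ f) x :=
  (h.contDiffAt hx).fderiv_right (by simp)

theorem differentiableAt (h : IsSphereImmersion f ξ U) (hx : x ∈ U) : DifferentiableAt ℝ f x :=
  (h.contDiffAt hx).differentiableAt (by simp)

theorem differentiableAt_normal (h : IsSphereImmersion f ξ U) (hx : x ∈ U) :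
    DifferentiableAt ℝ ξ x :=
  (h.contDiffAt_normal hx).differentiableAt (by simp)

theorem differentiableAt_fderiv (h : IsSphereImmersion f ξ U) (hx : x ∈ U) :
    DifferentiableAt ℝ (fderiv ℝ f) x :=
  (h.contDiffAt_fderiv hx).differentiableAt (by simp)

theorem eventually_mem (h : IsSphereImmersion f ξ U) (hx : x ∈ U) : ∀ᶠ y in nhds x, y ∈ U :=
  h.isOpen.mem_nhds hx

theorem inner_fderiv (h : IsSphereImmersion f ξ U) (hx : x ∈ U) (v) :
    inner ℝ (f x) (fderiv ℝ f x v) = 0 := by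
  have := inner_fderiv_add_eq_zero (c := 1) (h.differentiableAt hx) (h.differentiableAt hx)
    ((h.eventually_mem hx).mono fun y hy => by rw [real_inner_self_eq_norm_sq, h.norm_eq y hy]; simp) v
  rw [real_inner_comm] at this
  rw [real_inner_comm]
  linarith

theorem inner_normal_fderiv_normal (h : IsSphereImmersion f ξ U) (hx : x ∈ U) (v) :
    inner ℝ (ξ x) (fderiv ℝ ξ x v) = 0 := by
  have := inner_fderiv_add_eq_zero (c := 1) (h.differentiableAt_normal hx)
    (h.differentiableAt_normal hx) ((h.eventually_mem hx).mono fun y hy => by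
      rw [real_inner_self_eq_norm_sq, h.norm_normal y hy]; simp) v
  rw [real_inner_comm] at this
  rw [real_inner_comm]
  linarith

theorem inner_fderiv_normal (h : IsSphereImmersion f ξ U) (hx : x ∈ U) (v) :
    inner ℝ (f x) (fderiv ℝ ξ x v) = 0 := by
  have := inner_fderiv_add_eq_zero (h.differentiableAt hx)
    (h.differentiableAt_normal hx) ((h.eventually_mem hx).mono h.inner_normal) v
  have h1 := h.inner_normal_fderiv x hx v
  rw [real_inner_comm] at h1
  linarith

theorem fderiv_fderiv_symm (h : IsSphereImmersion f ξ U) (hx : x ∈ U) (v w) :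
    fderiv ℝ (fderiv ℝ f) x v w = fderiv ℝ (fderiv ℝ f) x w v :=
  (h.contDiffAt hx).isSymmSndFDerivAt (by simpa using WithTop.coe_le_coe.2 (le_top (a := (2 : ℕ∞)))) v w

theorem fderiv_fderiv_apply (h : IsSphereImmersion f ξ U) (hx : x ∈ U) (v w) :
    fderiv ℝ (fun y => fderiv ℝ f y w) x v = fderiv ℝ (fderiv ℝ f) x v w := by
  rw [fderiv_clm_apply (h.differentiableAt_fderiv hx) (differentiableAt_const w)]
  simp

theorem differentiableAt_fderiv_apply (h : IsSphereImmersion f ξ U) (hx : x ∈ U) (w) :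
    DifferentiableAt ℝ (fun y => fderiv ℝ f y w) x :=
  (h.differentiableAt_fderiv hx).clm_apply (differentiableAt_const w)

theorem inner_normal_fderiv_fderiv (h : IsSphereImmersion f ξ U) (hx : x ∈ U) (v w) :
    inner ℝ (ξ x) (fderiv ℝ (fderiv ℝ f) x v w) = -inner ℝ (fderiv ℝ ξ x v) (fderiv ℝ f x w) := by
  have := inner_fderiv_add_eq_zero (h.differentiableAt_normal hx)
    (h.differentiableAt_fderiv_apply hx w)
    ((h.eventually_mem hx).mono fun y hy => h.inner_normal_fderiv y hy w) v
  rw [h.fderiv_fderiv_apply hx] at this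
  linarith

theorem inner_fderiv_fderiv (h : IsSphereImmersion f ξ U) (hx : x ∈ U) (v w) :
    inner ℝ (f x) (fderiv ℝ (fderiv ℝ f) x v w) = -inner ℝ (fderiv ℝ f x v) (fderiv ℝ f x w) := by
  have := inner_fderiv_add_eq_zero (h.differentiableAt hx)
    (h.differentiableAt_fderiv_apply hx w)
    ((h.eventually_mem hx).mono fun y hy => h.inner_fderiv hy w) v
  rw [h.fderiv_fderiv_apply hx] at this
  linarith

theorem inner_fderiv_normal_symm (h : IsSphereImmersion f ξ U) (hx : x ∈ U) (v w) :
    inner ℝ (fderiv ℝ ξ x v) (fderiv ℝ f x w) = inner ℝ (fderiv ℝ f x v) (fderiv ℝ ξ x w) := by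
  have h1 := h.inner_normal_fderiv_fderiv hx v w
  rw [h.fderiv_fderiv_symm hx, h.inner_normal_fderiv_fderiv hx] at h1
  rw [real_inner_comm (fderiv ℝ ξ x w)]
  linarith

theorem exists_fderiv_eq (h : IsSphereImmersion f ξ U) (hx : x ∈ U)
    {z : EuclideanSpace ℝ (Fin (n + 2))} (h1 : inner ℝ (f x) z = 0) (h2 : inner ℝ (ξ x) z = 0) :
    ∃ w, fderiv ℝ f x w = z :=
  exists_apply_eq_of_orthogonal (h.injective x hx) (h.norm_eq x hx) (h.norm_normal x hx)
    (h.inner_normal x hx) (h.inner_fderiv hx) (h.inner_normal_fderiv x hx) h1 h2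

/-- The vectors `f x`, `ξ x` and the range of `fderiv ℝ f x` span the ambient space, so vector
identities can be checked on these three components. -/
theorem eq_of_forall_inner (h : IsSphereImmersion f ξ U) (hx : x ∈ U)
    {y z : EuclideanSpace ℝ (Fin (n + 2))} (h1 : inner ℝ (f x) y = inner ℝ (f x) z)
    (h2 : inner ℝ (ξ x) y = inner ℝ (ξ x) z)
    (h3 : ∀ w, inner ℝ (fderiv ℝ f x w) y = inner ℝ (fderiv ℝ f x w) z) : y = z := by
  obtain ⟨w, hw⟩ := h.exists_fderiv_eq hx (z := y - z) (by rw [inner_sub_right, h1, sub_self])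
    (by rw [inner_sub_right, h2, sub_self])
  have := h3 w
  rw [← sub_eq_zero, ← inner_sub_right, hw, inner_self_eq_zero] at this
  exact sub_eq_zero.1 this

end IsSphereImmersion

/-! ### The Gauss formula, the Gauss equation and the Ricci tensor in coordinates -/

namespace LocalGeometry

variable {n N : ℕ}

theorem fderiv_eq_sum_pderiv {F : Type*} [NormedAddCommGroup F] [NormedSpace ℝ F]
    (f : EuclideanSpace ℝ (Fin n) → F) (x v : EuclideanSpace ℝ (Fin n)) :
    fderiv ℝ f x v = ∑ i, v i • pderiv i f x := by
  conv_lhs => rw [← (EuclideanSpace.basisFun (Fin n) ℝ).sum_repr v]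
  simp [pderiv]

theorem firstForm_apply (f : EuclideanSpace ℝ (Fin n) → EuclideanSpace ℝ (Fin N))
    (x : EuclideanSpace ℝ (Fin n)) (i j : Fin n) :
    firstForm f x i j = inner ℝ (pderiv i f x) (pderiv j f x) := rfl

theorem secondForm_apply (f ξ : EuclideanSpace ℝ (Fin n) → EuclideanSpace ℝ (Fin N))
    (x : EuclideanSpace ℝ (Fin n)) (i j : Fin n) :
    secondForm f ξ x i j = -inner ℝ (pderiv i f x) (pderiv j ξ x) := rfl

theorem firstForm_transpose (f : EuclideanSpace ℝ (Fin n) → EuclideanSpace ℝ (Fin N))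
    (x : EuclideanSpace ℝ (Fin n)) : (firstForm f x).transpose = firstForm f x := by
  ext i j
  simp only [Matrix.transpose_apply, firstForm_apply]
  exact real_inner_comm _ _

theorem firstForm_mulVec (f : EuclideanSpace ℝ (Fin n) → EuclideanSpace ℝ (Fin N))
    (x : EuclideanSpace ℝ (Fin n)) (v : EuclideanSpace ℝ (Fin n)) (i : Fin n) :
    (firstForm f x).mulVec v i = inner ℝ (pderiv i f x) (fderiv ℝ f x v) := by
  simp [fderiv_eq_sum_pderiv, inner_sum, Matrix.mulVec, dotProduct, firstForm_apply,
    real_inner_smul_right, mul_comm]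

theorem secondForm_mulVec (f ξ : EuclideanSpace ℝ (Fin n) → EuclideanSpace ℝ (Fin N))
    (x : EuclideanSpace ℝ (Fin n)) (v : EuclideanSpace ℝ (Fin n)) (i : Fin n) :
    (secondForm f ξ x).mulVec v i = -inner ℝ (pderiv i f x) (fderiv ℝ ξ x v) := by
  simp [fderiv_eq_sum_pderiv, inner_sum, Matrix.mulVec, dotProduct, secondForm_apply,
    real_inner_smul_right, mul_comm]

theorem isUnit_det_firstForm {f : EuclideanSpace ℝ (Fin n) → EuclideanSpace ℝ (Fin N)}
    {x : EuclideanSpace ℝ (Fin n)} (h : Function.Injective (fderiv ℝ f x)) :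
    IsUnit (firstForm f x).det := by
  rw [isUnit_iff_ne_zero]
  intro h0
  obtain ⟨v, hv, hv0⟩ := Matrix.exists_mulVec_eq_zero_iff.2 h0
  apply hv
  have h1 : ∀ i, inner ℝ (pderiv i f x) (fderiv ℝ f x (WithLp.toLp 2 v)) = 0 := fun i => by
    rw [← firstForm_mulVec]
    exact congrFun hv0 i
  have h2 : inner ℝ (fderiv ℝ f x (WithLp.toLp 2 v)) (fderiv ℝ f x (WithLp.toLp 2 v)) = 0 := by
    conv_lhs => rw [fderiv_eq_sum_pderiv (v := WithLp.toLp 2 v), sum_inner]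
    refine Finset.sum_eq_zero fun i _ => ?_
    rw [real_inner_smul_left, ← fderiv_eq_sum_pderiv, h1, mul_zero]
  rw [inner_self_eq_zero] at h2
  have h3 : WithLp.toLp 2 v = (0 : EuclideanSpace ℝ (Fin n)) := h (h2.trans (map_zero _).symm)
  simpa using h3

/-- The vector `dξ v` is orthogonal to `f` and `ξ`, hence tangent; on tangent vectors the Gram
matrix can be cancelled. -/
theorem fderiv_weingarten {f ξ : EuclideanSpace ℝ (Fin n) → EuclideanSpace ℝ (Fin (n + 2))}
    {U : Set (EuclideanSpace ℝ (Fin n))} (h : IsSphereImmersion f ξ U)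
    {x : EuclideanSpace ℝ (Fin n)} (hx : x ∈ U) (v : EuclideanSpace ℝ (Fin n)) :
    fderiv ℝ f x (WithLp.toLp 2 ((weingarten f ξ x).mulVec v)) = -fderiv ℝ ξ x v := by
  obtain ⟨w, hw⟩ := h.exists_fderiv_eq hx (z := -fderiv ℝ ξ x v)
    (by rw [inner_neg_right, h.inner_fderiv_normal hx, neg_zero])
    (by rw [inner_neg_right, h.inner_normal_fderiv_normal hx, neg_zero])
  have h1 : (firstForm f x).mulVec w = (secondForm f ξ x).mulVec v := by
    ext i
    rw [firstForm_mulVec, secondForm_mulVec, hw, inner_neg_right]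
  rw [weingarten, ← Matrix.mulVec_mulVec, ← h1, Matrix.mulVec_mulVec,
    Matrix.nonsing_inv_mul _ (isUnit_det_firstForm (h.injective x hx)), Matrix.one_mulVec]
  exact hw

end LocalGeometry

namespace LocalGeometry

variable {n : ℕ} {f ξ : EuclideanSpace ℝ (Fin n) → EuclideanSpace ℝ (Fin (n + 2))}
  {U : Set (EuclideanSpace ℝ (Fin n))} {x : EuclideanSpace ℝ (Fin n)}

theorem pderiv_pderiv (h : IsSphereImmersion f ξ U) (hx : x ∈ U) (i j : Fin n) :
    pderiv i (pderiv j f) x =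
      fderiv ℝ (fderiv ℝ f) x (EuclideanSpace.single i 1) (EuclideanSpace.single j 1) :=
  h.fderiv_fderiv_apply hx _ _

theorem contDiffAt_pderiv {F : Type*} [NormedAddCommGroup F] [NormedSpace ℝ F]
    {f : EuclideanSpace ℝ (Fin n) → F} (h : ContDiffAt ℝ ∞ f x) (i : Fin n) :
    ContDiffAt ℝ ∞ (pderiv i f) x :=
  (h.fderiv_right (m := ∞) (by simp)).clm_apply contDiffAt_const

theorem pderiv_comm {F : Type*} [NormedAddCommGroup F] [NormedSpace ℝ F]
    {f : EuclideanSpace ℝ (Fin n) → F} (h : ContDiffAt ℝ ∞ f x) (i j : Fin n) :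
    pderiv i (pderiv j f) x = pderiv j (pderiv i f) x := by
  have hd : DifferentiableAt ℝ (fderiv ℝ f) x :=
    (h.fderiv_right (m := ∞) (by simp)).differentiableAt (by simp)
  have key : ∀ i j, pderiv i (pderiv j f) x =
      fderiv ℝ (fderiv ℝ f) x (EuclideanSpace.single i 1) (EuclideanSpace.single j 1) := by
    intro i j
    unfold pderiv
    rw [fderiv_clm_apply hd (differentiableAt_const _)]
    simp
  rw [key, key]
  exact h.isSymmSndFDerivAt (by simpa using WithTop.coe_le_coe.2 (le_top (a := (2 : ℕ∞)))) _ _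

theorem pderiv_congr {F : Type*} [NormedAddCommGroup F] [NormedSpace ℝ F]
    {f g : EuclideanSpace ℝ (Fin n) → F} (h : f =ᶠ[nhds x] g) (i : Fin n) :
    pderiv i f x = pderiv i g x := by
  rw [pderiv, pderiv, h.fderiv_eq]

theorem pderiv_inner {F : Type*} [NormedAddCommGroup F] [InnerProductSpace ℝ F]
    {f g : EuclideanSpace ℝ (Fin n) → F} (hf : DifferentiableAt ℝ f x)
    (hg : DifferentiableAt ℝ g x) (i : Fin n) :
    pderiv i (fun y => (inner ℝ (f y) (g y) : ℝ)) x =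
      inner ℝ (f x) (pderiv i g x) + inner ℝ (pderiv i f x) (g x) :=
  fderiv_inner_apply ℝ hf hg _

theorem differentiableAt_pderiv (h : IsSphereImmersion f ξ U) (hx : x ∈ U) (i : Fin n) :
    DifferentiableAt ℝ (pderiv i f) x :=
  (contDiffAt_pderiv (h.contDiffAt hx) i).differentiableAt (by simp)

theorem pderiv_firstForm (h : IsSphereImmersion f ξ U) (hx : x ∈ U) (l i j : Fin n) :
    pderiv l (fun y => firstForm f y i j) x =
      inner ℝ (pderiv i f x) (pderiv l (pderiv j f) x) +
        inner ℝ (pderiv l (pderiv i f) x) (pderiv j f x) :=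
  pderiv_inner (differentiableAt_pderiv h hx i) (differentiableAt_pderiv h hx j) l

/-- Expanding the derivatives of the metric gives six terms; by symmetry of second derivatives four
cancel and the other two agree. -/
theorem christoffel_firstForm (h : IsSphereImmersion f ξ U) (hx : x ∈ U) (k i j : Fin n) :
    christoffel (firstForm f) k i j x =
      ∑ l, (firstForm f x)⁻¹ k l * inner ℝ (pderiv i (pderiv j f) x) (pderiv l f x) := by
  rw [christoffel, Finset.mul_sum]
  refine Finset.sum_congr rfl fun l _ => ?_
  rw [pderiv_firstForm h hx, pderiv_firstForm h hx, pderiv_firstForm h hx,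
    pderiv_comm (h.contDiffAt hx) j i, pderiv_comm (h.contDiffAt hx) l i,
    pderiv_comm (h.contDiffAt hx) l j,
    real_inner_comm (pderiv i (pderiv l f) x) (pderiv j f x)]
  ring

theorem sum_christoffel_mul_firstForm (h : IsSphereImmersion f ξ U) (hx : x ∈ U) (i j m : Fin n) :
    ∑ k, christoffel (firstForm f) k i j x * firstForm f x k m =
      inner ℝ (pderiv i (pderiv j f) x) (pderiv m f x) := by
  have hG := Matrix.mul_nonsing_inv _ (isUnit_det_firstForm (h.injective x hx))
  have hs : ∀ k, firstForm f x k m = firstForm f x m k := fun k =>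
    congrFun (congrFun (firstForm_transpose f x) m) k
  simp_rw [christoffel_firstForm h hx, Finset.sum_mul]
  rw [Finset.sum_comm]
  have : ∀ l, ∑ k, (firstForm f x)⁻¹ k l * inner ℝ (pderiv i (pderiv j f) x) (pderiv l f x) *
      firstForm f x k m = inner ℝ (pderiv i (pderiv j f) x) (pderiv l f x) *
        (firstForm f x * (firstForm f x)⁻¹) m l := by
    intro l
    rw [Matrix.mul_apply, Finset.mul_sum]
    refine Finset.sum_congr rfl fun k _ => ?_
    rw [hs]
    ring
  simp_rw [this, hG, Matrix.one_apply]
  simp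

/-- Gauss formula, checked on components. The `f`-component is minus the metric, by differentiating
`⟪f, ∂ⱼ f⟫ = 0`; it is the source of the curvature of the sphere. -/
theorem pderiv_pderiv_eq (h : IsSphereImmersion f ξ U) (hx : x ∈ U) (i j : Fin n) :
    pderiv i (pderiv j f) x = ∑ k, christoffel (firstForm f) k i j x • pderiv k f x +
      secondForm f ξ x i j • ξ x - firstForm f x i j • f x := by
  have hff : inner ℝ (f x) (f x) = (1 : ℝ) := by
    rw [real_inner_self_eq_norm_sq, h.norm_eq x hx, one_pow]
  have hnn : inner ℝ (ξ x) (ξ x) = (1 : ℝ) := by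
    rw [real_inner_self_eq_norm_sq, h.norm_normal x hx, one_pow]
  have hfn := h.inner_normal x hx
  have hnf : inner ℝ (ξ x) (f x) = (0 : ℝ) := by rw [real_inner_comm, hfn]
  have hfd : ∀ k, inner ℝ (f x) (pderiv k f x) = (0 : ℝ) := fun k => h.inner_fderiv hx _
  have hnd : ∀ k, inner ℝ (ξ x) (pderiv k f x) = (0 : ℝ) := fun k => h.inner_normal_fderiv x hx _
  refine h.eq_of_forall_inner hx ?_ ?_ fun w => ?_
  · simp only [inner_sub_right, inner_add_right, inner_sum, real_inner_smul_right, hfd, hfn, hff]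
    rw [pderiv_pderiv h hx, h.inner_fderiv_fderiv hx, firstForm_apply]
    simp [pderiv]
  · simp only [inner_sub_right, inner_add_right, inner_sum, real_inner_smul_right, hnd, hnf, hnn]
    rw [pderiv_pderiv h hx, h.inner_normal_fderiv_fderiv hx, secondForm_apply,
      h.inner_fderiv_normal_symm hx]
    simp [pderiv]
  · rw [fderiv_eq_sum_pderiv, sum_inner, sum_inner]
    refine Finset.sum_congr rfl fun m _ => ?_
    rw [real_inner_smul_left, real_inner_smul_left]
    congr 1
    simp only [inner_sub_right, inner_add_right, inner_sum, real_inner_smul_right]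
    rw [real_inner_comm (ξ x), hnd, real_inner_comm (f x), hfd, real_inner_comm,
      ← sum_christoffel_mul_firstForm h hx]
    simp only [mul_zero, add_zero, sub_zero]
    refine Finset.sum_congr rfl fun k _ => ?_
    rw [firstForm_apply, real_inner_comm]

/-- The entries of the inverse metric are cofactors divided by the determinant, hence rational in
the metric. -/
theorem differentiableAt_christoffel (h : IsSphereImmersion f ξ U) (hx : x ∈ U) (k i j : Fin n) :
    DifferentiableAt ℝ (christoffel (firstForm f) k i j) x := by
  have hev : christoffel (firstForm f) k i j =ᶠ[nhds x] fun y =>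
      ∑ l, (firstForm f y)⁻¹ k l * inner ℝ (pderiv i (pderiv j f) y) (pderiv l f y) :=
    (h.eventually_mem hx).mono fun y hy => christoffel_firstForm h hy k i j
  refine DifferentiableAt.congr_of_eventuallyEq ?_ hev
  have hG : ∀ i j, DifferentiableAt ℝ (fun y => firstForm f y i j) x := fun i j =>
    (differentiableAt_pderiv h hx i).inner ℝ (differentiableAt_pderiv h hx j)
  have hdet : ∀ A : EuclideanSpace ℝ (Fin n) → Matrix (Fin n) (Fin n) ℝ,
      (∀ i j, DifferentiableAt ℝ (fun y => A y i j) x) →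
        DifferentiableAt ℝ (fun y => (A y).det) x := by
    intro A hA
    simp only [Matrix.det_apply]
    refine DifferentiableAt.fun_sum fun σ _ => DifferentiableAt.const_smul ?_ _
    exact (HasFDerivAt.finsetProd fun i _ => (hA (σ i) i).hasFDerivAt).differentiableAt
  have hadj : ∀ l, DifferentiableAt ℝ (fun y => (firstForm f y).adjugate k l) x := by
    intro l
    simp only [Matrix.adjugate_apply]
    refine hdet _ fun a b => ?_
    by_cases hal : a = l
    · subst hal
      simp
    · simpa [Matrix.updateRow_ne hal] using hG a b
  refine DifferentiableAt.fun_sum fun l _ => DifferentiableAt.mul ?_ ?_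
  · simp only [Matrix.inv_def, Ring.inverse_eq_inv', Matrix.smul_apply, smul_eq_mul]
    exact ((hdet _ hG).inv (isUnit_det_firstForm (h.injective x hx)).ne_zero).mul (hadj l)
  · exact ((contDiffAt_pderiv (contDiffAt_pderiv (h.contDiffAt hx) j) i).differentiableAt
      (by simp)).inner ℝ (differentiableAt_pderiv h hx l)

/-- The tangential part of the third derivatives of an immersion into the sphere. -/
theorem sum_pderiv_christoffel (h : IsSphereImmersion f ξ U) (hx : x ∈ U) (i j k m : Fin n) :
    ∑ q, (pderiv i (christoffel (firstForm f) q j k) x +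
        ∑ p, christoffel (firstForm f) q i p x * christoffel (firstForm f) p j k x) *
          firstForm f x q m =
      inner ℝ (pderiv i (pderiv j (pderiv k f)) x) (pderiv m f x) +
        secondForm f ξ x j k * secondForm f ξ x i m + firstForm f x j k * firstForm f x i m := by
  have hnd : ∀ k, inner ℝ (ξ x) (pderiv k f x) = (0 : ℝ) := fun k => h.inner_normal_fderiv x hx _
  have hfd : ∀ k, inner ℝ (f x) (pderiv k f x) = (0 : ℝ) := fun k => h.inner_fderiv hx _
  have hev : pderiv j (pderiv k f) =ᶠ[nhds x] fun y =>
      ∑ q, christoffel (firstForm f) q j k y • pderiv q f y +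
        secondForm f ξ y j k • ξ y - firstForm f y j k • f y :=
    (h.eventually_mem hx).mono fun y hy => pderiv_pderiv_eq h hy j k
  have hΓ := fun q => differentiableAt_christoffel h hx q j k
  have hf := fun q => differentiableAt_pderiv h hx q
  have hxi := h.differentiableAt_normal hx
  have hf0 := h.differentiableAt hx
  have hII : DifferentiableAt ℝ (fun y => secondForm f ξ y j k) x :=
    ((hf j).inner ℝ ((contDiffAt_pderiv (h.contDiffAt_normal hx) k).differentiableAt
      (by simp))).neg
  have hI : DifferentiableAt ℝ (fun y => firstForm f y j k) x := (hf j).inner ℝ (hf k)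
  have hder : pderiv i (pderiv j (pderiv k f)) x =
      ∑ q, (christoffel (firstForm f) q j k x • pderiv i (pderiv q f) x +
          pderiv i (christoffel (firstForm f) q j k) x • pderiv q f x) +
        (secondForm f ξ x j k • pderiv i ξ x +
          pderiv i (fun y => secondForm f ξ y j k) x • ξ x) -
        (firstForm f x j k • pderiv i f x + pderiv i (fun y => firstForm f y j k) x • f x) := by
    rw [pderiv_congr hev]
    have h1 := HasFDerivAt.fun_sum (u := Finset.univ) fun q _ =>
      (hΓ q).hasFDerivAt.smul (hf q).hasFDerivAt
    have h2 := ((h1.add (hII.hasFDerivAt.smul hxi.hasFDerivAt)).sub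
      (hI.hasFDerivAt.smul hf0.hasFDerivAt)).fderiv
    have h3 := congrArg (fun L => L (EuclideanSpace.single i (1 : ℝ))) h2
    refine h3.trans ?_
    simp [pderiv]
  have hs : secondForm f ξ x i m = -inner ℝ (pderiv i ξ x) (pderiv m f x) := by
    rw [secondForm_apply]
    exact congrArg _ (h.inner_fderiv_normal_symm hx _ _).symm
  rw [hder, hs]
  simp only [inner_sub_left, inner_add_left, sum_inner, real_inner_smul_left, hnd, hfd,
    ← sum_christoffel_mul_firstForm h hx, Finset.sum_add_distrib, add_mul, Finset.sum_mul,
    Finset.mul_sum, ← firstForm_apply]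
  have hcomm : ∑ q, ∑ p, christoffel (firstForm f) q i p x * christoffel (firstForm f) p j k x *
      firstForm f x q m = ∑ p, ∑ q, christoffel (firstForm f) p j k x *
        (christoffel (firstForm f) q i p x * firstForm f x q m) := by
    rw [Finset.sum_comm]
    exact Finset.sum_congr rfl fun p _ => Finset.sum_congr rfl fun q _ => by ring
  rw [hcomm]
  ring

/-- Antisymmetrizing the tangential third derivatives in `i`, `j` removes the third derivatives
themselves. -/
theorem sum_riemann_mul_firstForm (h : IsSphereImmersion f ξ U) (hx : x ∈ U) (i j k m : Fin n) :
    ∑ q, riemann (firstForm f) q k i j x * firstForm f x q m =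
      secondForm f ξ x j k * secondForm f ξ x i m - secondForm f ξ x i k * secondForm f ξ x j m +
        (firstForm f x j k * firstForm f x i m - firstForm f x i k * firstForm f x j m) := by
  have h1 := sum_pderiv_christoffel h hx i j k m
  have h2 := sum_pderiv_christoffel h hx j i k m
  rw [pderiv_comm (contDiffAt_pderiv (h.contDiffAt hx) k) j i] at h2
  have h3 : ∑ q, riemann (firstForm f) q k i j x * firstForm f x q m =
      ∑ q, (pderiv i (christoffel (firstForm f) q j k) x +
        ∑ p, christoffel (firstForm f) q i p x * christoffel (firstForm f) p j k x) *
          firstForm f x q m -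
      ∑ q, (pderiv j (christoffel (firstForm f) q i k) x +
        ∑ p, christoffel (firstForm f) q j p x * christoffel (firstForm f) p i k x) *
          firstForm f x q m := by
    rw [← Finset.sum_sub_distrib]
    refine Finset.sum_congr rfl fun q _ => ?_
    rw [riemann, Finset.sum_sub_distrib]
    ring
  rw [h3, h1, h2]
  ring

theorem secondForm_symm (h : IsSphereImmersion f ξ U) (hx : x ∈ U) (i j : Fin n) :
    secondForm f ξ x i j = secondForm f ξ x j i := by
  rw [secondForm_apply, secondForm_apply, real_inner_comm]
  exact congrArg _ (h.inner_fderiv_normal_symm hx _ _)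

/-- The **Gauss equation**. -/
theorem riemann_firstForm (h : IsSphereImmersion f ξ U) (hx : x ∈ U) (q i j k : Fin n) :
    riemann (firstForm f) q k i j x =
      secondForm f ξ x j k * weingarten f ξ x q i - secondForm f ξ x i k * weingarten f ξ x q j +
        (firstForm f x j k * (1 : Matrix (Fin n) (Fin n) ℝ) q i -
          firstForm f x i k * (1 : Matrix (Fin n) (Fin n) ℝ) q j) := by
  have hG := Matrix.nonsing_inv_mul _ (isUnit_det_firstForm (h.injective x hx))
  have hs : ∀ k m, firstForm f x k m = firstForm f x m k := fun k m =>
    congrFun (congrFun (firstForm_transpose f x) m) k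
  have h1 : (firstForm f x).mulVec (fun q => riemann (firstForm f) q k i j x) = fun m =>
      secondForm f ξ x j k * secondForm f ξ x m i - secondForm f ξ x i k * secondForm f ξ x m j +
        (firstForm f x j k * firstForm f x m i - firstForm f x i k * firstForm f x m j) := by
    ext m
    rw [secondForm_symm h hx m i, secondForm_symm h hx m j, hs m i, hs m j,
      ← sum_riemann_mul_firstForm h hx]
    simp only [Matrix.mulVec, dotProduct, hs m, mul_comm]
  have h2 := congrArg (fun v => (firstForm f x)⁻¹.mulVec v q) h1
  simp only [Matrix.mulVec_mulVec, hG, Matrix.one_mulVec] at h2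
  rw [h2, weingarten, ← hG]
  simp only [Matrix.mulVec, dotProduct, Matrix.mul_apply, Finset.mul_sum,
    ← Finset.sum_sub_distrib, ← Finset.sum_add_distrib]
  exact Finset.sum_congr rfl fun m _ => by ring

theorem ricci_firstForm (h : IsSphereImmersion f ξ U) (hx : x ∈ U) (j k : Fin n) :
    ricci (firstForm f) j k x =
      (weingarten f ξ x).trace * secondForm f ξ x j k -
        (secondForm f ξ x * weingarten f ξ x) k j + ((n : ℝ) - 1) * firstForm f x j k := by
  have h1 : ∑ i, firstForm f x i k * (1 : Matrix (Fin n) (Fin n) ℝ) i j = firstForm f x j k := by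
    simp [Matrix.one_apply]
  rw [ricci]
  simp_rw [riemann_firstForm h hx]
  rw [Finset.sum_add_distrib, Finset.sum_sub_distrib, Finset.sum_sub_distrib, h1,
    Matrix.mul_apply, Matrix.trace, Finset.sum_mul]
  simp_rw [secondForm_symm h hx k, Matrix.one_apply_eq, Matrix.diag_apply]
  rw [Finset.sum_const, Finset.card_univ, Fintype.card_fin, nsmul_eq_mul]
  rw [Finset.sum_congr rfl fun i _ => mul_comm (secondForm f ξ x j k) (weingarten f ξ x i i)]
  ring

/-- Since `dξ = -df ∘ A`, this is `(n - 1) I + (tr A) II - III`, a form that a principal frame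
diagonalizes. -/
theorem sum_ricci_firstForm (h : IsSphereImmersion f ξ U) (hx : x ∈ U)
    (v w : EuclideanSpace ℝ (Fin n)) :
    ∑ j, ∑ k, ricci (firstForm f) j k x * v j * w k =
      ((n : ℝ) - 1) * inner ℝ (fderiv ℝ f x v) (fderiv ℝ f x w) -
        (weingarten f ξ x).trace * inner ℝ (fderiv ℝ f x v) (fderiv ℝ ξ x w) -
        inner ℝ (fderiv ℝ ξ x v) (fderiv ℝ ξ x w) := by
  have hI : ∀ v w : EuclideanSpace ℝ (Fin n), ∑ j, ∑ k, firstForm f x j k * v j * w k =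
      inner ℝ (fderiv ℝ f x v) (fderiv ℝ f x w) := by
    intro v w
    rw [fderiv_eq_sum_pderiv f x v, sum_inner]
    refine Finset.sum_congr rfl fun j _ => ?_
    rw [real_inner_smul_left, ← firstForm_mulVec, Matrix.mulVec, dotProduct, Finset.mul_sum]
    exact Finset.sum_congr rfl fun k _ => by ring
  have hII : ∀ v w : EuclideanSpace ℝ (Fin n), ∑ j, ∑ k, secondForm f ξ x j k * v j * w k =
      -inner ℝ (fderiv ℝ f x v) (fderiv ℝ ξ x w) := by
    intro v w
    rw [fderiv_eq_sum_pderiv f x v, sum_inner, ← Finset.sum_neg_distrib]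
    refine Finset.sum_congr rfl fun j _ => ?_
    rw [real_inner_smul_left, ← mul_neg, ← secondForm_mulVec, Matrix.mulVec, dotProduct,
      Finset.mul_sum]
    exact Finset.sum_congr rfl fun k _ => by ring
  have hIII : ∑ j, ∑ k, (secondForm f ξ x * weingarten f ξ x) k j * v j * w k =
      inner ℝ (fderiv ℝ ξ x v) (fderiv ℝ ξ x w) := by
    have h1 := hII w (WithLp.toLp 2 ((weingarten f ξ x).mulVec v))
    rw [h.inner_fderiv_normal_symm hx w _ |>.symm, fderiv_weingarten h hx, inner_neg_right,
      neg_neg, real_inner_comm] at h1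
    rw [← h1, Finset.sum_comm]
    refine Finset.sum_congr rfl fun k _ => ?_
    simp only [Matrix.mulVec, dotProduct, Matrix.mul_apply, Finset.mul_sum, Finset.sum_mul]
    rw [Finset.sum_comm]
    exact Finset.sum_congr rfl fun l _ => Finset.sum_congr rfl fun j _ => by ring
  simp_rw [ricci_firstForm h hx]
  generalize (n : ℝ) - 1 = c
  simp_rw [add_mul, sub_mul, Finset.sum_add_distrib, Finset.sum_sub_distrib, hIII]
  have e1 : ∑ j, ∑ k, c * firstForm f x j k * v j * w k =
      c * inner ℝ (fderiv ℝ f x v) (fderiv ℝ f x w) := by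
    simp_rw [← hI, Finset.mul_sum, mul_assoc]
  have e2 : ∑ j, ∑ k, (weingarten f ξ x).trace * secondForm f ξ x j k * v j * w k =
      -((weingarten f ξ x).trace * inner ℝ (fderiv ℝ f x v) (fderiv ℝ ξ x w)) := by
    rw [← mul_neg, ← hII]
    simp_rw [Finset.mul_sum, mul_assoc]
  rw [e1, e2]
  ring

end LocalGeometry

/-! ### From charts to principal frames and the Ricci curvature of an isoparametric hypersurface -/

theorem fderiv_comp_extChartAt_symm {n N : ℕ} {X : Type*} [TopologicalSpace X]
    [ChartedSpace (EuclideanSpace ℝ (Fin n)) X] {h : X → EuclideanSpace ℝ (Fin N)} {p : X}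
    (hh : MDifferentiableAt (𝓡 n) (𝓡 N) h p) :
    fderiv ℝ (h ∘ (extChartAt (𝓡 n) p).symm) (extChartAt (𝓡 n) p p) =
      mfderiv (𝓡 n) (𝓡 N) h p := by
  rw [hh.mfderiv]
  simp [writtenInExtChartAt, Function.comp_def, chartAt_self_eq]

/-- The principal curvatures are defined only at the centre of each preferred chart. At another
point of that chart, `L` is the differential of the change to the chart centred there. It is the
same for all `h`, so it serves the immersion and the normal field at once. -/
theorem exists_fderiv_comp_extChartAt_symm_eq {n : ℕ} {X : Type*} [TopologicalSpace X]
    [ChartedSpace (EuclideanSpace ℝ (Fin n)) X] [IsManifold (𝓡 n) ∞ X] (p : X)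
    {x : EuclideanSpace ℝ (Fin n)} (hx : x ∈ (extChartAt (𝓡 n) p).target) :
    ∃ L : EuclideanSpace ℝ (Fin n) ≃L[ℝ] EuclideanSpace ℝ (Fin n),
      ∀ (N : ℕ) (h : X → EuclideanSpace ℝ (Fin N)), MDifferentiable (𝓡 n) (𝓡 N) h → ∀ v,
        fderiv ℝ (h ∘ (extChartAt (𝓡 n) p).symm) x v =
          fderiv ℝ (h ∘ (extChartAt (𝓡 n) ((extChartAt (𝓡 n) p).symm x)).symm)
            (extChartAt (𝓡 n) ((extChartAt (𝓡 n) p).symm x) ((extChartAt (𝓡 n) p).symm x))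
              (L v) := by
  have : IsManifold (𝓡 n) 1 X := IsManifold.of_le (n := ∞) (by simp)
  obtain ⟨L, hL⟩ := isInvertible_mfderivWithin_extChartAt_symm (I := 𝓡 n) hx
  refine ⟨L, fun N h hh v => ?_⟩
  rw [fderiv_comp_extChartAt_symm (hh _)]
  have h1 := mdifferentiableWithinAt_extChartAt_symm (I := 𝓡 n) hx
  simp only [modelWithCornersSelf_coe, Set.range_id, mdifferentiableWithinAt_univ,
    mfderivWithin_univ] at h1 hL
  rw [← mfderiv_eq_fderiv, mfderiv_comp x (hh _) h1, ← hL]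
  rfl

namespace SphereHypersurface

variable {n : ℕ} (M : SphereHypersurface.{u} n)

theorem mdifferentiable_toFun : MDifferentiable (𝓡 n) (𝓡 (n + 2)) M.toFun :=
  M.mdifferentiableAt_toFun

theorem mdifferentiable_normal : MDifferentiable (𝓡 n) (𝓡 (n + 2)) M.normal :=
  M.mdifferentiableAt_normal

theorem contDiffOn_comp_extChartAt_symm {N : ℕ} {X : Type*} [TopologicalSpace X]
    [ChartedSpace (EuclideanSpace ℝ (Fin n)) X] [IsManifold (𝓡 n) ∞ X]
    {h : X → EuclideanSpace ℝ (Fin N)} (hh : ContMDiff (𝓡 n) (𝓡 N) ∞ h) (p : X) :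
    ContDiffOn ℝ ∞ (h ∘ (extChartAt (𝓡 n) p).symm) (extChartAt (𝓡 n) p).target := by
  rw [← contMDiffOn_iff_contDiffOn]
  exact hh.comp_contMDiffOn (contMDiffOn_extChartAt_symm p)

theorem isSphereImmersion (p : M.carrier) :
    IsSphereImmersion (M.param p) (M.normalParam p) (extChartAt (𝓡 n) p).target where
  isOpen := isOpen_extChartAt_target p
  contDiffOn := contDiffOn_comp_extChartAt_symm M.smooth_toFun p
  contDiffOn_normal := contDiffOn_comp_extChartAt_symm M.smooth_normal p
  norm_eq x _ := M.norm_toFun _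
  norm_normal x _ := M.norm_normal _
  inner_normal x _ := M.inner_toFun_normal _
  inner_normal_fderiv x hx v := by
    obtain ⟨L, hL⟩ := exists_fderiv_comp_extChartAt_symm_eq p hx
    rw [param, hL _ _ M.mdifferentiable_toFun, fderiv_comp_extChartAt_symm (M.mdifferentiableAt_toFun _)]
    exact M.inner_normal_mfderiv _ _
  injective x hx := by
    obtain ⟨L, hL⟩ := exists_fderiv_comp_extChartAt_symm_eq p hx
    intro v w hvw
    rw [param, hL _ _ M.mdifferentiable_toFun, hL _ _ M.mdifferentiable_toFun,
      fderiv_comp_extChartAt_symm (M.mdifferentiableAt_toFun _)] at hvw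
    exact L.injective (M.immersion _ hvw)

theorem exists_isEigenFrame {g : ℕ} {κ : Fin g → ℝ} {m : Fin g → ℕ} (hM : M.IsIsoparametric κ m)
    (p : M.carrier) :
    ∃ e, IsEigenFrame (fderiv ℝ (M.param p) (extChartAt (𝓡 n) p p))
      (fderiv ℝ (M.normalParam p) (extChartAt (𝓡 n) p p)) κ m e := by
  have hS := M.isSphereImmersion p
  have hx := mem_extChartAt_target (I := 𝓡 n) p
  have hw := LocalGeometry.fderiv_weingarten hS hx
  have hinj := hS.injective _ hx
  have hsymm := hS.inner_fderiv_normal_symm hx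
  have heig := hM.principalCurvature_iff p
  have hmul := hM.multiplicity_eq p
  simp only [IsPrincipalCurvature, multiplicity, shapeMatrix] at heig hmul
  set x := extChartAt (𝓡 n) p p
  set W := LocalGeometry.weingarten (M.param p) (M.normalParam p) x
  set T : (Fin n → ℝ) ≃ₗ[ℝ] EuclideanSpace ℝ (Fin n) := (WithLp.linearEquiv 2 ℝ (Fin n → ℝ)).symm
  have hT : ∀ v : Fin n → ℝ, fderiv ℝ (M.param p) x (T (Matrix.toLin' W v)) =
      -fderiv ℝ (M.normalParam p) x (T v) := fun v => hw (T v)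
  obtain ⟨e, he, he'⟩ := exists_orthonormal_eigenbasis
    (a := (fderiv ℝ (M.param p) x).toLinearMap ∘ₗ T.toLinearMap) (hinj.comp T.injective)
    (A := Matrix.toLin' W) (fun v w => by
      simp only [LinearMap.comp_apply, LinearEquiv.coe_coe, ContinuousLinearMap.coe_coe, hT]
      rw [inner_neg_left, inner_neg_right, hsymm])
    hM.strictAnti.injective (fun c => (heig c).1) hmul
  refine ⟨e.map T, by simpa using he, fun l => ?_⟩
  have := hT (e l)
  rw [he' l, map_smul, map_smul] at this
  rw [Module.Basis.map_apply, neg_smul, this, neg_neg]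

theorem pos_of_isIsoparametric {g : ℕ} {κ : Fin g → ℝ} {m : Fin g → ℕ}
    (hM : M.IsIsoparametric κ m) (i : Fin g) : 0 < m i := by
  obtain ⟨p⟩ := M.nonempty
  have h1 := (hM.principalCurvature_iff p (κ i)).2 ⟨i, rfl⟩
  rw [← hM.multiplicity_eq p i]
  have := Submodule.nontrivial_iff_ne_bot.2 (Module.End.hasEigenvalue_iff.1 h1)
  exact Module.finrank_pos

theorem exists_basis_of_isEigenFrame {g : ℕ} {κ : Fin g → ℝ} {m : Fin g → ℕ} {p : M.carrier}
    {e : Module.Basis (Σ i, Fin (m i)) ℝ (EuclideanSpace ℝ (Fin n))}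
    (he : IsEigenFrame (fderiv ℝ (M.param p) (extChartAt (𝓡 n) p p))
      (fderiv ℝ (M.normalParam p) (extChartAt (𝓡 n) p p)) κ m e) :
    ∃ e' : Module.Basis (Σ i, Fin (m i)) ℝ (Fin n → ℝ), (∀ l, WithLp.toLp 2 (e' l) = e l) ∧
      ∀ l, Matrix.toLin' (M.shapeMatrix p) (e' l) = κ l.1 • e' l := by
  have hS := M.isSphereImmersion p
  have hx := mem_extChartAt_target (I := 𝓡 n) p
  refine ⟨e.map (WithLp.linearEquiv 2 ℝ (Fin n → ℝ)), fun l => by simp, fun l => ?_⟩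
  apply WithLp.toLp_injective 2
  apply hS.injective _ hx
  have h1 := LocalGeometry.fderiv_weingarten hS hx (e l)
  rw [he.2 l, neg_smul, neg_neg] at h1
  rw [WithLp.toLp_smul, map_smul]
  exact h1

/-- Converse of `exists_isEigenFrame`; it recognizes the parallel hypersurfaces as isoparametric. -/
theorem isIsoparametric_of_isEigenFrame {g : ℕ} {κ : Fin g → ℝ} {m : Fin g → ℕ}
    (hκ : StrictAnti κ) (hm : ∀ i, 0 < m i)
    (he : ∀ p, ∃ e, IsEigenFrame (fderiv ℝ (M.param p) (extChartAt (𝓡 n) p p))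
      (fderiv ℝ (M.normalParam p) (extChartAt (𝓡 n) p p)) κ m e) :
    M.IsIsoparametric κ m where
  strictAnti := hκ
  principalCurvature_iff p c := by
    obtain ⟨e, he⟩ := he p
    obtain ⟨e', -, he'⟩ := M.exists_basis_of_isEigenFrame he
    rw [IsPrincipalCurvature, hasEigenvalue_iff_of_diagonal e' he']
    exact ⟨fun ⟨l, hl⟩ => ⟨l.1, hl⟩, fun ⟨i, hi⟩ => ⟨⟨i, 0, hm i⟩, hi⟩⟩
  multiplicity_eq p i := by
    obtain ⟨e, he⟩ := he p
    obtain ⟨e', -, he'⟩ := M.exists_basis_of_isEigenFrame he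
    rw [multiplicity, finrank_eigenspace_of_diagonal e' he']
    have : {l : Σ i, Fin (m i) // κ l.1 = κ i} ≃ Fin (m i) :=
      (Equiv.subtypeEquivRight fun l => by rw [hκ.injective.eq_iff]).trans
        (Equiv.sigmaSubtype i)
    rw [Nat.card_congr this, Nat.card_fin]

variable {M} {g : ℕ} {κ : Fin g → ℝ} {m : Fin g → ℕ}

theorem IsIsoparametric.meanCurvature_eq (hM : M.IsIsoparametric κ m) (p : M.carrier) :
    M.meanCurvature p = ∑ i, m i * κ i := by
  obtain ⟨e, he⟩ := M.exists_isEigenFrame hM p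
  obtain ⟨e', -, he'⟩ := M.exists_basis_of_isEigenFrame he
  rw [meanCurvature, ← Matrix.trace_toLin'_eq, trace_of_diagonal e' he', Fintype.sum_sigma]
  simp

theorem IsIsoparametric.sum_eq (hM : M.IsIsoparametric κ m) : ∑ i, m i = n := by
  obtain ⟨p⟩ := M.nonempty
  obtain ⟨e, he⟩ := M.exists_isEigenFrame hM p
  have := Module.finrank_eq_card_basis e
  rw [finrank_euclideanSpace_fin] at this
  rw [this]
  simp

/-- The Ricci curvature in a principal direction with principal curvature `c`, for the principal
curvatures `κ` with multiplicities `m`. -/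
noncomputable def principalRicci (κ : Fin g → ℝ) (m : Fin g → ℕ) (c : ℝ) : ℝ :=
  (∑ i, (m i : ℝ)) - 1 + (∑ i, m i * κ i) * c - c ^ 2

theorem IsIsoparametric.ricci_self (hM : M.IsIsoparametric κ m) {p : M.carrier}
    {e : Module.Basis (Σ i, Fin (m i)) ℝ (EuclideanSpace ℝ (Fin n))}
    (he : IsEigenFrame (fderiv ℝ (M.param p) (extChartAt (𝓡 n) p p))
      (fderiv ℝ (M.normalParam p) (extChartAt (𝓡 n) p p)) κ m e)
    (v : EuclideanSpace ℝ (Fin n)) :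
    M.ricci p v v = ∑ l, principalRicci κ m (κ l.1) * e.repr v l ^ 2 := by
  have hS := M.isSphereImmersion p
  have hx := mem_extChartAt_target (I := 𝓡 n) p
  rw [ricci, LocalGeometry.sum_ricci_firstForm hS hx]
  have hH : (LocalGeometry.weingarten (M.param p) (M.normalParam p)
      (extChartAt (𝓡 n) p p)).trace = ∑ i, m i * κ i := hM.meanCurvature_eq p
  have hn : (n : ℝ) = ∑ i, (m i : ℝ) := by rw [← hM.sum_eq, Nat.cast_sum]
  rw [hH, hn]
  set a := fderiv ℝ (M.param p) (extChartAt (𝓡 n) p p)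
  set b := fderiv ℝ (M.normalParam p) (extChartAt (𝓡 n) p p)
  have ha : a v = ∑ l, e.repr v l • a (e l) := by
    conv_lhs => rw [← e.sum_repr v]
    rw [map_sum]
    exact Finset.sum_congr rfl fun l _ => map_smul _ _ _
  have hb : b v = ∑ l, (-κ l.1 * e.repr v l) • a (e l) := by
    conv_lhs => rw [← e.sum_repr v]
    rw [map_sum]
    exact Finset.sum_congr rfl fun l _ => by rw [map_smul, he.2, smul_smul, mul_comm]
  rw [ha, hb, he.1.inner_sum, he.1.inner_sum, he.1.inner_sum, Finset.mul_sum, Finset.mul_sum,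
    ← Finset.sum_sub_distrib, ← Finset.sum_sub_distrib]
  refine Finset.sum_congr rfl fun l _ => ?_
  rw [principalRicci]
  simp
  ring

theorem IsIsoparametric.ricciPositive (hM : M.IsIsoparametric κ m)
    (h : ∀ i, 0 < principalRicci κ m (κ i)) : M.RicciPositive := by
  intro p (v : EuclideanSpace ℝ (Fin n)) (hv : v ≠ (0 : EuclideanSpace ℝ (Fin n)))
  obtain ⟨e, he⟩ := M.exists_isEigenFrame hM p
  rw [hM.ricci_self he]
  obtain ⟨l, hl⟩ : ∃ l, e.repr v l ≠ 0 := by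
    by_contra! h0
    exact hv (e.ext_elem_iff.2 fun l => by simpa using h0 l)
  exact Finset.sum_pos' (fun l _ => mul_nonneg (h l.1).le (sq_nonneg _))
    ⟨l, Finset.mem_univ _, mul_pos (h l.1) (by positivity)⟩

theorem IsIsoparametric.not_ricciNonneg (hM : M.IsIsoparametric κ m) {i : Fin g}
    (h : principalRicci κ m (κ i) < 0) : ¬ M.RicciNonneg := by
  classical
  intro hR
  obtain ⟨p⟩ := M.nonempty
  obtain ⟨e, he⟩ := M.exists_isEigenFrame hM p
  have h1 := hR p (e ⟨i, 0, M.pos_of_isIsoparametric hM i⟩)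
  rw [hM.ricci_self he, Finset.sum_eq_single ⟨i, 0, M.pos_of_isIsoparametric hM i⟩] at h1
  · simp at h1
    linarith
  · intro l _ hl
    simp [Ne.symm hl]
  · simp

end SphereHypersurface

/-! ### Parallel hypersurfaces and focal distances -/

namespace IsEigenFrame

variable {V F : Type*} [NormedAddCommGroup V] [NormedSpace ℝ V] [NormedAddCommGroup F]
  [InnerProductSpace ℝ F] {a b : V →L[ℝ] F} {g : ℕ} {κ : Fin g → ℝ} {m : Fin g → ℕ}
  {e : Module.Basis (Σ i, Fin (m i)) ℝ V}

theorem combination_apply (he : IsEigenFrame a b κ m e) (c d : ℝ) (l : Σ i, Fin (m i)) :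
    (c • a + d • b) (e l) = (c - d * κ l.1) • a (e l) := by
  rw [add_apply, smul_apply, smul_apply, he.2 l, smul_smul, ← add_smul]
  congr 1
  ring

theorem injective_combination_iff (he : IsEigenFrame a b κ m e) (hm : ∀ i, 0 < m i) (c d : ℝ) :
    Function.Injective (c • a + d • b) ↔ ∀ i, c - d * κ i ≠ 0 := by
  constructor
  · intro hinj i hi
    have h1 := he.combination_apply c d ⟨i, 0, hm i⟩
    rw [hi, zero_smul] at h1
    exact e.ne_zero _ (hinj (h1.trans (map_zero _).symm))
  · intro h0
    rw [injective_iff_map_eq_zero]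
    intro v hv
    have h1 : (c • a + d • b) v = ∑ l, (e.repr v l * (c - d * κ l.1)) • a (e l) := by
      conv_lhs => rw [← e.sum_repr v]
      rw [map_sum]
      exact Finset.sum_congr rfl fun l _ => by rw [map_smul, he.combination_apply, smul_smul]
    rw [h1] at hv
    have h2 := Fintype.linearIndependent_iff.1 he.1.linearIndependent _ hv
    exact e.ext_elem_iff.2 fun l => by simpa [h0 l.1] using h2 l

/-- With `c = cos t` and `d = sin t` the two maps are the differentials of the parallel hypersurface
and its normal. The principal directions stay the same; rescaling by `(c - d κ)⁻¹` makes them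
orthonormal again. -/
theorem exists_combination (he : IsEigenFrame a b κ m e) {c d : ℝ} (h0 : ∀ i, c - d * κ i ≠ 0)
    {κ' : Fin g → ℝ} (hκ : ∀ i, κ' i * (c - d * κ i) = d + c * κ i) :
    ∃ e', IsEigenFrame (c • a + d • b) (-d • a + c • b : V →L[ℝ] F) κ' m e' := by
  let e' := e.isUnitSMul (w := fun l => (c - d * κ l.1)⁻¹) fun l => (inv_ne_zero (h0 l.1)).isUnit
  have he' : ∀ l, e' l = (c - d * κ l.1)⁻¹ • e l := fun l => e.isUnitSMul_apply _ l
  have hl : ∀ l, (c • a + d • b) (e' l) = a (e l) := fun l => by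
    rw [he', map_smul, he.combination_apply, smul_smul, inv_mul_cancel₀ (h0 l.1), one_smul]
  refine ⟨e', by simpa only [hl] using he.1, fun l => ?_⟩
  rw [hl, he', map_smul, he.combination_apply, smul_smul]
  congr 1
  rw [inv_mul_eq_iff_eq_mul₀ (h0 l.1)]
  linear_combination hκ l.1

end IsEigenFrame

namespace SphereHypersurface

variable {n : ℕ} {M : SphereHypersurface.{u} n} {g : ℕ} {κ : Fin g → ℝ} {m : Fin g → ℕ}

theorem IsIsoparametric.exists_isEigenFrame_param (hM : M.IsIsoparametric κ m) (p : M.carrier)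
    {x : EuclideanSpace ℝ (Fin n)} (hx : x ∈ (extChartAt (𝓡 n) p).target) :
    ∃ e, IsEigenFrame (fderiv ℝ (M.param p) x) (fderiv ℝ (M.normalParam p) x) κ m e := by
  obtain ⟨L, hL⟩ := exists_fderiv_comp_extChartAt_symm_eq p hx
  obtain ⟨e, he⟩ := M.exists_isEigenFrame hM ((extChartAt (𝓡 n) p).symm x)
  have h1 : ∀ l, fderiv ℝ (M.param p) x (e.map L.symm.toLinearEquiv l) = fderiv ℝ
      (M.param ((extChartAt (𝓡 n) p).symm x)) (extChartAt (𝓡 n) ((extChartAt (𝓡 n) p).symm x)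
        ((extChartAt (𝓡 n) p).symm x)) (e l) := fun l => by
    rw [param, hL _ _ M.mdifferentiable_toFun]
    simp [param]
  have h2 : ∀ l, fderiv ℝ (M.normalParam p) x (e.map L.symm.toLinearEquiv l) = fderiv ℝ
      (M.normalParam ((extChartAt (𝓡 n) p).symm x)) (extChartAt (𝓡 n) ((extChartAt (𝓡 n) p).symm x)
        ((extChartAt (𝓡 n) p).symm x)) (e l) := fun l => by
    rw [normalParam, hL _ _ M.mdifferentiable_normal]
    simp [normalParam]
  refine ⟨e.map L.symm.toLinearEquiv, ?_, fun l => ?_⟩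
  · simpa only [h1] using he.1
  · rw [h1, h2]
    exact he.2 l

theorem hasFDerivAt_combination (M : SphereHypersurface.{u} n) (p : M.carrier) (c d : ℝ) :
    fderiv ℝ ((fun q => c • M.toFun q + d • M.normal q) ∘ (extChartAt (𝓡 n) p).symm)
        (extChartAt (𝓡 n) p p) =
      c • fderiv ℝ (M.param p) (extChartAt (𝓡 n) p p) +
        d • fderiv ℝ (M.normalParam p) (extChartAt (𝓡 n) p p) := by
  have hS := M.isSphereImmersion p
  have hx := mem_extChartAt_target (I := 𝓡 n) p
  exact (((hS.differentiableAt hx).hasFDerivAt.const_smul c).add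
    ((hS.differentiableAt_normal hx).hasFDerivAt.const_smul d)).fderiv

theorem IsIsoparametric.injective_mfderiv_parallelMap_iff (hM : M.IsIsoparametric κ m) (s : ℝ)
    (p : M.carrier) : Function.Injective (mfderiv (𝓡 n) (𝓡 (n + 2)) (M.parallelMap s) p) ↔
      ∀ i, Real.cos s - Real.sin s * κ i ≠ 0 := by
  have hd : fderiv ℝ (M.parallelMap s ∘ (extChartAt (𝓡 n) p).symm) (extChartAt (𝓡 n) p p) =
      mfderiv (𝓡 n) (𝓡 (n + 2)) (M.parallelMap s) p :=
    fderiv_comp_extChartAt_symm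
      ((M.contMDiff_combination (Real.cos s) (Real.sin s)).mdifferentiable (by simp) p)
  have hd' := M.hasFDerivAt_combination p (Real.cos s) (Real.sin s)
  change fderiv ℝ (M.parallelMap s ∘ (extChartAt (𝓡 n) p).symm) _ = _ at hd'
  rw [← hd, hd']
  obtain ⟨e, he⟩ := M.exists_isEigenFrame hM p
  exact he.injective_combination_iff (M.pos_of_isIsoparametric hM) _ _

theorem IsIsoparametric.parallel (hM : M.IsIsoparametric κ m) (t : M.familyParams)
    {κ' : Fin g → ℝ} (hκ' : StrictAnti κ')
    (hκ : ∀ i, κ' i * (Real.cos t - Real.sin t * κ i) = Real.sin t + Real.cos t * κ i) :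
    (M.parallel t).IsIsoparametric κ' m := by
  refine isIsoparametric_of_isEigenFrame _ hκ' (M.pos_of_isIsoparametric hM) fun (p : M.carrier) => ?_
  obtain ⟨e, he⟩ := M.exists_isEigenFrame hM p
  have hne := (hM.injective_mfderiv_parallelMap_iff t p).1 (t.2 t Set.right_mem_uIcc p)
  have ha := M.hasFDerivAt_combination p (Real.cos t) (Real.sin t)
  have hb := M.hasFDerivAt_combination p (-Real.sin t) (Real.cos t)
  change fderiv ℝ ((M.parallel t).param p) (extChartAt (𝓡 n) p p) = _ at ha
  change fderiv ℝ ((M.parallel t).normalParam p) (extChartAt (𝓡 n) p p) = _ at hb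
  obtain ⟨e', he'⟩ := he.exists_combination hne hκ
  rw [← ha, ← hb] at he'
  exact ⟨e', he'⟩

end SphereHypersurface

/-! ### Functions independent of some coordinates, and local inverses -/

section FreezeCoordinates

variable {ι : Type*} (s : ι → Prop) [DecidablePred s] (y₀ : ι → ℝ)

/-- Replace the coordinates of `y` in `s` by those of `y₀`. -/
def freeze (y : ι → ℝ) : ι → ℝ := fun l => if s l then y₀ l else y l

variable [Fintype ι]

theorem freeze_mem_ball {r : ℝ} {y : ι → ℝ} (hy : y ∈ Metric.ball y₀ r) :
    freeze s y₀ y ∈ Metric.ball y₀ r := by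
  refine lt_of_le_of_lt ?_ (Metric.mem_ball.1 hy)
  refine (dist_pi_le_iff dist_nonneg).2 fun l => ?_
  unfold freeze
  split_ifs
  · simp
  · exact dist_le_pi_dist y y₀ l

/-- Chain rule: `freeze` is affine, and its linear part fixes the coordinate directions outside `s`.
-/
theorem fderiv_freeze [DecidableEq ι] {E : Type*} [NormedAddCommGroup E] [NormedSpace ℝ E]
    {G : (ι → ℝ) → E} {y : ι → ℝ} (hG : DifferentiableAt ℝ G (freeze s y₀ y))
    (heq : ∀ᶠ z in nhds y, G z = G (freeze s y₀ z)) {k : ι} (hk : ¬ s k) :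
    fderiv ℝ G y (Pi.single k 1) = fderiv ℝ G (freeze s y₀ y) (Pi.single k 1) := by
  have hP : HasFDerivAt (freeze s y₀)
      (ContinuousLinearMap.pi fun l => if s l then (0 : (ι → ℝ) →L[ℝ] ℝ) else
        ContinuousLinearMap.proj l) y := by
    rw [hasFDerivAt_pi]
    intro l
    unfold freeze
    split_ifs
    · exact hasFDerivAt_const _ _
    · exact hasFDerivAt_apply l y
  have h1 := (hG.hasFDerivAt.comp y hP).congr_of_eventuallyEq heq
  rw [h1.fderiv, ContinuousLinearMap.comp_apply]
  congr 1
  ext l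
  rw [ContinuousLinearMap.pi_apply]
  split_ifs with hl
  · rw [Pi.single_eq_of_ne (by rintro rfl; exact hk hl)]
    rfl
  · rfl

/-- The segment from `freeze s y₀ y` to `y` stays in the ball and moves only coordinates in `s`, so
`G` has derivative zero along it. -/
theorem eq_freeze_of_fderiv_eq_zero [DecidableEq ι] {E : Type*} [NormedAddCommGroup E]
    [NormedSpace ℝ E] {G : (ι → ℝ) → E} {r : ℝ}
    (hG : ∀ y ∈ Metric.ball y₀ r, DifferentiableAt ℝ G y)
    (h0 : ∀ y ∈ Metric.ball y₀ r, ∀ l, s l → fderiv ℝ G y (Pi.single l 1) = 0) {y : ι → ℝ}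
    (hy : y ∈ Metric.ball y₀ r) : G y = G (freeze s y₀ y) := by
  set z := freeze s y₀ y
  have hz : z ∈ Metric.ball y₀ r := freeze_mem_ball s y₀ hy
  have hseg : ∀ t ∈ Set.Icc (0 : ℝ) 1, z + t • (y - z) ∈ Metric.ball y₀ r := fun t ht =>
    (convex_ball y₀ r).add_smul_sub_mem hz hy ht
  have hdir : ∀ w ∈ Metric.ball y₀ r, fderiv ℝ G w (y - z) = 0 := by
    intro w hw
    rw [← Finset.univ_sum_single (y - z), map_sum]
    refine Finset.sum_eq_zero fun l _ => ?_
    by_cases hl : s l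
    · rw [show Pi.single l ((y - z) l) = (y - z) l • (Pi.single l 1 : ι → ℝ) by
        rw [← Pi.single_smul, smul_eq_mul, mul_one], map_smul, h0 w hw l hl, smul_zero]
    · have : (y - z) l = 0 := by simp [z, freeze, hl]
      rw [this, Pi.single_zero, map_zero]
  have hd : ∀ t ∈ Set.Icc (0 : ℝ) 1, HasDerivAt (fun t : ℝ => G (z + t • (y - z))) 0 t := by
    intro t ht
    have h1 := (hG _ (hseg t ht)).hasFDerivAt.comp_hasDerivAt t
      (((hasDerivAt_id t).smul_const (y - z)).const_add z)
    simpa [hdir _ (hseg t ht), Function.comp_def] using h1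
  have := constant_of_has_deriv_right_zero
    (fun t ht => (hd t ht).continuousAt.continuousWithinAt)
    (fun t ht => (hd t ⟨ht.1, ht.2.le⟩).hasDerivWithinAt) 1 (by simp)
  simpa using this

end FreezeCoordinates

/-- Inverse function theorem on a ball, which is convex and, for the sup metric, stable under
`freeze`. Class `C²` is enough: at most second derivatives of the focal map occur. -/
theorem exists_local_inverse {E Y : Type*} [NormedAddCommGroup E] [NormedSpace ℝ E]
    [CompleteSpace E] [NormedAddCommGroup Y] [NormedSpace ℝ Y] {Φ : E → Y} {x : E}
    (hΦ : ContDiffAt ℝ ∞ Φ x) {Φ' : E ≃L[ℝ] Y} (hΦ' : HasFDerivAt Φ (Φ' : E →L[ℝ] Y) x)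
    {U : Set E} (hU : U ∈ nhds x) :
    ∃ Ψ : Y → E, Ψ (Φ x) = x ∧ ∃ r > 0, ∀ y ∈ Metric.ball (Φ x) r,
      ContDiffAt ℝ 2 Ψ y ∧ Ψ y ∈ U ∧ Φ (Ψ y) = y := by
  have h2 : ContDiffAt ℝ 2 Φ x := hΦ.of_le (WithTop.coe_le_coe.2 (le_top (a := (2 : ℕ∞))))
  have h20 : (2 : WithTop ℕ∞) ≠ 0 := by simp
  set R := h2.toOpenPartialHomeomorph Φ hΦ' h20
  have hx : x ∈ R.source := h2.mem_toOpenPartialHomeomorph_source hΦ' h20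
  have hy : Φ x ∈ R.target := h2.image_mem_toOpenPartialHomeomorph_target hΦ' h20
  have hR : ⇑R = Φ := h2.toOpenPartialHomeomorph_coe hΦ' h20
  have hsymm : R.symm (Φ x) = x := by rw [← hR]; exact R.left_inv hx
  have hsm : ContDiffAt ℝ 2 R.symm (Φ x) := h2.to_localInverse hΦ' h20
  have e1 := hsm.eventually (by simp)
  have e2 : ∀ᶠ y in nhds (Φ x), R.symm y ∈ U :=
    hsm.continuousAt (by rwa [hsymm])
  have e3 : ∀ᶠ y in nhds (Φ x), Φ (R.symm y) = y := by
    filter_upwards [R.open_target.mem_nhds hy] with y hy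
    rw [← hR]
    exact R.right_inv hy
  obtain ⟨r, hr, hball⟩ := Metric.eventually_nhds_iff_ball.1 (e1.and (e2.and e3))
  exact ⟨R.symm, hsymm, r, hr, hball⟩

/-! ### Charts adapted to a focal map -/

namespace IsSphereImmersion

variable {n : ℕ} {f ξ : EuclideanSpace ℝ (Fin n) → EuclideanSpace ℝ (Fin (n + 2))}
  {U : Set (EuclideanSpace ℝ (Fin n))} {x : EuclideanSpace ℝ (Fin n)}

theorem hasFDerivAt_combination (h : IsSphereImmersion f ξ U) (hx : x ∈ U) (c d : ℝ) :
    HasFDerivAt (fun y => c • f y + d • ξ y) (c • fderiv ℝ f x + d • fderiv ℝ ξ x) x :=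
  ((h.differentiableAt hx).hasFDerivAt.const_smul c).add
    ((h.differentiableAt_normal hx).hasFDerivAt.const_smul d)

theorem contDiffAt_combination (h : IsSphereImmersion f ξ U) (hx : x ∈ U) (c d : ℝ) :
    ContDiffAt ℝ ∞ (fun y => c • f y + d • ξ y) x :=
  ((h.contDiffAt hx).const_smul c).add ((h.contDiffAt_normal hx).const_smul d)

theorem inner_combination (h : IsSphereImmersion f ξ U) (hx : x ∈ U) (c d c' d' : ℝ) :
    inner ℝ (c • f x + d • ξ x) (c' • f x + d' • ξ x) = c * c' + d * d' := by
  have h1 : inner ℝ (f x) (f x) = (1 : ℝ) := by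
    rw [real_inner_self_eq_norm_sq, h.norm_eq x hx, one_pow]
  have h2 : inner ℝ (ξ x) (ξ x) = (1 : ℝ) := by
    rw [real_inner_self_eq_norm_sq, h.norm_normal x hx, one_pow]
  have h3 := h.inner_normal x hx
  have h4 : inner ℝ (ξ x) (f x) = (0 : ℝ) := by rw [real_inner_comm, h3]
  simp only [inner_add_left, inner_add_right, real_inner_smul_left, real_inner_smul_right,
    h1, h2, h3, h4]
  ring

theorem inner_combination_fderiv (h : IsSphereImmersion f ξ U) (hx : x ∈ U) (c d c' d' : ℝ) (v) :
    inner ℝ (c • f x + d • ξ x) ((c' • fderiv ℝ f x + d' • fderiv ℝ ξ x) v) = 0 := by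
  rw [add_apply, smul_apply, smul_apply]
  simp only [inner_add_left, inner_add_right, real_inner_smul_left, real_inner_smul_right,
    h.inner_fderiv hx, h.inner_normal_fderiv x hx, h.inner_fderiv_normal hx,
    h.inner_normal_fderiv_normal hx]
  ring

end IsSphereImmersion

/-- `Ψ` is a local parametrization of `U` around `x₀ = Ψ y₀`, adapted to the focal map of the
principal curvature `κ i₀`: its coordinates with index over `i₀` are those of the normal
vector `-f + κ i₀ ξ` of the focal submanifold, and the other ones are those of the focal point
`κ i₀ f + ξ`, in the directions of the eigenframe `e` at `x₀`. -/
structure IsFocalChart {n : ℕ} (f ξ : EuclideanSpace ℝ (Fin n) → EuclideanSpace ℝ (Fin (n + 2)))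
    (U : Set (EuclideanSpace ℝ (Fin n))) {g : ℕ} (κ : Fin g → ℝ) (m : Fin g → ℕ) (i₀ : Fin g)
    (x₀ : EuclideanSpace ℝ (Fin n))
    (e : Module.Basis (Σ i, Fin (m i)) ℝ (EuclideanSpace ℝ (Fin n)))
    (Ψ : ((Σ i, Fin (m i)) → ℝ) → EuclideanSpace ℝ (Fin n)) (y₀ : (Σ i, Fin (m i)) → ℝ) (r : ℝ) :
    Prop where
  immersion : IsSphereImmersion f ξ U
  frame : ∀ x ∈ U, ∃ e, IsEigenFrame (fderiv ℝ f x) (fderiv ℝ ξ x) κ m e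
  injective : Function.Injective κ
  frame₀ : IsEigenFrame (fderiv ℝ f x₀) (fderiv ℝ ξ x₀) κ m e
  pos : 0 < r
  apply_center : Ψ y₀ = x₀
  center_eq_zero : ∀ l, l.1 = i₀ → y₀ l = 0
  contDiffAt : ∀ y ∈ Metric.ball y₀ r, ContDiffAt ℝ 2 Ψ y
  mem : ∀ y ∈ Metric.ball y₀ r, Ψ y ∈ U
  inner_normal : ∀ y ∈ Metric.ball y₀ r, ∀ l, l.1 = i₀ →
    inner ℝ (fderiv ℝ f x₀ (e l)) ((-1 : ℝ) • f (Ψ y) + κ i₀ • ξ (Ψ y)) = y l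
  inner_focal : ∀ y ∈ Metric.ball y₀ r, ∀ l, l.1 ≠ i₀ →
    inner ℝ (fderiv ℝ f x₀ (e l)) (κ i₀ • f (Ψ y) + (1 : ℝ) • ξ (Ψ y)) = y l

section

variable {n : ℕ} {f ξ : EuclideanSpace ℝ (Fin n) → EuclideanSpace ℝ (Fin (n + 2))}
  {U : Set (EuclideanSpace ℝ (Fin n))} {g : ℕ} {κ : Fin g → ℝ} {m : Fin g → ℕ}
  {x₀ : EuclideanSpace ℝ (Fin n)}

theorem IsEigenFrame.inner_combination_apply {V F : Type*} [NormedAddCommGroup V] [NormedSpace ℝ V]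
    [NormedAddCommGroup F] [InnerProductSpace ℝ F] {a b : V →L[ℝ] F}
    {e : Module.Basis (Σ i, Fin (m i)) ℝ V} (he : IsEigenFrame a b κ m e) (c d : ℝ)
    (l : Σ i, Fin (m i)) (v : V) :
    inner ℝ (a (e l)) ((c • a + d • b) v) = (c - d * κ l.1) * e.repr v l := by
  have h1 : (c • a + d • b) v = ∑ l, ((c - d * κ l.1) * e.repr v l) • a (e l) := by
    conv_lhs => rw [← e.sum_repr v]
    rw [map_sum]
    exact Finset.sum_congr rfl fun l _ => by
      rw [map_smul, he.combination_apply, smul_smul, mul_comm]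
  rw [h1, he.1.inner_right_sum _ (Finset.mem_univ l)]

/-- In the frame `e` the differential of `Φ` at `x₀` is diagonal. Its entries are `-1 - κ i₀ ^ 2`
over `i₀` and `κ i₀ - κ l.1` elsewhere, all nonzero, so `Ψ` comes from the inverse function theorem.
-/
theorem exists_isFocalChart (h : IsSphereImmersion f ξ U)
    (hfr : ∀ x ∈ U, ∃ e, IsEigenFrame (fderiv ℝ f x) (fderiv ℝ ξ x) κ m e)
    (hκ : Function.Injective κ) (hx : x₀ ∈ U) (i₀ : Fin g)
    {e : Module.Basis (Σ i, Fin (m i)) ℝ (EuclideanSpace ℝ (Fin n))}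
    (he : IsEigenFrame (fderiv ℝ f x₀) (fderiv ℝ ξ x₀) κ m e) :
    ∃ Ψ y₀ r, IsFocalChart f ξ U κ m i₀ x₀ e Ψ y₀ r := by
  let c : (Σ i, Fin (m i)) → ℝ := fun l => if l.1 = i₀ then -1 else κ i₀
  let d : (Σ i, Fin (m i)) → ℝ := fun l => if l.1 = i₀ then κ i₀ else 1
  let Φ : EuclideanSpace ℝ (Fin n) → (Σ i, Fin (m i)) → ℝ := fun x l =>
    inner ℝ (fderiv ℝ f x₀ (e l)) (c l • f x + d l • ξ x)
  have hne : ∀ l, c l - d l * κ l.1 ≠ 0 := by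
    intro l
    by_cases hl : l.1 = i₀
    · simp only [c, d, hl, if_true]
      nlinarith [mul_self_nonneg (κ i₀)]
    · simp only [c, d, hl, if_false, one_mul]
      exact sub_ne_zero.2 fun h => hl (hκ h.symm)
  have hΦ : ContDiffAt ℝ ∞ Φ x₀ := contDiffAt_pi.2 fun l =>
    contDiffAt_const.inner ℝ (h.contDiffAt_combination hx (c l) (d l))
  let e' := e.isUnitSMul (w := fun l => (c l - d l * κ l.1)⁻¹)
    fun l => (inv_ne_zero (hne l)).isUnit
  have he' : ∀ l, e' l = (c l - d l * κ l.1)⁻¹ • e l := fun l => e.isUnitSMul_apply _ l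
  have hΦ' : HasFDerivAt Φ (e'.equivFun.toContinuousLinearEquiv :
      EuclideanSpace ℝ (Fin n) →L[ℝ] ((Σ i, Fin (m i)) → ℝ)) x₀ := by
    rw [hasFDerivAt_pi']
    intro l
    have h1 := (hasFDerivAt_const (𝕜 := ℝ) (fderiv ℝ f x₀ (e l)) x₀).inner ℝ
      (h.hasFDerivAt_combination hx (c l) (d l))
    refine h1.congr_fderiv ?_
    apply ContinuousLinearMap.coe_injective
    refine e'.ext fun k => ?_
    simp only [ContinuousLinearMap.coe_coe, ContinuousLinearMap.comp_apply,
      ContinuousLinearMap.prod_apply, fderivInnerCLM_apply, zero_apply, inner_zero_left, add_zero,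
      he.inner_combination_apply]
    have h2 : e.repr (e' k) l = (c k - d k * κ k.1)⁻¹ * if k = l then 1 else 0 := by
      rw [he' k]
      simp [Finsupp.single_apply]
    rw [h2]
    change _ = e'.equivFun (e' k) l
    rw [e'.equivFun_self]
    split_ifs with hkl
    · subst hkl
      rw [mul_one, mul_inv_cancel₀ (hne k)]
    · simp
  obtain ⟨Ψ, hΨ, r, hr, hball⟩ := exists_local_inverse hΦ hΦ' (h.isOpen.mem_nhds hx)
  refine ⟨Ψ, Φ x₀, r, h, hfr, hκ, he, hr, hΨ, fun l hl => ?_, fun y hy => (hball y hy).1,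
    fun y hy => (hball y hy).2.1, fun y hy l hl => ?_, fun y hy l hl => ?_⟩
  · simp only [Φ, inner_add_right, real_inner_smul_right]
    rw [real_inner_comm (f x₀), h.inner_fderiv hx, real_inner_comm (ξ x₀),
      h.inner_normal_fderiv x₀ hx]
    simp
  · have := congrFun (hball y hy).2.2 l
    simpa only [Φ, c, d, hl, if_true] using this
  · have := congrFun (hball y hy).2.2 l
    simpa only [Φ, c, d, hl, if_false] using this

end

namespace IsFocalChart

variable {n : ℕ} {f ξ : EuclideanSpace ℝ (Fin n) → EuclideanSpace ℝ (Fin (n + 2))}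
  {U : Set (EuclideanSpace ℝ (Fin n))} {g : ℕ} {κ : Fin g → ℝ} {m : Fin g → ℕ} {i₀ : Fin g}
  {x₀ : EuclideanSpace ℝ (Fin n)} {e : Module.Basis (Σ i, Fin (m i)) ℝ (EuclideanSpace ℝ (Fin n))}
  {Ψ : ((Σ i, Fin (m i)) → ℝ) → EuclideanSpace ℝ (Fin n)} {y₀ y : (Σ i, Fin (m i)) → ℝ} {r : ℝ}

theorem eventually_mem (hy : y ∈ Metric.ball y₀ r) : ∀ᶠ z in nhds y, z ∈ Metric.ball y₀ r :=
  Metric.isOpen_ball.mem_nhds hy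

theorem center_mem (hC : IsFocalChart f ξ U κ m i₀ x₀ e Ψ y₀ r) : y₀ ∈ Metric.ball y₀ r :=
  Metric.mem_ball_self hC.pos

theorem mem₀ (hC : IsFocalChart f ξ U κ m i₀ x₀ e Ψ y₀ r) : x₀ ∈ U := by
  rw [← hC.apply_center]
  exact hC.mem _ hC.center_mem

theorem hasFDerivAt (hC : IsFocalChart f ξ U κ m i₀ x₀ e Ψ y₀ r) (hy : y ∈ Metric.ball y₀ r)
    (c d : ℝ) : HasFDerivAt (fun z => c • f (Ψ z) + d • ξ (Ψ z))
      ((c • fderiv ℝ f (Ψ y) + d • fderiv ℝ ξ (Ψ y)).comp (fderiv ℝ Ψ y)) y :=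
  (hC.immersion.hasFDerivAt_combination (hC.mem y hy) c d).comp y
    ((hC.contDiffAt y hy).differentiableAt (by simp)).hasFDerivAt

theorem fderiv_apply (hC : IsFocalChart f ξ U κ m i₀ x₀ e Ψ y₀ r) (hy : y ∈ Metric.ball y₀ r)
    (c d : ℝ) (v : (Σ i, Fin (m i)) → ℝ) :
    fderiv ℝ (fun z => c • f (Ψ z) + d • ξ (Ψ z)) y v =
      (c • fderiv ℝ f (Ψ y) + d • fderiv ℝ ξ (Ψ y)) (fderiv ℝ Ψ y v) := by
  rw [(hC.hasFDerivAt hy c d).fderiv, ContinuousLinearMap.comp_apply]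

theorem contDiffAt_combination (hC : IsFocalChart f ξ U κ m i₀ x₀ e Ψ y₀ r)
    (hy : y ∈ Metric.ball y₀ r) (c d : ℝ) :
    ContDiffAt ℝ 2 (fun z => c • f (Ψ z) + d • ξ (Ψ z)) y :=
  ((hC.immersion.contDiffAt_combination (hC.mem y hy) c d).of_le
    (WithTop.coe_le_coe.2 (le_top (a := (2 : ℕ∞))))).comp y (hC.contDiffAt y hy)

theorem differentiableAt_fderiv_apply (hC : IsFocalChart f ξ U κ m i₀ x₀ e Ψ y₀ r)
    (hy : y ∈ Metric.ball y₀ r) (c d : ℝ) (v : (Σ i, Fin (m i)) → ℝ) :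
    DifferentiableAt ℝ (fun z => fderiv ℝ (fun z => c • f (Ψ z) + d • ξ (Ψ z)) z v) y :=
  (((hC.contDiffAt_combination hy c d).fderiv_right (m := 1) (by norm_num)).differentiableAt
    (by simp)).clm_apply (differentiableAt_const v)

theorem inner_fderiv_focal (hC : IsFocalChart f ξ U κ m i₀ x₀ e Ψ y₀ r)
    (hy : y ∈ Metric.ball y₀ r) {l : Σ i, Fin (m i)} (hl : l.1 ≠ i₀)
    (v : (Σ i, Fin (m i)) → ℝ) :
    inner ℝ (fderiv ℝ f x₀ (e l))
      (fderiv ℝ (fun z => κ i₀ • f (Ψ z) + (1 : ℝ) • ξ (Ψ z)) y v) = v l := by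
  have h1 : (fun z => inner ℝ (fderiv ℝ f x₀ (e l)) (κ i₀ • f (Ψ z) + (1 : ℝ) • ξ (Ψ z)))
      =ᶠ[nhds y] fun z => z l :=
    (eventually_mem hy).mono fun z hz => hC.inner_focal z hz l hl
  have h2 := fderiv_inner_apply ℝ (differentiableAt_const (fderiv ℝ f x₀ (e l)))
    (hC.hasFDerivAt hy (κ i₀) 1).differentiableAt v
  rw [h1.fderiv_eq, (hasFDerivAt_apply l y).fderiv] at h2
  simpa using h2.symm

/-- The rank of the focal map is the number of the remaining principal directions. -/
theorem fderiv_focal_single (hC : IsFocalChart f ξ U κ m i₀ x₀ e Ψ y₀ r)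
    (hy : y ∈ Metric.ball y₀ r) {l : Σ i, Fin (m i)} (hl : l.1 = i₀) :
    fderiv ℝ (fun z => κ i₀ • f (Ψ z) + (1 : ℝ) • ξ (Ψ z)) y (Pi.single l 1) = 0 := by
  obtain ⟨e', he'⟩ := hC.frame _ (hC.mem y hy)
  set a := fderiv ℝ f (Ψ y)
  set b := fderiv ℝ ξ (Ψ y)
  let c : ((Σ i, Fin (m i)) → ℝ) → {l : Σ i, Fin (m i) // l.1 ≠ i₀} → ℝ := fun v l =>
    (κ i₀ - κ l.1.1) * e'.repr (fderiv ℝ Ψ y v) l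
  have hsum : ∀ v, fderiv ℝ (fun z => κ i₀ • f (Ψ z) + (1 : ℝ) • ξ (Ψ z)) y v =
      ∑ l : {l : Σ i, Fin (m i) // l.1 ≠ i₀}, c v l • a (e' l) := by
    intro v
    rw [hC.fderiv_apply hy]
    conv_lhs => rw [← e'.sum_repr (fderiv ℝ Ψ y v)]
    rw [map_sum, ← Fintype.sum_subtype_add_sum_subtype (fun l : Σ i, Fin (m i) => l.1 ≠ i₀)]
    refine (add_eq_left.2 ?_).trans ?_
    · refine Finset.sum_eq_zero fun l _ => ?_
      rw [map_smul, he'.combination_apply, not_not.1 l.2, one_mul, sub_self, zero_smul, smul_zero]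
    · refine Finset.sum_congr rfl fun l _ => ?_
      rw [map_smul, he'.combination_apply, smul_smul, one_mul, mul_comm]
  -- The focal differential is expressed by the coefficients `c v` off `i₀`, and the chart says that
  -- the square matrix `B` sends `c v` to the coordinates of `v` off `i₀`. So `B` is onto, hence
  -- injective, and `c v` vanishes when those coordinates do.
  let B : Matrix {l : Σ i, Fin (m i) // l.1 ≠ i₀} {l : Σ i, Fin (m i) // l.1 ≠ i₀} ℝ :=
    Matrix.of fun j l => inner ℝ (fderiv ℝ f x₀ (e j)) (a (e' l))
  have hB : ∀ v, B.mulVec (c v) = fun j => v j.1 := by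
    intro v
    ext j
    rw [← hC.inner_fderiv_focal hy j.2 v, hsum, inner_sum]
    refine Finset.sum_congr rfl fun l _ => ?_
    rw [real_inner_smul_right, mul_comm]
    rfl
  have hsurj : Function.Surjective B.mulVecLin := by
    intro w
    refine ⟨c fun l => if h : l.1 ≠ i₀ then w ⟨l, h⟩ else 0, ?_⟩
    rw [Matrix.mulVecLin_apply, hB]
    ext j
    simp [j.2]
  have hinj := LinearMap.injective_iff_surjective.2 hsurj
  have hc : c (Pi.single l 1) = 0 := by
    apply hinj
    rw [Matrix.mulVecLin_apply, hB, map_zero]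
    ext j
    exact Pi.single_eq_of_ne (by rintro rfl; exact j.2 hl) _
  rw [hsum, hc]
  simp

theorem focal_eq_freeze (hC : IsFocalChart f ξ U κ m i₀ x₀ e Ψ y₀ r)
    (hy : y ∈ Metric.ball y₀ r) :
    κ i₀ • f (Ψ y) + (1 : ℝ) • ξ (Ψ y) =
      κ i₀ • f (Ψ (freeze (fun l => l.1 = i₀) y₀ y)) +
        (1 : ℝ) • ξ (Ψ (freeze (fun l => l.1 = i₀) y₀ y)) :=
  eq_freeze_of_fderiv_eq_zero (fun l => l.1 = i₀) y₀
    (G := fun z => κ i₀ • f (Ψ z) + (1 : ℝ) • ξ (Ψ z))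
    (fun _ hz => (hC.hasFDerivAt hz _ _).differentiableAt)
    (fun _ hz _ hl => hC.fderiv_focal_single hz hl) hy

theorem fderiv_focal_eq_freeze (hC : IsFocalChart f ξ U κ m i₀ x₀ e Ψ y₀ r)
    (hy : y ∈ Metric.ball y₀ r) {j : Σ i, Fin (m i)} (hj : j.1 ≠ i₀) :
    fderiv ℝ (fun z => κ i₀ • f (Ψ z) + (1 : ℝ) • ξ (Ψ z)) y (Pi.single j 1) =
      fderiv ℝ (fun z => κ i₀ • f (Ψ z) + (1 : ℝ) • ξ (Ψ z))
        (freeze (fun l => l.1 = i₀) y₀ y) (Pi.single j 1) :=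
  fderiv_freeze (fun l => l.1 = i₀) y₀
    (hC.hasFDerivAt (freeze_mem_ball _ _ hy) _ _).differentiableAt
    ((eventually_mem hy).mono fun _ hz => hC.focal_eq_freeze hz) hj

theorem fderiv_fderiv_focal_eq_freeze (hC : IsFocalChart f ξ U κ m i₀ x₀ e Ψ y₀ r)
    (hy : y ∈ Metric.ball y₀ r) {j k : Σ i, Fin (m i)} (hj : j.1 ≠ i₀) (hk : k.1 ≠ i₀) :
    fderiv ℝ (fun w => fderiv ℝ (fun z => κ i₀ • f (Ψ z) + (1 : ℝ) • ξ (Ψ z)) w (Pi.single j 1))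
        y (Pi.single k 1) =
      fderiv ℝ (fun w => fderiv ℝ (fun z => κ i₀ • f (Ψ z) + (1 : ℝ) • ξ (Ψ z)) w
        (Pi.single j 1)) (freeze (fun l => l.1 = i₀) y₀ y) (Pi.single k 1) :=
  fderiv_freeze (fun l => l.1 = i₀) y₀
    (hC.differentiableAt_fderiv_apply (freeze_mem_ball _ _ hy) _ _ _)
    ((eventually_mem hy).mono fun _ hz => hC.fderiv_focal_eq_freeze hz hj) hk

/-- The focal differential has no component along `f`, `ξ` or the frame vectors over `i₀`; the chart
coordinates prescribe the others. -/
theorem fderiv_focal_center (hC : IsFocalChart f ξ U κ m i₀ x₀ e Ψ y₀ r)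
    {j : Σ i, Fin (m i)} (hj : j.1 ≠ i₀) :
    fderiv ℝ (fun z => κ i₀ • f (Ψ z) + (1 : ℝ) • ξ (Ψ z)) y₀ (Pi.single j 1) =
      fderiv ℝ f x₀ (e j) := by
  have hx := hC.mem₀
  have h0 := hC.fderiv_apply hC.center_mem (κ i₀) 1 (Pi.single j 1)
  rw [hC.apply_center] at h0
  refine hC.immersion.eq_of_forall_inner hx ?_ ?_ fun w => ?_
  · have := hC.immersion.inner_combination_fderiv hx 1 0 (κ i₀) 1
      (fderiv ℝ Ψ y₀ (Pi.single j 1))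
    rw [one_smul, zero_smul, add_zero] at this
    rw [h0, this, hC.immersion.inner_fderiv hx]
  · have := hC.immersion.inner_combination_fderiv hx 0 1 (κ i₀) 1
      (fderiv ℝ Ψ y₀ (Pi.single j 1))
    rw [one_smul, zero_smul, zero_add] at this
    rw [h0, this, hC.immersion.inner_normal_fderiv _ hx]
  · rw [← e.sum_repr w, map_sum, sum_inner, sum_inner]
    refine Finset.sum_congr rfl fun l _ => ?_
    rw [map_smul, real_inner_smul_left, real_inner_smul_left]
    congr 1
    rw [orthonormal_iff_ite.1 hC.frame₀.1 l j]
    by_cases hl : l.1 = i₀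
    · rw [h0, hC.frame₀.inner_combination_apply, hl, one_mul, sub_self, zero_mul,
        if_neg (by rintro rfl; exact hj hl)]
    · rw [hC.inner_fderiv_focal hC.center_mem hl, Pi.single_apply]

/-- The second fundamental form of the focal submanifold is the same along the whole fibre. -/
theorem inner_normal_fderiv_fderiv_focal (hC : IsFocalChart f ξ U κ m i₀ x₀ e Ψ y₀ r)
    (hy : y ∈ Metric.ball y₀ r) (hy' : freeze (fun l => l.1 = i₀) y₀ y = y₀)
    {j k : Σ i, Fin (m i)} (hj : j.1 ≠ i₀) (hk : k.1 ≠ i₀) :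
    inner ℝ ((-1 : ℝ) • f (Ψ y) + κ i₀ • ξ (Ψ y))
        (fderiv ℝ (fun w => fderiv ℝ (fun z => κ i₀ • f (Ψ z) + (1 : ℝ) • ξ (Ψ z)) w
          (Pi.single j 1)) y₀ (Pi.single k 1)) =
      -inner ℝ (fderiv ℝ (fun z => (-1 : ℝ) • f (Ψ z) + κ i₀ • ξ (Ψ z)) y (Pi.single k 1))
        (fderiv ℝ (fun z => κ i₀ • f (Ψ z) + (1 : ℝ) • ξ (Ψ z)) y (Pi.single j 1)) := by
  have h1 := inner_fderiv_add_eq_zero (c := 0) (hC.hasFDerivAt hy (-1) (κ i₀)).differentiableAt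
    (hC.differentiableAt_fderiv_apply hy (κ i₀) 1 (Pi.single j 1))
    ((eventually_mem hy).mono fun z hz => by
      rw [hC.fderiv_apply hz, hC.immersion.inner_combination_fderiv (hC.mem z hz)])
    (Pi.single k 1)
  -- The second derivative at `y` is exchanged for the one at `y₀`: the focal map and its
  -- derivatives off `i₀` do not change along the fibre.
  rw [hC.fderiv_fderiv_focal_eq_freeze hy hj hk, hy'] at h1
  linarith

/-- The characteristic polynomial of the focal shape operator does not depend on the point of the
fibre. In the frame at `Ψ y`, the metric and the second fundamental form of the focal map are `Wᵀ D
W` for the same `W`, with `D` diagonal of entries `(κ i₀ - κ l) ^ 2` and `(κ i₀ - κ l) (1 + κ i₀ κ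
l)`. The metric is the identity, because the differential at `y` is the one at `y₀`. -/
theorem det_focal_sub (hC : IsFocalChart f ξ U κ m i₀ x₀ e Ψ y₀ r)
    (hy : y ∈ Metric.ball y₀ r) (hy' : freeze (fun l => l.1 = i₀) y₀ y = y₀) (c : ℝ) :
    (Matrix.of (fun j k : {l : Σ i, Fin (m i) // l.1 ≠ i₀} =>
      inner ℝ ((-1 : ℝ) • f (Ψ y) + κ i₀ • ξ (Ψ y))
        (fderiv ℝ (fun w => fderiv ℝ (fun z => κ i₀ • f (Ψ z) + (1 : ℝ) • ξ (Ψ z)) w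
          (Pi.single j.1 1)) y₀ (Pi.single k.1 1))) - c • 1).det =
      ∏ l : {l : Σ i, Fin (m i) // l.1 ≠ i₀},
        ((1 + κ i₀ * κ l.1.1) / (κ i₀ - κ l.1.1) - c) := by
  obtain ⟨e', he'⟩ := hC.frame _ (hC.mem y hy)
  set u : {l : Σ i, Fin (m i) // l.1 ≠ i₀} → (Σ i, Fin (m i)) → ℝ := fun j l =>
    e'.repr (fderiv ℝ Ψ y (Pi.single j.1 1)) l
  have hexp : ∀ (c d : ℝ) (j : {l : Σ i, Fin (m i) // l.1 ≠ i₀}),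
      fderiv ℝ (fun z => c • f (Ψ z) + d • ξ (Ψ z)) y (Pi.single j.1 1) =
        ∑ l, ((c - d * κ l.1) * u j l) • fderiv ℝ f (Ψ y) (e' l) := by
    intro c d j
    rw [hC.fderiv_apply hy]
    conv_lhs => rw [← e'.sum_repr (fderiv ℝ Ψ y (Pi.single j.1 1))]
    rw [map_sum]
    refine Finset.sum_congr rfl fun l _ => ?_
    rw [map_smul, he'.combination_apply, smul_smul, mul_comm]
  have hsub : ∀ φ : (Σ i, Fin (m i)) → ℝ, (∑ l, (κ i₀ - 1 * κ l.1) * φ l) =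
      ∑ l : {l : Σ i, Fin (m i) // l.1 ≠ i₀}, (κ i₀ - κ l.1.1) * φ l := by
    intro φ
    rw [← Fintype.sum_subtype_add_sum_subtype (fun l : Σ i, Fin (m i) => l.1 ≠ i₀),
      add_eq_left.2]
    · simp only [one_mul]
    · refine Finset.sum_eq_zero fun l _ => ?_
      rw [not_not.1 l.2, one_mul, sub_self, zero_mul]
  set W : Matrix {l : Σ i, Fin (m i) // l.1 ≠ i₀} {l : Σ i, Fin (m i) // l.1 ≠ i₀} ℝ :=
    Matrix.of fun l j => u j l
  have hone : (1 : Matrix {l : Σ i, Fin (m i) // l.1 ≠ i₀} {l : Σ i, Fin (m i) // l.1 ≠ i₀} ℝ) =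
      W.transpose * Matrix.diagonal (fun l => (κ i₀ - κ l.1.1) ^ 2) * W := by
    ext j k
    have h1 := hC.fderiv_focal_eq_freeze hy j.2
    have h2 := hC.fderiv_focal_eq_freeze hy k.2
    rw [hy', hC.fderiv_focal_center j.2] at h1
    rw [hy', hC.fderiv_focal_center k.2] at h2
    have h3 := orthonormal_iff_ite.1 hC.frame₀.1 j.1 k.1
    rw [← h1, ← h2, hexp, hexp, he'.1.inner_sum] at h3
    simp only [conj_trivial, mul_assoc] at h3
    rw [hsub] at h3
    rw [Matrix.one_apply, Matrix.mul_apply]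
    simp only [Matrix.mul_diagonal, Matrix.transpose_apply, W, Matrix.of_apply, Subtype.ext_iff]
    rw [← h3]
    exact Finset.sum_congr rfl fun l _ => by ring
  have hmat : Matrix.of (fun j k : {l : Σ i, Fin (m i) // l.1 ≠ i₀} =>
      inner ℝ ((-1 : ℝ) • f (Ψ y) + κ i₀ • ξ (Ψ y))
        (fderiv ℝ (fun w => fderiv ℝ (fun z => κ i₀ • f (Ψ z) + (1 : ℝ) • ξ (Ψ z)) w
          (Pi.single j.1 1)) y₀ (Pi.single k.1 1))) =
      W.transpose * Matrix.diagonal (fun l => (κ i₀ - κ l.1.1) * (1 + κ i₀ * κ l.1.1)) * W := by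
    ext j k
    rw [Matrix.of_apply, hC.inner_normal_fderiv_fderiv_focal hy hy' j.2 k.2, real_inner_comm,
      hexp, hexp, he'.1.inner_sum]
    rw [Matrix.mul_apply]
    simp only [conj_trivial, Matrix.mul_diagonal, Matrix.transpose_apply, W, Matrix.of_apply,
      mul_assoc]
    rw [hsub, ← Finset.sum_neg_distrib]
    exact Finset.sum_congr rfl fun l _ => by ring
  -- This evaluates the factor `det W ^ 2 * ∏ (κ i₀ - κ l) ^ 2` to one.
  have hdet := congrArg Matrix.det hone
  rw [Matrix.det_one, Matrix.det_mul, Matrix.det_mul, Matrix.det_transpose,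
    Matrix.det_diagonal] at hdet
  have hsubm : W.transpose * Matrix.diagonal (fun l => (κ i₀ - κ l.1.1) * (1 + κ i₀ * κ l.1.1)) * W
      - c • 1 = W.transpose * Matrix.diagonal (fun l => (κ i₀ - κ l.1.1) ^ 2 *
        ((1 + κ i₀ * κ l.1.1) / (κ i₀ - κ l.1.1) - c)) * W := by
    conv_lhs => rw [hone]
    rw [← Matrix.smul_mul, ← Matrix.mul_smul, ← Matrix.sub_mul, ← Matrix.mul_sub,
      ← Matrix.diagonal_smul, Matrix.diagonal_sub]
    congr 3
    ext l
    have : κ i₀ - κ l.1.1 ≠ 0 := sub_ne_zero.2 fun h => l.2 (hC.injective h.symm)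
    simp only [Pi.smul_apply, smul_eq_mul]
    field_simp
  rw [hmat, hsubm, Matrix.det_mul, Matrix.det_mul, Matrix.det_transpose, Matrix.det_diagonal,
    Finset.prod_mul_distrib]
  linear_combination -(∏ l : {l : Σ i, Fin (m i) // l.1 ≠ i₀},
        ((1 + κ i₀ * κ l.1.1) / (κ i₀ - κ l.1.1) - c)) * hdet

end IsFocalChart

namespace IsFocalChart

variable {n : ℕ} {f ξ : EuclideanSpace ℝ (Fin n) → EuclideanSpace ℝ (Fin (n + 2))}
  {U : Set (EuclideanSpace ℝ (Fin n))} {g : ℕ} {κ : Fin g → ℝ} {m : Fin g → ℕ} {i₀ : Fin g}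
  {x₀ : EuclideanSpace ℝ (Fin n)} {e : Module.Basis (Σ i, Fin (m i)) ℝ (EuclideanSpace ℝ (Fin n))}
  {Ψ : ((Σ i, Fin (m i)) → ℝ) → EuclideanSpace ℝ (Fin n)} {y₀ y : (Σ i, Fin (m i)) → ℝ} {r : ℝ}

/-- The normal vectors of the focal submanifold along a coordinate line of the fibre form an arc of
a great circle. -/
theorem normal_add_single (hC : IsFocalChart f ξ U κ m i₀ x₀ e Ψ y₀ r) (k : Fin (m i₀)) {s : ℝ}
    (hs : s ∈ Set.Ioo (-(Real.pi / 2)) (Real.pi / 2))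
    (hy : y = y₀ + (√(1 + κ i₀ ^ 2) * Real.sin s) • Pi.single ⟨i₀, k⟩ 1)
    (hyr : y ∈ Metric.ball y₀ r)
    (hpos : 0 < (inner ℝ ((-1 : ℝ) • f x₀ + κ i₀ • ξ x₀)
      ((-1 : ℝ) • f (Ψ y) + κ i₀ • ξ (Ψ y)) : ℝ)) :
    freeze (fun l => l.1 = i₀) y₀ y = y₀ ∧
    (-1 : ℝ) • f (Ψ y) + κ i₀ • ξ (Ψ y) =
      Real.cos s • ((-1 : ℝ) • f x₀ + κ i₀ • ξ x₀) +
        (√(1 + κ i₀ ^ 2) * Real.sin s) • fderiv ℝ f x₀ (e ⟨i₀, k⟩) := by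
  have hx := hC.mem₀
  have hS := hC.immersion
  have hfr : freeze (fun l => l.1 = i₀) y₀ y = y₀ := by
    ext l
    unfold freeze
    split_ifs with hl
    · rfl
    · rw [hy]
      simp only [Pi.add_apply, Pi.smul_apply]
      rw [Pi.single_eq_of_ne (by rintro rfl; exact hl rfl), smul_zero, add_zero]
  refine ⟨hfr, ?_⟩
  set ρ : ℝ := √(1 + κ i₀ ^ 2)
  have hρ : ρ ^ 2 = 1 + κ i₀ ^ 2 := Real.sq_sqrt (by positivity)
  have hρ0 : 0 < 1 + κ i₀ ^ 2 := by positivity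
  set z := (-1 : ℝ) • f (Ψ y) + κ i₀ • ξ (Ψ y)
  have hzz : inner ℝ z z = 1 + κ i₀ ^ 2 := by
    rw [hS.inner_combination (hC.mem y hyr)]
    ring
  set η := (-1 : ℝ) • f x₀ + κ i₀ • ξ x₀ with hη
  set τ : ℝ := inner ℝ η z
  have hηη : inner ℝ η η = 1 + κ i₀ ^ 2 := by
    rw [hS.inner_combination hx]
    ring
  -- The focal point at `y` is the one at `x₀`, so `z` is orthogonal to it; the `f x₀` and `ξ x₀`
  -- components of `z` are then determined by `τ`.
  have hfocal : inner ℝ (κ i₀ • f x₀ + (1 : ℝ) • ξ x₀) z = 0 := by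
    have h1 := hC.focal_eq_freeze hyr
    rw [hfr, hC.apply_center] at h1
    rw [← h1, hS.inner_combination (hC.mem y hyr)]
    ring
  have hηε : ∀ l, inner ℝ (fderiv ℝ f x₀ (e l)) η = 0 := by
    intro l
    rw [hη, inner_add_right, real_inner_smul_right, real_inner_smul_right, real_inner_comm (f x₀),
      hS.inner_fderiv hx, real_inner_comm (ξ x₀), hS.inner_normal_fderiv _ hx]
    simp
  have hf : (1 + κ i₀ ^ 2) * inner ℝ (f x₀) z = -τ := by
    simp only [inner_add_left, real_inner_smul_left, τ, η] at hfocal ⊢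
    linear_combination κ i₀ * hfocal
  have hξ : (1 + κ i₀ ^ 2) * inner ℝ (ξ x₀) z = κ i₀ * τ := by
    simp only [inner_add_left, real_inner_smul_left, τ, η] at hfocal ⊢
    linear_combination hfocal
  have hR : ∀ (w : EuclideanSpace ℝ (Fin (n + 2))) (A B : ℝ),
      inner ℝ w (A • η + B • fderiv ℝ f x₀ (e ⟨i₀, k⟩)) =
        A * inner ℝ w η + B * inner ℝ w (fderiv ℝ f x₀ (e ⟨i₀, k⟩)) := fun w A B => by
    rw [inner_add_right, real_inner_smul_right, real_inner_smul_right]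
  have hz : z = (τ / (1 + κ i₀ ^ 2)) • η + (ρ * Real.sin s) • fderiv ℝ f x₀ (e ⟨i₀, k⟩) := by
    refine hS.eq_of_forall_inner hx ?_ ?_ fun w => ?_
    · rw [hR, hS.inner_fderiv hx, mul_zero, add_zero]
      have := hS.inner_combination hx 1 0 (-1) (κ i₀)
      rw [one_smul, zero_smul, add_zero] at this
      rw [this, div_mul_eq_mul_div, eq_div_iff hρ0.ne']
      linarith
    · rw [hR, hS.inner_normal_fderiv _ hx, mul_zero, add_zero]
      have := hS.inner_combination hx 0 1 (-1) (κ i₀)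
      rw [one_smul, zero_smul, zero_add] at this
      rw [this, div_mul_eq_mul_div, eq_div_iff hρ0.ne']
      linarith
    · rw [← e.sum_repr w, map_sum, sum_inner, sum_inner]
      refine Finset.sum_congr rfl fun l _ => ?_
      rw [map_smul, real_inner_smul_left, real_inner_smul_left]
      congr 1
      rw [hR, hηε, mul_zero, zero_add, orthonormal_iff_ite.1 hC.frame₀.1 l ⟨i₀, k⟩]
      by_cases hl : l.1 = i₀
      · rw [hC.inner_normal y hyr l hl, hy]
        simp only [Pi.add_apply, Pi.smul_apply, smul_eq_mul]
        rw [hC.center_eq_zero l hl, zero_add, Pi.single_apply]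
      · rw [if_neg (by rintro rfl; exact hl rfl), mul_zero]
        have h1 := hC.immersion.inner_combination_fderiv (hC.mem y hyr) (-1) (κ i₀) (κ i₀) 1
          (fderiv ℝ Ψ y (Pi.single l 1))
        rw [← hC.fderiv_apply hyr, hC.fderiv_focal_eq_freeze hyr hl, hfr,
          hC.fderiv_focal_center hl] at h1
        rw [real_inner_comm]
        exact h1
  have hεε : inner ℝ (fderiv ℝ f x₀ (e ⟨i₀, k⟩)) (fderiv ℝ f x₀ (e ⟨i₀, k⟩)) = (1 : ℝ) := by
    rw [orthonormal_iff_ite.1 hC.frame₀.1, if_pos rfl]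
  -- The length of `z` determines `τ` up to sign; positivity of `τ` and of `cos s` fixes the sign.
  have hτ : τ = Real.cos s * (1 + κ i₀ ^ 2) := by
    have h1 := hzz
    rw [hz] at h1
    simp only [inner_add_left, inner_add_right, real_inner_smul_left, real_inner_smul_right, hηη,
      hηε, hεε, (real_inner_comm (fderiv ℝ f x₀ (e ⟨i₀, k⟩)) η).trans (hηε ⟨i₀, k⟩)] at h1
    have h2 : τ ^ 2 = (Real.cos s * (1 + κ i₀ ^ 2)) ^ 2 := by
      have h3 : τ / (1 + κ i₀ ^ 2) * (1 + κ i₀ ^ 2) = τ := div_mul_cancel₀ _ hρ0.ne'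
      have h4 := Real.sin_sq_add_cos_sq s
      generalize τ / (1 + κ i₀ ^ 2) = q at h1 h3
      rw [← h3]
      linear_combination (1 + κ i₀ ^ 2) * h1 - (1 + κ i₀ ^ 2) * Real.sin s ^ 2 * hρ
        - (1 + κ i₀ ^ 2) ^ 2 * h4
    have h3 : 0 < Real.cos s * (1 + κ i₀ ^ 2) := mul_pos (Real.cos_pos_of_mem_Ioo hs) hρ0
    exact (pow_left_inj₀ hpos.le h3.le two_ne_zero).1 h2
  rw [hz, hτ, mul_div_cancel_right₀ _ hρ0.ne']

/-- Both sides are values of one function of the arc parameter, at `0` and at `π`: the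
characteristic polynomial, evaluated at `c`, of the second fundamental form in the direction of a
point on a great circle. It is analytic, and constant near `0` by `det_focal_sub`. -/
theorem prod_sub_eq (hC : IsFocalChart f ξ U κ m i₀ x₀ e Ψ y₀ r) (hm : 0 < m i₀) (c : ℝ) :
    ∏ l : {l : Σ i, Fin (m i) // l.1 ≠ i₀}, ((1 + κ i₀ * κ l.1.1) / (κ i₀ - κ l.1.1) - c) =
      ∏ l : {l : Σ i, Fin (m i) // l.1 ≠ i₀},
        (-((1 + κ i₀ * κ l.1.1) / (κ i₀ - κ l.1.1)) - c) := by
  set Q : {l : Σ i, Fin (m i) // l.1 ≠ i₀} → {l : Σ i, Fin (m i) // l.1 ≠ i₀} →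
      EuclideanSpace ℝ (Fin (n + 2)) := fun j k =>
    fderiv ℝ (fun w => fderiv ℝ (fun z => κ i₀ • f (Ψ z) + (1 : ℝ) • ξ (Ψ z)) w
      (Pi.single j.1 1)) y₀ (Pi.single k.1 1) with hQ
  set η := (-1 : ℝ) • f x₀ + κ i₀ • ξ x₀ with hη
  set ε := fderiv ℝ f x₀ (e ⟨i₀, 0, hm⟩)
  -- The full great circle, defined for all `s`; only near `s = 0` are its points known to be normal
  -- vectors coming from the chart.
  let N : ℝ → EuclideanSpace ℝ (Fin (n + 2)) := fun s =>
    Real.cos s • η + (√(1 + κ i₀ ^ 2) * Real.sin s) • ε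
  let p : ℝ → ℝ := fun s => (Matrix.of (fun j k => inner ℝ (N s) (Q j k)) - c • 1).det
  have hp : AnalyticOnNhd ℝ p Set.univ := by
    intro s _
    have hent : ∀ j k, AnalyticAt ℝ (fun s : ℝ =>
        (Matrix.of (fun j k => inner ℝ (N s) (Q j k)) - c • 1 :
          Matrix {l : Σ i, Fin (m i) // l.1 ≠ i₀} {l : Σ i, Fin (m i) // l.1 ≠ i₀} ℝ) j k) s := by
      intro j k
      simp only [Matrix.sub_apply, Matrix.of_apply, N, inner_add_left, real_inner_smul_left]
      fun_prop
    simp only [p, Matrix.det_apply]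
    refine Finset.analyticAt_fun_sum _ fun σ _ => AnalyticAt.const_smul ?_
    exact Finset.analyticAt_fun_prod _ fun i _ => hent (σ i) i
  let γ : ℝ → (Σ i, Fin (m i)) → ℝ := fun s =>
    y₀ + (√(1 + κ i₀ ^ 2) * Real.sin s) • Pi.single ⟨i₀, 0, hm⟩ 1
  have hγ0 : γ 0 = y₀ := by simp [γ]
  have hγ : Continuous γ := by fun_prop
  have hev : p =ᶠ[nhds 0] fun _ => ∏ l : {l : Σ i, Fin (m i) // l.1 ≠ i₀},
      ((1 + κ i₀ * κ l.1.1) / (κ i₀ - κ l.1.1) - c) := by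
    have e1 : ∀ᶠ s in nhds (0 : ℝ), s ∈ Set.Ioo (-(Real.pi / 2)) (Real.pi / 2) :=
      Ioo_mem_nhds (by linarith [Real.pi_pos]) (by linarith [Real.pi_pos])
    have e2 : ∀ᶠ s in nhds (0 : ℝ), γ s ∈ Metric.ball y₀ r :=
      hγ.continuousAt.eventually_mem (by rw [hγ0]; exact Metric.ball_mem_nhds _ hC.pos)
    have e3 : ∀ᶠ s in nhds (0 : ℝ), 0 < (inner ℝ η
        ((-1 : ℝ) • f (Ψ (γ s)) + κ i₀ • ξ (Ψ (γ s))) : ℝ) := by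
      have hc : ContinuousAt (fun z => (inner ℝ η ((-1 : ℝ) • f (Ψ z) + κ i₀ • ξ (Ψ z)) : ℝ))
          (γ 0) := by
        rw [hγ0]
        exact continuousAt_const.inner (𝕜 := ℝ) (hC.hasFDerivAt hC.center_mem _ _).continuousAt
      have hc' := hc.comp hγ.continuousAt
      refine hc'.eventually_const_lt ?_
      simp only [Function.comp_apply]
      rw [hγ0, hC.apply_center, hη, hC.immersion.inner_combination hC.mem₀]
      nlinarith [mul_self_nonneg (κ i₀)]
    filter_upwards [e1, e2, e3] with s h1 h2 h3
    obtain ⟨h4, h5⟩ := hC.normal_add_single ⟨0, hm⟩ h1 rfl h2 h3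
    rw [← hC.det_focal_sub h2 h4 c]
    simp only [p, N]
    rw [h5]
  have hpc := hp.eq_of_eventuallyEq (g := fun _ => ∏ l : {l : Σ i, Fin (m i) // l.1 ≠ i₀},
      ((1 + κ i₀ * κ l.1.1) / (κ i₀ - κ l.1.1) - c)) (fun _ _ => analyticAt_const) hev
  have h1 : p Real.pi = _ := congrFun hpc Real.pi
  rw [← h1]
  have h0 := hC.det_focal_sub hC.center_mem (by ext l; simp [freeze]) (-c)
  rw [hC.apply_center] at h0
  -- Here `N π = -η`, and the sign of the determinant of the negative matrix is absorbed into the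
  -- factors of the product.
  have h2 : (Matrix.of (fun j k => inner ℝ (N Real.pi) (Q j k)) - c • 1 :
      Matrix {l : Σ i, Fin (m i) // l.1 ≠ i₀} {l : Σ i, Fin (m i) // l.1 ≠ i₀} ℝ) =
      -(Matrix.of (fun j k => inner ℝ η (Q j k)) - (-c) • 1) := by
    ext j k
    simp [N, inner_neg_left]
    ring
  simp only [p]
  rw [h2, Matrix.det_neg, h0, ← Finset.card_univ, ← Finset.prod_neg]
  exact Finset.prod_congr rfl fun l _ => by ring

end IsFocalChart

/-! ### Reflection symmetry of the principal curvatures -/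

/-- Up to a common sign the products are values of monic polynomials with roots `a l` and `b l`;
these polynomials agree, hence so do their root multiplicities. -/
theorem card_fiber_eq_of_prod_sub_eq {J : Type*} [Fintype J] {a b : J → ℝ}
    (h : ∀ c, ∏ l, (a l - c) = ∏ l, (b l - c)) (v : ℝ) :
    Nat.card {l // a l = v} = Nat.card {l // b l = v} := by
  classical
  have key : ∀ a : J → ℝ, (∏ l, (Polynomial.X - Polynomial.C (a l))).roots.count v =
      Nat.card {l // a l = v} := by
    intro a
    rw [Polynomial.roots_prod _ _ (Finset.prod_ne_zero_iff.2 fun l _ => Polynomial.X_sub_C_ne_zero _)]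
    simp only [Polynomial.roots_X_sub_C, Multiset.count_bind, Multiset.count_singleton]
    rw [Nat.card_eq_fintype_card, Fintype.card_subtype, Finset.card_filter]
    exact Finset.sum_congr rfl fun l _ => by simp only [eq_comm]
  rw [← key a, ← key b]
  congr 2
  refine Polynomial.funext fun c => ?_
  have h1 : ∀ a : J → ℝ, ∏ l, (c - a l) = (-1) ^ Fintype.card J * ∏ l, (a l - c) := by
    intro a
    rw [← Finset.card_univ, ← Finset.prod_neg]
    exact Finset.prod_congr rfl fun l _ => by ring
  simp only [Polynomial.eval_prod, Polynomial.eval_sub, Polynomial.eval_X, Polynomial.eval_C]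
  rw [h1, h1, h]

theorem card_sigma_fiber {g : ℕ} (m : Fin g → ℕ) (i₀ : Fin g) {φ : Fin g → ℝ} {v : ℝ} {i : Fin g}
    (hi : i ≠ i₀) (hφ : ∀ j, j ≠ i₀ → (φ j = v ↔ j = i)) :
    Nat.card {l : {l : Σ i, Fin (m i) // l.1 ≠ i₀} // φ l.1.1 = v} = m i := by
  have e1 : {l : {l : Σ i, Fin (m i) // l.1 ≠ i₀} // φ l.1.1 = v} ≃
      {l : Σ i, Fin (m i) // l.1 = i} :=
    (Equiv.subtypeSubtypeEquivSubtypeInter (fun l : Σ i, Fin (m i) => l.1 ≠ i₀)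
      fun l => φ l.1 = v).trans (Equiv.subtypeEquivRight fun l =>
        ⟨fun h => (hφ _ h.1).1 h.2, fun h => ⟨h ▸ hi, (hφ _ (h ▸ hi)).2 h⟩⟩)
  rw [Nat.card_congr (e1.trans (Equiv.sigmaSubtype i)), Nat.card_fin]

/-- The principal curvatures of the focal submanifold of the `i₀`-th principal curvature are
symmetric about zero. -/
theorem SphereHypersurface.IsIsoparametric.exists_reflection {n : ℕ} {M : SphereHypersurface.{u} n}
    {g : ℕ} {κ : Fin g → ℝ} {m : Fin g → ℕ} (hM : M.IsIsoparametric κ m) {i₀ i : Fin g}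
    (hi : i ≠ i₀) : ∃ j, j ≠ i₀ ∧ m j = m i ∧
      (1 + κ i₀ * κ j) / (κ i₀ - κ j) = -((1 + κ i₀ * κ i) / (κ i₀ - κ i)) := by
  obtain ⟨p⟩ := M.nonempty
  have hx := mem_extChartAt_target (I := 𝓡 n) p
  obtain ⟨e, he⟩ := hM.exists_isEigenFrame_param p hx
  obtain ⟨Ψ, y₀, r, hC⟩ := exists_isFocalChart (M.isSphereImmersion p)
    (fun x hx => hM.exists_isEigenFrame_param p hx) hM.strictAnti.injective hx i₀ he
  have hprod := hC.prod_sub_eq (M.pos_of_isIsoparametric hM i₀)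
  -- For `κ = cot α` this is `cot (α j - α i₀)`, so distinct principal curvatures give distinct
  -- values.
  set φ : Fin g → ℝ := fun j => (1 + κ i₀ * κ j) / (κ i₀ - κ j)
  have hinj : ∀ j k, j ≠ i₀ → k ≠ i₀ → φ j = φ k → j = k := by
    intro j k hj hk h
    have h1 : κ i₀ - κ j ≠ 0 := sub_ne_zero.2 fun h => hj (hM.strictAnti.injective h.symm)
    have h2 : κ i₀ - κ k ≠ 0 := sub_ne_zero.2 fun h => hk (hM.strictAnti.injective h.symm)
    have h3 : (1 + κ i₀ ^ 2) * (κ j - κ k) = 0 := by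
      have := (div_eq_div_iff h1 h2).1 h
      linear_combination this
    have h4 : (1 + κ i₀ ^ 2) ≠ 0 := by positivity
    exact hM.strictAnti.injective (sub_eq_zero.1 ((mul_eq_zero.1 h3).resolve_left h4))
  have hcard := card_fiber_eq_of_prod_sub_eq hprod (φ i)
  have h1 := card_sigma_fiber m i₀ (φ := φ) hi fun j hj =>
    ⟨fun h => hinj j i hj hi h, fun h => by rw [h]⟩
  have h1' := hcard.symm.trans h1
  have hpos : 0 < Nat.card {l : {l : Σ i, Fin (m i) // l.1 ≠ i₀} // -φ l.1.1 = φ i} := by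
    rw [h1']
    exact M.pos_of_isIsoparametric hM i
  obtain ⟨l, hl⟩ := (Nat.card_pos_iff.1 hpos).1
  refine ⟨l.1.1, l.2, ?_, neg_eq_iff_eq_neg.1 hl⟩
  rw [← h1', card_sigma_fiber m i₀ (φ := fun j => -φ j) l.2 fun j hj => ⟨fun h =>
    hinj j _ hj l.2 (neg_injective (h.trans hl.symm)), fun h => by rw [h]; exact hl⟩]

/-! ### Sequences symmetric about each of their terms -/

section Spacing

variable {g : ℕ} (α : Fin g → ℝ)

/-- Reflected in `a k`, the next term lands at or below `a (k - 1)` and the previous term at or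
above `a (k + 1)`; the two inequalities together force equality. -/
theorem reflection_symmetric_neighbours {a : ℤ → ℝ} (ha : StrictMono a) {μ : ℤ → ℕ}
    (h : ∀ k j, ∃ j', a j' = 2 * a k - a j ∧ μ j' = μ j) (k : ℤ) :
    a (k + 1) - a k = a k - a (k - 1) ∧ μ (k + 1) = μ (k - 1) := by
  obtain ⟨j, hj, hj'⟩ := h k (k + 1)
  obtain ⟨l, hl, -⟩ := h k (k - 1)
  have h1 : a j < a k := by linarith [ha (lt_add_one k)]
  have h2 : a k < a l := by linarith [ha (sub_one_lt k)]
  have h3 : a j ≤ a (k - 1) := ha.monotone (Int.le_sub_one_of_lt (ha.lt_iff_lt.1 h1))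
  have h4 : a (k + 1) ≤ a l := ha.monotone (Int.add_one_le_of_lt (ha.lt_iff_lt.1 h2))
  have h5 : a j = a (k - 1) := by linarith
  refine ⟨by linarith, ?_⟩
  rw [← hj', ha.injective h5]

/-- The residue of an integer as an element of `Fin g`. -/
def residue (hg : 0 < g) (k : ℤ) : Fin g :=
  ⟨(k % g).toNat, by have := Int.emod_lt_of_pos k (by exact_mod_cast hg : (0 : ℤ) < g); omega⟩

theorem residue_mul_add (hg : 0 < g) (q : ℤ) (i : Fin g) : residue hg (g * q + i) = i := by
  ext
  simp only [residue]
  rw [Int.mul_add_emod_self_left, Int.emod_eq_of_lt (by positivity) (by exact_mod_cast i.2)]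
  simp

theorem mul_add_ediv (hg : 0 < g) (q : ℤ) (i : Fin g) : ((g : ℤ) * q + i) / g = q := by
  rw [Int.mul_add_ediv_left _ _ (by omega), Int.ediv_eq_zero_of_lt (by positivity)
    (by exact_mod_cast i.2), add_zero]

theorem mul_ediv_add_residue (hg : 0 < g) (k : ℤ) : (g : ℤ) * (k / g) + residue hg k = k := by
  have h1 := Int.mul_ediv_add_emod k g
  have h2 := Int.emod_nonneg k (by omega : (g : ℤ) ≠ 0)
  simp only [residue]
  omega

theorem strictMono_periodic_extension (hg : 0 < g) (hα : StrictMono α)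
    (hα' : ∀ i, α i ∈ Set.Ioo 0 Real.pi) :
    StrictMono fun k : ℤ => α (residue hg k) + Real.pi * (k / g : ℤ) := by
  refine strictMono_int_of_lt_succ fun k => ?_
  have hk := mul_ediv_add_residue hg k
  set q := k / g
  set i := residue hg k
  by_cases hi : (i : ℕ) + 1 < g
  · have h1 : k + 1 = g * q + ((⟨i + 1, hi⟩ : Fin g) : ℕ) := by
      push_cast
      omega
    rw [h1, residue_mul_add, mul_add_ediv hg]
    have : α i < α ⟨i + 1, hi⟩ := hα (by simp [Fin.lt_def])
    linarith
  · have h1 : k + 1 = g * (q + 1) + ((⟨0, hg⟩ : Fin g) : ℕ) := by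
      have := i.2
      push_cast
      rw [mul_add]
      omega
    rw [h1, residue_mul_add, mul_add_ediv hg]
    push_cast
    linarith [(hα' i).2, (hα' ⟨0, hg⟩).1]

/-- The angles modulo `π` are listed as one increasing sequence over `ℤ`, symmetric about each term.
Its differences are constant, and `g` of them add up to `π`. Multiplicities two steps apart are
exchanged by the reflection in the term between. -/
theorem equally_spaced_of_reflection (hg : 0 < g) (hα : StrictMono α)
    (hα' : ∀ i, α i ∈ Set.Ioo 0 Real.pi) {m : Fin g → ℕ}
    (h : ∀ i₀ i, i ≠ i₀ → ∃ j, m j = m i ∧ ∃ ε : ℤ, α j = 2 * α i₀ - α i + ε * Real.pi) :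
    (∀ i : Fin g, α i = α ⟨0, hg⟩ + i * (Real.pi / g)) ∧
      ∀ i j : Fin g, (j : ℕ) = (i + 2) % g → m j = m i := by
  set a : ℤ → ℝ := fun k => α (residue hg k) + Real.pi * (k / g : ℤ)
  have ha : StrictMono a := strictMono_periodic_extension α hg hα hα'
  have haq : ∀ (q : ℤ) (i : Fin g), a (g * q + i) = α i + Real.pi * q := fun q i => by
    simp only [a]
    rw [residue_mul_add, mul_add_ediv hg]
  have key := reflection_symmetric_neighbours ha (μ := fun k => m (residue hg k)) fun k j => by
    -- If `j` and `k` have the same residue, the terms differ by a multiple of `π` and the reflected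
    -- term is a shift of the same angle; `h` does not cover this case.
    by_cases hkj : residue hg j = residue hg k
    · refine ⟨g * (2 * (k / g) - j / g) + residue hg k, ?_, ?_⟩
      · rw [haq]
        simp only [a, hkj]
        push_cast
        ring
      · rw [residue_mul_add, hkj]
    · obtain ⟨l, hl, ε, hε⟩ := h _ _ hkj
      refine ⟨g * (2 * (k / g) - j / g - ε) + l, ?_, ?_⟩
      · rw [haq, hε]
        simp only [a]
        push_cast
        ring
      · rw [residue_mul_add, hl]
  have hlin : ∀ k : ℕ, a k = a 0 + k * (a 1 - a 0) ∧ a (k + 1) - a k = a 1 - a 0 := by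
    intro k
    induction k with
    | zero => simp
    | succ k ih =>
      have := (key (k + 1)).1
      rw [add_sub_cancel_right] at this
      push_cast
      constructor
      · linarith
      · linarith
  have hz := haq 0 ⟨0, hg⟩
  have hp := haq 1 ⟨0, hg⟩
  have hgl := (hlin g).1
  simp only [mul_zero, mul_one, Nat.cast_zero, add_zero, Int.cast_zero, Int.cast_one]
    at hz hp
  rw [hp, hz] at hgl
  have hgR : (g : ℝ) ≠ 0 := by exact_mod_cast hg.ne'
  have hδ : a 1 - a 0 = Real.pi / g := by
    rw [eq_div_iff hgR, hz]
    linarith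
  refine ⟨fun i => ?_, fun i j hij => ?_⟩
  · have h1 := haq 0 i
    simp only [mul_zero, zero_add, Int.cast_zero, add_zero] at h1
    rw [← h1, (hlin i).1, hδ, hz]
  · have h1 := (key (i + 1)).2
    rw [add_sub_cancel_right] at h1
    have h2 : residue hg i = i := by simpa using residue_mul_add hg 0 i
    have h3 : residue hg ((i : ℤ) + 1 + 1) = j := by
      ext
      rw [hij]
      simp only [residue]
      have : ((i : ℤ) + 1 + 1) % g = (((i + 2) % g : ℕ) : ℤ) := by
        push_cast
        ring_nf
      rw [this, Int.toNat_natCast]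
    rw [h2, h3] at h1
    exact h1

end Spacing

/-! ### The curvatures `cot (φ + i π / g)` -/

theorem sin_pos_of_spaced {g : ℕ} {φ : ℝ} (hφ : φ ∈ Set.Ioo 0 (Real.pi / g)) (i : Fin g) :
    φ + i * (Real.pi / g) ∈ Set.Ioo 0 Real.pi := by
  have hg : (0 : ℝ) < g := by exact_mod_cast i.pos
  have h0 : 0 < Real.pi / g := div_pos Real.pi_pos hg
  have h1 : ((i : ℕ) : ℝ) + 1 ≤ g := by exact_mod_cast i.2
  refine ⟨by have := hφ.1; positivity, ?_⟩
  have h2 : (((i : ℕ) : ℝ) + 1) * (Real.pi / g) ≤ g * (Real.pi / g) :=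
    mul_le_mul_of_nonneg_right h1 h0.le
  rw [mul_div_cancel₀ _ hg.ne'] at h2
  linarith [hφ.2]

theorem cot_lt_cot {x y : ℝ} (hx : x ∈ Set.Ioo 0 Real.pi) (hy : y ∈ Set.Ioo 0 Real.pi)
    (h : x < y) : Real.cot y < Real.cot x := by
  have h1 := Real.sin_pos_of_mem_Ioo hx
  have h2 := Real.sin_pos_of_mem_Ioo hy
  have h3 : 0 < Real.sin (y - x) := Real.sin_pos_of_pos_of_lt_pi (by linarith)
    (by linarith [hx.1, hy.2])
  rw [Real.cot_eq_cos_div_sin, Real.cot_eq_cos_div_sin, div_lt_div_iff₀ h2 h1]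
  rw [Real.sin_sub] at h3
  linarith

/-- The principal curvatures `cot (φ + i π / g)`. -/
noncomputable def spacedCurvature (g : ℕ) (φ : ℝ) (i : Fin g) : ℝ :=
  Real.cot (φ + i * (Real.pi / g))

theorem strictAnti_spacedCurvature {g : ℕ} {φ : ℝ} (hφ : φ ∈ Set.Ioo 0 (Real.pi / g)) :
    StrictAnti (spacedCurvature g φ) := by
  intro i j hij
  have hg : (0 : ℝ) < g := by exact_mod_cast i.pos
  have hij' : ((i : ℕ) : ℝ) < (j : ℕ) := by exact_mod_cast hij
  refine cot_lt_cot (sin_pos_of_spaced hφ i) (sin_pos_of_spaced hφ j) ?_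
  have := mul_lt_mul_of_pos_right hij' (div_pos Real.pi_pos hg)
  linarith

theorem sin_sub_eq_mul_spacedCurvature {g : ℕ} {φ : ℝ} (hφ : φ ∈ Set.Ioo 0 (Real.pi / g))
    (i : Fin g) (t : ℝ) :
    Real.sin (φ + i * (Real.pi / g) - t) =
      Real.sin (φ + i * (Real.pi / g)) * (Real.cos t - Real.sin t * spacedCurvature g φ i) := by
  have h := (Real.sin_pos_of_mem_Ioo (sin_pos_of_spaced hφ i)).ne'
  rw [Real.sin_sub, spacedCurvature, Real.cot_eq_cos_div_sin]
  generalize φ + i * (Real.pi / g) = a at h ⊢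
  field_simp

theorem continuousAt_spacedCurvature {g : ℕ} {φ : ℝ} (hφ : φ ∈ Set.Ioo 0 (Real.pi / g))
    (i : Fin g) : ContinuousAt (fun φ => spacedCurvature g φ i) φ := by
  have h := (Real.sin_pos_of_mem_Ioo (sin_pos_of_spaced hφ i)).ne'
  simp only [spacedCurvature, Real.cot_eq_cos_div_sin]
  exact ContinuousAt.div (by fun_prop) (by fun_prop) h

/-! ### Münzner's theorem and the minimal member of the family -/

namespace SphereHypersurface

variable {n : ℕ} {M : SphereHypersurface.{u} n} {g : ℕ} {κ : Fin g → ℝ} {m : Fin g → ℕ}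

theorem continuousAt_principalRicci {φ : ℝ} (hφ : φ ∈ Set.Ioo 0 (Real.pi / g)) (m : Fin g → ℕ)
    (i : Fin g) : ContinuousAt
      (fun φ => principalRicci (spacedCurvature g φ) m (spacedCurvature g φ i)) φ := by
  unfold principalRicci
  have h := continuousAt_spacedCurvature hφ
  have hs : ContinuousAt (fun φ => ∑ j, (m j : ℝ) * spacedCurvature g φ j) φ :=
    tendsto_finsetSum _ fun j _ => (h j).const_mul (m j : ℝ)
  exact (continuousAt_const.add (hs.mul (h i))).sub ((h i).pow 2)

/-- **Münzner's theorem** on the principal curvatures of an isoparametric hypersurface and their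
multiplicities. -/
theorem IsIsoparametric.exists_spaced (hM : M.IsIsoparametric κ m) (hg : 0 < g) :
    (∃ θ ∈ Set.Ioo 0 (Real.pi / g), κ = spacedCurvature g θ) ∧
      ∀ i j : Fin g, (j : ℕ) = (i + 2) % g → m j = m i := by
  set α : Fin g → ℝ := fun i => Real.pi / 2 - Real.arctan (κ i)
  have hα : StrictMono α := fun i j hij => by
    simp only [α]
    linarith [Real.arctan_strictMono (hM.strictAnti hij)]
  have hα' : ∀ i, α i ∈ Set.Ioo 0 Real.pi := fun i => by
    have h1 := Real.arctan_lt_pi_div_two (κ i)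
    have h2 := Real.neg_pi_div_two_lt_arctan (κ i)
    constructor <;> simp only [α] <;> linarith
  have hs : ∀ i, 0 < Real.sin (α i) := fun i => Real.sin_pos_of_mem_Ioo (hα' i)
  have hc : ∀ i, Real.cos (α i) = κ i * Real.sin (α i) := fun i => by
    have h := Real.tan_arctan (κ i)
    rw [Real.tan_eq_sin_div_cos, div_eq_iff (Real.cos_arctan_pos _).ne'] at h
    simpa only [α, Real.cos_pi_div_two_sub, Real.sin_pi_div_two_sub] using h
  clear_value α
  have key := equally_spaced_of_reflection α hg hα hα' (m := m) fun i₀ i hi => by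
    obtain ⟨j, hj, hmj, h⟩ := hM.exists_reflection hi
    refine ⟨j, hmj, ?_⟩
    have h1 : κ i₀ - κ j ≠ 0 := sub_ne_zero.2 fun h => hj (hM.strictAnti.injective h.symm)
    have h2 : κ i₀ - κ i ≠ 0 := sub_ne_zero.2 fun h => hi (hM.strictAnti.injective h.symm)
    rw [← neg_div, div_eq_div_iff h1 h2] at h
    -- The reflection identity says `cot (α j - α i₀) = -cot (α i - α i₀)`; cleared of denominators,
    -- the sine of the sum of the two differences vanishes.
    have h3 : Real.sin (α j - α i₀ + (α i - α i₀)) = 0 := by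
      rw [Real.sin_add, Real.sin_sub, Real.sin_sub, Real.cos_sub, Real.cos_sub, hc, hc, hc]
      linear_combination Real.sin (α i₀) ^ 2 * Real.sin (α i) * Real.sin (α j) * h
    obtain ⟨ε, hε⟩ := Real.sin_eq_zero_iff.1 h3
    exact ⟨ε, by linarith⟩
  refine ⟨⟨α ⟨0, hg⟩, ⟨(hα' _).1, ?_⟩, ?_⟩, key.2⟩
  · have h1 := key.1 ⟨g - 1, by omega⟩
    have h2 := (hα' ⟨g - 1, by omega⟩).2
    have hgR : (0 : ℝ) < g := by exact_mod_cast hg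
    rw [h1, Nat.cast_sub (by omega : 1 ≤ g), sub_mul, mul_div_cancel₀ _ hgR.ne'] at h2
    push_cast at h2
    linarith
  · ext i
    rw [spacedCurvature, ← key.1, Real.cot_eq_cos_div_sin, hc, mul_div_cancel_right₀ _ (hs i).ne']

/-- Focal points occur where some `sin (θ + i π / g - s)` vanishes; the nearest to `s = 0` are `s =
θ`, from `i = 0`, and `s = θ - π / g`, from `i = g - 1`. -/
theorem IsIsoparametric.mem_familyParams_iff {θ : ℝ}
    (hM : M.IsIsoparametric (spacedCurvature g θ) m) (hg : 0 < g)
    (hθ : θ ∈ Set.Ioo 0 (Real.pi / g)) (t : ℝ) :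
    t ∈ M.familyParams ↔ θ - t ∈ Set.Ioo 0 (Real.pi / g) := by
  have hgR : (0 : ℝ) < g := by exact_mod_cast hg
  have hfoc : ∀ s p, Function.Injective (mfderiv (𝓡 n) (𝓡 (n + 2)) (M.parallelMap s) p) ↔
      ∀ i : Fin g, Real.sin (θ + i * (Real.pi / g) - s) ≠ 0 := by
    intro s p
    rw [hM.injective_mfderiv_parallelMap_iff]
    refine forall_congr' fun i => ?_
    rw [sin_sub_eq_mul_spacedCurvature hθ, mul_ne_zero_iff]
    have := (Real.sin_pos_of_mem_Ioo (sin_pos_of_spaced hθ i)).ne'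
    tauto
  constructor
  · intro ht
    obtain ⟨p⟩ := M.nonempty
    constructor
    · by_contra! h
      have hs : θ ∈ Set.uIcc 0 t := by
        rw [Set.uIcc_of_le (by linarith [hθ.1])]
        exact ⟨hθ.1.le, by linarith⟩
      exact (hfoc θ p).1 (ht θ hs p) ⟨0, hg⟩ (by simp)
    · by_contra! h
      have hs : θ - Real.pi / g ∈ Set.uIcc 0 t := by
        rw [Set.uIcc_of_ge (by linarith [hθ.2])]
        exact ⟨by linarith, by linarith [hθ.2]⟩
      refine (hfoc _ p).1 (ht _ hs p) ⟨g - 1, by omega⟩ ?_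
      rw [Nat.cast_sub (by omega : 1 ≤ g), sub_mul, mul_div_cancel₀ _ hgR.ne']
      simp
  · intro ht s hs p
    rw [hfoc]
    intro i
    have hφ : θ - s ∈ Set.Ioo 0 (Real.pi / g) := by
      rcases Set.mem_uIcc.1 hs with h | h
      · exact ⟨by linarith [ht.1, h.2], by linarith [hθ.2, h.1]⟩
      · exact ⟨by linarith [hθ.1, h.2], by linarith [ht.2, h.1]⟩
    rw [show θ + i * (Real.pi / g) - s = θ - s + i * (Real.pi / g) by ring]
    exact (Real.sin_pos_of_mem_Ioo (sin_pos_of_spaced hφ i)).ne'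

theorem IsIsoparametric.parallel_spaced {θ : ℝ}
    (hM : M.IsIsoparametric (spacedCurvature g θ) m) (hg : 0 < g)
    (hθ : θ ∈ Set.Ioo 0 (Real.pi / g)) (t : M.familyParams) :
    (M.parallel t).IsIsoparametric (spacedCurvature g (θ - t)) m := by
  have ht := (hM.mem_familyParams_iff hg hθ t).1 t.2
  refine hM.parallel t (strictAnti_spacedCurvature ht) fun i => ?_
  have h1 := (Real.sin_pos_of_mem_Ioo (sin_pos_of_spaced hθ i)).ne'
  have h2 := (Real.sin_pos_of_mem_Ioo (sin_pos_of_spaced ht i)).ne'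
  have h3 := sin_sub_eq_mul_spacedCurvature hθ i t
  rw [show θ + i * (Real.pi / g) - t = θ - t + i * (Real.pi / g) by ring] at h3
  apply mul_left_cancel₀ h1
  rw [mul_left_comm, ← h3, spacedCurvature, Real.cot_eq_cos_div_sin, div_mul_cancel₀ _ h2,
    show θ - t + i * (Real.pi / g) = θ + i * (Real.pi / g) - t by ring, Real.cos_sub,
    spacedCurvature, Real.cot_eq_cos_div_sin]
  generalize θ + i * (Real.pi / g) = a at h1 ⊢
  field_simp
  ring

theorem sum_mul_spacedCurvature_strictAnti (hg : 0 < g) (hm : ∀ i, 0 < m i) {φ ψ : ℝ}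
    (hφ : φ ∈ Set.Ioo 0 (Real.pi / g)) (hψ : ψ ∈ Set.Ioo 0 (Real.pi / g)) (h : φ < ψ) :
    ∑ i, (m i : ℝ) * spacedCurvature g ψ i < ∑ i, (m i : ℝ) * spacedCurvature g φ i := by
  refine Finset.sum_lt_sum_of_nonempty ⟨⟨0, hg⟩, Finset.mem_univ _⟩ fun i _ => ?_
  refine mul_lt_mul_of_pos_left ?_ (by exact_mod_cast hm i)
  exact cot_lt_cot (sin_pos_of_spaced hφ i) (sin_pos_of_spaced hψ i) (by linarith)

/-- The member at `t` has angle `θ - t`, so `t₀ = θ - φ`, and distances between parameters are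
distances between angles. Uniqueness holds because each cotangent, hence `H`, is strictly
decreasing. -/
theorem IsIsoparametric.exists_minimal (hM : M.IsIsoparametric κ m) (hg : 0 < g) {φ : ℝ}
    (hφ : φ ∈ Set.Ioo 0 (Real.pi / g)) (h0 : ∑ i, (m i : ℝ) * spacedCurvature g φ i = 0) :
    ∃ t₀ : M.familyParams, (M.parallel t₀).IsMinimal ∧
      (∀ t : M.familyParams, (M.parallel t).IsMinimal → t = t₀) ∧
      ∀ t : M.familyParams, ∃ ψ, dist ψ φ = |(t : ℝ) - t₀| ∧
        (M.parallel t).IsIsoparametric (spacedCurvature g ψ) m := by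
  obtain ⟨⟨θ, hθ, rfl⟩, -⟩ := hM.exists_spaced hg
  have hmem : θ - φ ∈ M.familyParams := by
    rw [hM.mem_familyParams_iff hg hθ, sub_sub_cancel]
    exact hφ
  refine ⟨⟨θ - φ, hmem⟩, fun p => ?_, fun t ht => ?_, fun t => ⟨θ - t, ?_, ?_⟩⟩
  · have := hM.parallel_spaced hg hθ ⟨θ - φ, hmem⟩
    rw [this.meanCurvature_eq]
    simpa using h0
  · have hpar := hM.parallel_spaced hg hθ t
    obtain ⟨p⟩ := (M.parallel t).nonempty
    have h1 := ht p
    rw [hpar.meanCurvature_eq] at h1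
    have ht' := (hM.mem_familyParams_iff hg hθ t).1 t.2
    have hm := M.pos_of_isIsoparametric hM
    ext
    rcases lt_trichotomy (θ - t) φ with h | h | h
    · have := sum_mul_spacedCurvature_strictAnti hg hm ht' hφ h
      linarith
    · simp only
      linarith
    · have := sum_mul_spacedCurvature_strictAnti hg hm hφ ht' h
      linarith
  · rw [Real.dist_eq, ← abs_neg]
    congr 1
    ring
  · exact hM.parallel_spaced hg hθ t

/-- The number `ε` comes from continuity in the angle at `φ`, before any hypersurface is chosen.
Since `H = 0` at `φ`, the condition there is `κ i ^ 2 < n - 1`. -/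
theorem exists_forall_ricciPositive (hg : 0 < g) {φ : ℝ} (hφ : φ ∈ Set.Ioo 0 (Real.pi / g))
    (h0 : ∑ i, (m i : ℝ) * spacedCurvature g φ i = 0)
    (hpos : ∀ i, spacedCurvature g φ i ^ 2 < (∑ i, (m i : ℝ)) - 1) :
    ∃ ε : ℝ, 0 < ε ∧ ∀ (n : ℕ) (M : SphereHypersurface.{u} n) (κ : Fin g → ℝ),
      M.IsIsoparametric κ m → ∃ t₀ : M.familyParams, (M.parallel t₀).IsMinimal ∧
        (∀ t : M.familyParams, (M.parallel t).IsMinimal → t = t₀) ∧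
        ∀ t : M.familyParams, |(t : ℝ) - t₀| < ε → (M.parallel t).RicciPositive := by
  have hev : ∀ᶠ ψ in nhds φ, ∀ i, 0 < principalRicci (spacedCurvature g ψ) m
      (spacedCurvature g ψ i) := by
    rw [Filter.eventually_all]
    intro i
    refine (continuousAt_principalRicci hφ m i).eventually_const_lt ?_
    simp only [principalRicci, h0]
    linarith [hpos i]
  obtain ⟨ε, hε, hball⟩ := Metric.eventually_nhds_iff.1 hev
  refine ⟨ε, hε, fun n M κ hM => ?_⟩
  obtain ⟨t₀, h1, h2, h3⟩ := hM.exists_minimal hg hφ h0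
  refine ⟨t₀, h1, h2, fun t ht => ?_⟩
  obtain ⟨ψ, hψ, hpar⟩ := h3 t
  exact hpar.ricciPositive (hball (hψ.trans_lt ht))

theorem exists_forall_not_ricciNonneg (hg : 0 < g) {φ : ℝ} (hφ : φ ∈ Set.Ioo 0 (Real.pi / g))
    (h0 : ∑ i, (m i : ℝ) * spacedCurvature g φ i = 0) {i : Fin g}
    (hneg : (∑ i, (m i : ℝ)) - 1 < spacedCurvature g φ i ^ 2) :
    ∃ ε : ℝ, 0 < ε ∧ ∀ (n : ℕ) (M : SphereHypersurface.{u} n) (κ : Fin g → ℝ),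
      M.IsIsoparametric κ m → ∃ t₀ : M.familyParams, (M.parallel t₀).IsMinimal ∧
        (∀ t : M.familyParams, (M.parallel t).IsMinimal → t = t₀) ∧
        ∀ t : M.familyParams, |(t : ℝ) - t₀| < ε → ¬ (M.parallel t).RicciNonneg := by
  have hev : ∀ᶠ ψ in nhds φ, principalRicci (spacedCurvature g ψ) m
      (spacedCurvature g ψ i) < 0 := by
    refine (continuousAt_principalRicci hφ m i).eventually_lt_const ?_
    simp only [principalRicci, h0]
    linarith
  obtain ⟨ε, hε, hball⟩ := Metric.eventually_nhds_iff.1 hev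
  refine ⟨ε, hε, fun n M κ hM => ?_⟩
  obtain ⟨t₀, h1, h2, h3⟩ := hM.exists_minimal hg hφ h0
  refine ⟨t₀, h1, h2, fun t ht => ?_⟩
  obtain ⟨ψ, hψ, hpar⟩ := h3 t
  exact hpar.not_ricciNonneg (hball (hψ.trans_lt ht))

end SphereHypersurface

/-! ### The curvatures as rational functions of `cot φ` -/

theorem spacedCurvature_eq {g : ℕ} {φ : ℝ} (hφ : φ ∈ Set.Ioo 0 (Real.pi / g)) (i : Fin g) {β : ℝ}
    (hβ : i * (Real.pi / g) = β) :
    spacedCurvature g φ i = (Real.cot φ * Real.cos β - Real.sin β) /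
      (Real.cos β + Real.cot φ * Real.sin β) := by
  have h0 : Real.sin φ ≠ 0 := by
    simpa using (Real.sin_pos_of_mem_Ioo (sin_pos_of_spaced hφ ⟨0, i.pos⟩)).ne'
  rw [spacedCurvature, hβ, Real.cot_eq_cos_div_sin, Real.cot_eq_cos_div_sin, Real.cos_add,
    Real.sin_add]
  have h1 : Real.cos φ / Real.sin φ * Real.cos β - Real.sin β =
      (Real.cos φ * Real.cos β - Real.sin φ * Real.sin β) / Real.sin φ := by
    field_simp
  have h2 : Real.cos β + Real.cos φ / Real.sin φ * Real.sin β =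
      (Real.sin φ * Real.cos β + Real.cos φ * Real.sin β) / Real.sin φ := by
    field_simp
  rw [h1, h2, div_div_div_cancel_right₀ h0]

theorem cot_pi_div_lt {g : ℕ} (hg : 1 < g) {φ : ℝ} (hφ : φ ∈ Set.Ioo 0 (Real.pi / g)) :
    Real.cos (Real.pi / g) / Real.sin (Real.pi / g) < Real.cot φ := by
  have h1 : Real.pi / g < Real.pi := div_lt_self Real.pi_pos (by exact_mod_cast hg)
  rw [← Real.cot_eq_cos_div_sin]
  exact cot_lt_cot ⟨hφ.1, hφ.2.trans h1⟩ ⟨hφ.1.trans hφ.2, h1⟩ hφ.2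

theorem exists_cot_eq {g : ℕ} (hg : 1 < g) {x : ℝ}
    (hx : Real.cos (Real.pi / g) / Real.sin (Real.pi / g) < x) :
    ∃ φ ∈ Set.Ioo 0 (Real.pi / g), Real.cot φ = x := by
  have hcot : Real.cot (Real.pi / 2 - Real.arctan x) = x := by
    rw [Real.cot_eq_cos_div_sin, Real.cos_pi_div_two_sub, Real.sin_pi_div_two_sub,
      ← Real.tan_eq_sin_div_cos, Real.tan_arctan]
  have h1 := Real.arctan_lt_pi_div_two x
  have h2 := Real.neg_pi_div_two_lt_arctan x
  have h3 : Real.pi / g < Real.pi := div_lt_self Real.pi_pos (by exact_mod_cast hg)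
  have h4 : 0 < Real.pi / g := div_pos Real.pi_pos (by exact_mod_cast (by omega : 0 < g))
  refine ⟨Real.pi / 2 - Real.arctan x, ⟨by linarith, ?_⟩, hcot⟩
  rw [← Real.cot_eq_cos_div_sin, ← hcot] at hx
  by_contra! h
  rcases h.eq_or_lt with h | h
  · rw [h] at hx
    exact lt_irrefl _ hx
  · exact lt_asymm hx (cot_lt_cot ⟨h4, h3⟩ ⟨by linarith, by linarith⟩ h)

theorem spacedCurvature_three {φ : ℝ} (hφ : φ ∈ Set.Ioo 0 (Real.pi / (3 : ℕ))) :
    spacedCurvature 3 φ = ![Real.cot φ, (Real.cot φ - √3) / (1 + √3 * Real.cot φ),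
      -(Real.cot φ + √3) / (√3 * Real.cot φ - 1)] := by
  ext i
  fin_cases i
  · simp [spacedCurvature]
  · rw [spacedCurvature_eq hφ _ (β := Real.pi / 3) (by simp),
      Real.cos_pi_div_three, Real.sin_pi_div_three, ← mul_div_mul_left _ _ (two_ne_zero' ℝ)]
    simp only [Fin.mk_one, Matrix.cons_val]
    congr 1 <;> ring
  · rw [spacedCurvature_eq hφ _ (β := Real.pi - Real.pi / 3) (by norm_num; ring), Real.cos_pi_sub,
      Real.sin_pi_sub, Real.cos_pi_div_three, Real.sin_pi_div_three,
      ← mul_div_mul_left _ _ (two_ne_zero' ℝ)]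
    simp only [Fin.reduceFinMk, Matrix.cons_val]
    congr 1 <;> ring

theorem spacedCurvature_four {φ : ℝ} (hφ : φ ∈ Set.Ioo 0 (Real.pi / (4 : ℕ))) :
    spacedCurvature 4 φ = ![Real.cot φ, (Real.cot φ - 1) / (Real.cot φ + 1),
      -1 / Real.cot φ, -(Real.cot φ + 1) / (Real.cot φ - 1)] := by
  have h2 : √2 / 2 ≠ 0 := by positivity
  ext i
  fin_cases i
  · simp [spacedCurvature]
  · rw [spacedCurvature_eq hφ _ (β := Real.pi / 4) (by simp),
      Real.cos_pi_div_four, Real.sin_pi_div_four]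
    simp only [Fin.mk_one, Matrix.cons_val]
    rw [← mul_div_mul_left (_ - 1) _ h2]
    congr 1 <;> ring
  · rw [spacedCurvature_eq hφ _ (β := Real.pi / 2) (by norm_num; ring)]
    simp
  · rw [spacedCurvature_eq hφ _ (β := Real.pi - Real.pi / 4) (by norm_num; ring), Real.cos_pi_sub,
      Real.sin_pi_sub, Real.cos_pi_div_four, Real.sin_pi_div_four]
    simp only [Fin.reduceFinMk, Matrix.cons_val]
    rw [← mul_div_mul_left (-(_ + 1)) _ h2]
    congr 1 <;> ring

theorem spacedCurvature_six {φ : ℝ} (hφ : φ ∈ Set.Ioo 0 (Real.pi / (6 : ℕ))) :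
    spacedCurvature 6 φ = ![Real.cot φ, (√3 * Real.cot φ - 1) / (√3 + Real.cot φ),
      (Real.cot φ - √3) / (1 + √3 * Real.cot φ), -1 / Real.cot φ,
      -(Real.cot φ + √3) / (√3 * Real.cot φ - 1),
      -(√3 * Real.cot φ + 1) / (Real.cot φ - √3)] := by
  ext i
  fin_cases i
  · simp [spacedCurvature]
  · rw [spacedCurvature_eq hφ _ (β := Real.pi / 6) (by simp),
      Real.cos_pi_div_six, Real.sin_pi_div_six, ← mul_div_mul_left _ _ (two_ne_zero' ℝ)]
    simp only [Fin.mk_one, Matrix.cons_val]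
    congr 1 <;> ring
  · rw [spacedCurvature_eq hφ _ (β := Real.pi / 3) (by norm_num; ring),
      Real.cos_pi_div_three, Real.sin_pi_div_three, ← mul_div_mul_left _ _ (two_ne_zero' ℝ)]
    simp only [Fin.reduceFinMk, Matrix.cons_val]
    congr 1 <;> ring
  · rw [spacedCurvature_eq hφ _ (β := Real.pi / 2) (by norm_num; ring)]
    simp
  · rw [spacedCurvature_eq hφ _ (β := Real.pi - Real.pi / 3) (by norm_num; ring), Real.cos_pi_sub,
      Real.sin_pi_sub, Real.cos_pi_div_three, Real.sin_pi_div_three,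
      ← mul_div_mul_left _ _ (two_ne_zero' ℝ)]
    simp only [Fin.reduceFinMk, Matrix.cons_val]
    congr 1 <;> ring
  · rw [spacedCurvature_eq hφ _ (β := Real.pi - Real.pi / 6) (by norm_num; ring), Real.cos_pi_sub,
      Real.sin_pi_sub, Real.cos_pi_div_six, Real.sin_pi_div_six,
      ← mul_div_mul_left _ _ (two_ne_zero' ℝ)]
    simp only [Fin.reduceFinMk, Matrix.cons_val]
    congr 1 <;> ring

/-- For `x = cot θ` both sides are `3 cot (3 θ)`. -/
theorem sum_three_cot_thirds {x : ℝ} (h1 : 1 + √3 * x ≠ 0) (h2 : √3 * x - 1 ≠ 0) :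
    x + (x - √3) / (1 + √3 * x) + -(x + √3) / (√3 * x - 1) =
      3 * x * (x ^ 2 - 3) / (3 * x ^ 2 - 1) := by
  have h3 : (√3 : ℝ) ^ 2 = 3 := Real.sq_sqrt (by norm_num)
  have h4 : 3 * x ^ 2 - 1 = (1 + √3 * x) * (√3 * x - 1) := by linear_combination -x ^ 2 * h3
  rw [h4]
  obtain ⟨A, hA⟩ : ∃ A, A = 1 + √3 * x := ⟨_, rfl⟩
  obtain ⟨B, hB⟩ : ∃ B, B = √3 * x - 1 := ⟨_, rfl⟩
  rw [← hA] at h1 ⊢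
  rw [← hB] at h2 ⊢
  field_simp
  rw [hA, hB]
  linear_combination (x ^ 3 - 2 * x) * h3

/-- For `x = cot θ` both sides are `-3 tan (3 θ)`, the previous sum with `θ` shifted by `π / 6`. -/
theorem sum_three_cot_sixths {x : ℝ} (h0 : x ≠ 0) (h1 : √3 + x ≠ 0) (h2 : x - √3 ≠ 0) :
    (√3 * x - 1) / (√3 + x) + -1 / x + -(√3 * x + 1) / (x - √3) =
      -3 * (3 * x ^ 2 - 1) / (x * (x ^ 2 - 3)) := by
  have h3 : (√3 : ℝ) ^ 2 = 3 := Real.sq_sqrt (by norm_num)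
  have h4 : x ^ 2 - 3 = (√3 + x) * (x - √3) := by linear_combination h3
  rw [h4]
  field_simp
  linear_combination (1 - 2 * x ^ 2) * h3

/-! ### The cases of three, four and six principal curvatures -/

namespace SphereHypersurface

theorem IsIsoparametric.not_ricciNonneg_three {n : ℕ} {M : SphereHypersurface.{u} n}
    {κ : Fin 3 → ℝ} {m : Fin 3 → ℕ} (hM : M.IsIsoparametric κ m) (h : m 0 = 1) :
    ¬ M.RicciNonneg := by
  obtain ⟨⟨θ, hθ, hκ⟩, hm⟩ := hM.exists_spaced (by norm_num)
  have hm2 : m 2 = m 0 := hm 0 2 rfl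
  have hm1 : m 1 = m 2 := hm 2 1 rfl
  refine hM.not_ricciNonneg (i := 0) ?_
  have hx := cot_pi_div_lt (by norm_num) hθ
  rw [hκ, spacedCurvature_three hθ]
  generalize Real.cot θ = x at hx ⊢
  norm_num at hx
  have h3 : (√3 : ℝ) ^ 2 = 3 := Real.sq_sqrt (by norm_num)
  have h3' : 0 < (√3 : ℝ) := by positivity
  have hx0 : 0 < x := lt_trans (by positivity) hx
  have hx1 : 0 < √3 * x - 1 := by
    rw [div_lt_iff₀ (by positivity)] at hx
    linarith
  have hx2 : 0 < 3 * x ^ 2 - 1 := by nlinarith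
  have hs := sum_three_cot_thirds (x := x) (by positivity) hx1.ne'
  simp only [principalRicci, Fin.sum_univ_three, hm1, hm2, h, Matrix.cons_val, Nat.cast_one,
    one_mul, hs]
  have : 1 + 1 + 1 - 1 + 3 * x * (x ^ 2 - 3) / (3 * x ^ 2 - 1) * x - x ^ 2 =
      -(2 * x ^ 2 + 2) / (3 * x ^ 2 - 1) := by
    field_simp
    ring
  rw [this]
  exact div_neg_of_neg_of_pos (by nlinarith) hx2

/-- The minimal angle is `π / 6`, with curvatures `√3, 0, -√3`, and `3 < 3 m - 1` for `m ≥ 2`. -/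
theorem exists_forall_ricciPositive_three {m : Fin 3 → ℕ} (h : 1 < m 0) :
    ∃ ε : ℝ, 0 < ε ∧ ∀ (n : ℕ) (M : SphereHypersurface.{u} n) (κ : Fin 3 → ℝ),
      M.IsIsoparametric κ m → ∃ t₀ : M.familyParams, (M.parallel t₀).IsMinimal ∧
        (∀ t : M.familyParams, (M.parallel t).IsMinimal → t = t₀) ∧
        ∀ t : M.familyParams, |(t : ℝ) - t₀| < ε → (M.parallel t).RicciPositive := by
  by_cases hm : m 2 = m 0 ∧ m 1 = m 2
  · obtain ⟨hm2, hm1⟩ := hm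
    have h3 : (√3 : ℝ) ^ 2 = 3 := Real.sq_sqrt (by norm_num)
    have h3' : 0 < (√3 : ℝ) := by positivity
    obtain ⟨φ, hφ, hx⟩ := exists_cot_eq (g := 3) (x := √3) (by norm_num) (by
      norm_num
      rw [div_lt_iff₀ (by positivity)]
      nlinarith)
    have hs := spacedCurvature_three hφ
    rw [hx] at hs
    have h2 : √3 * √3 - 1 = 2 := by nlinarith
    have h4 : -(√3 + √3) / (2 : ℝ) = -√3 := by ring
    rw [sub_self, zero_div, h2, h4] at hs
    have ha : (2 : ℝ) ≤ m 0 := by exact_mod_cast h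
    refine exists_forall_ricciPositive (by norm_num) hφ ?_ fun i => ?_
    · simp [hs, Fin.sum_univ_three, hm1, hm2]
    · rw [hs, Fin.sum_univ_three, hm1, hm2]
      fin_cases i <;> simp <;> linarith
  -- Multiplicities that violate Münzner's theorem belong to no hypersurface, so any `ε` will do.
  · refine ⟨1, one_pos, fun n M κ hM => (hm ?_).elim⟩
    obtain ⟨-, h⟩ := hM.exists_spaced (by norm_num)
    exact ⟨h 0 2 rfl, h 2 1 rfl⟩

/-- For the multiplicity-one curvature `c` the term `c ^ 2` in `H c` cancels `-c ^ 2`, and the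
curvature `-1 / c` contributes `-1`. Here `c` is `κ 0` if `m 0 = 1` and `κ 3` if `m 1 = 1`. -/
theorem IsIsoparametric.not_ricciNonneg_four {n : ℕ} {M : SphereHypersurface.{u} n}
    {κ : Fin 4 → ℝ} {m : Fin 4 → ℕ} (hM : M.IsIsoparametric κ m) (h : m 0 = 1 ∨ m 1 = 1) :
    ¬ M.RicciNonneg := by
  obtain ⟨⟨θ, hθ, hκ⟩, hm⟩ := hM.exists_spaced (by norm_num)
  have hm2 : m 2 = m 0 := hm 0 2 rfl
  have hm3 : m 3 = m 1 := hm 1 3 rfl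
  have ha : (0 : ℝ) < m 0 := by exact_mod_cast M.pos_of_isIsoparametric hM 0
  have hb : (0 : ℝ) < m 1 := by exact_mod_cast M.pos_of_isIsoparametric hM 1
  have hx := cot_pi_div_lt (by norm_num) hθ
  have hs := spacedCurvature_four hθ
  rw [← hκ] at hs
  generalize Real.cot θ = x at hx hs
  norm_num at hx
  have hx0 : 0 < x := by linarith
  have hx1 : 0 < x - 1 := by linarith
  have hx2 : 0 < x ^ 2 - 1 := by nlinarith
  rcases h with h | h
  · refine hM.not_ricciNonneg (i := 0) ?_
    simp only [principalRicci, hs, Fin.sum_univ_four, hm2, hm3, h, Matrix.cons_val, Nat.cast_one,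
      one_mul]
    generalize (m 1 : ℝ) = b at hb ⊢
    have : 1 + b + 1 + b - 1 + (x + b * ((x - 1) / (x + 1)) + -1 / x +
        b * (-(x + 1) / (x - 1))) * x - x ^ 2 = -b * (2 * x ^ 2 + 2) / (x ^ 2 - 1) := by
      rw [show x ^ 2 - 1 = (x + 1) * (x - 1) by ring]
      field_simp
      ring
    rw [this]
    exact div_neg_of_neg_of_pos (by nlinarith [mul_pos hb (by positivity : 0 < 2 * x ^ 2 + 2)]) hx2
  · refine hM.not_ricciNonneg (i := 3) ?_
    simp only [principalRicci, hs, Fin.sum_univ_four, hm2, hm3, h, Matrix.cons_val, Nat.cast_one,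
      one_mul]
    generalize (m 0 : ℝ) = a at ha ⊢
    have : a + 1 + a + 1 - 1 + (a * x + (x - 1) / (x + 1) + a * (-1 / x) +
        -(x + 1) / (x - 1)) * (-(x + 1) / (x - 1)) - (-(x + 1) / (x - 1)) ^ 2 =
          -a * (x ^ 2 + 1) / x := by
      field_simp
      ring
    rw [this]
    exact div_neg_of_neg_of_pos (by nlinarith [mul_pos ha (by positivity : 0 < x ^ 2 + 1)]) hx0

theorem exists_forall_ricciPositive_four {m : Fin 4 → ℕ} (h0 : 2 ≤ m 0) (h1 : 2 ≤ m 1) :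
    ∃ ε : ℝ, 0 < ε ∧ ∀ (n : ℕ) (M : SphereHypersurface.{u} n) (κ : Fin 4 → ℝ),
      M.IsIsoparametric κ m → ∃ t₀ : M.familyParams, (M.parallel t₀).IsMinimal ∧
        (∀ t : M.familyParams, (M.parallel t).IsMinimal → t = t₀) ∧
        ∀ t : M.familyParams, |(t : ℝ) - t₀| < ε → (M.parallel t).RicciPositive := by
  by_cases hm : m 2 = m 0 ∧ m 3 = m 1
  · obtain ⟨hm2, hm3⟩ := hm
    have ha : (2 : ℝ) ≤ m 0 := by exact_mod_cast h0
    have hb : (2 : ℝ) ≤ m 1 := by exact_mod_cast h1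
    -- Here `s` is `cot (2 φ)`: the mean curvature is `2 m₀ cot (2 φ) - 2 m₁ tan (2 φ)`, and `x ^ 2
    -- - 1 = 2 s x` is the double-angle formula for `x = cot φ`.
    set s : ℝ := √((m 1 : ℝ) / m 0) with hs
    have hs0 : 0 < s := Real.sqrt_pos.2 (by positivity)
    have hs2 : m 0 * s ^ 2 = m 1 := by
      rw [hs, Real.sq_sqrt (by positivity)]
      field_simp
    obtain ⟨x, hx1, hx⟩ : ∃ x : ℝ, 1 < x ∧ x ^ 2 - 1 = 2 * s * x := by
      have hr : √(s ^ 2 + 1) ^ 2 = s ^ 2 + 1 := Real.sq_sqrt (by positivity)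
      have hr0 := Real.sqrt_nonneg (s ^ 2 + 1)
      exact ⟨s + √(s ^ 2 + 1), by nlinarith, by linear_combination hr⟩
    obtain ⟨φ, hφ, rfl⟩ := exists_cot_eq (g := 4) (by norm_num) (by norm_num; exact hx1)
    have hc := spacedCurvature_four hφ
    generalize Real.cot φ = x at hx1 hx hc
    have hx0 : 0 < x := by linarith
    have hx' : 0 < x - 1 := by linarith
    have hx2 : 0 < x + 1 := by linarith
    -- Here `z` and `w` are principal curvatures whose angles differ by `π / 2`. If `z ^ 2 ≥ n - 1`,
    -- then `d ^ 2 ≤ z ^ 2 - 3`, and `(z ^ 2 - 1) ^ 2 = d ^ 2 * z ^ 2` would force `z ^ 2 ≤ -1`.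
    have hq : ∀ z w d : ℝ, z * w = -1 → z + w = d → (d ^ 2 ≤ 2 * m 0 ∨ d ^ 2 ≤ 2 * m 1) →
        z ^ 2 < (m 0 + m 1 + m 0 + m 1 : ℝ) - 1 := by
      intro z w d hzw hd hle
      have h : (z ^ 2 - 1) ^ 2 = d ^ 2 * z ^ 2 := by
        rw [← hd]
        linear_combination (1 - 2 * z ^ 2 - z * w) * hzw
      by_contra! hz
      have hd : d ^ 2 ≤ z ^ 2 - 3 := by rcases hle with hle | hle <;> linarith
      nlinarith [mul_le_mul_of_nonneg_right hd (sq_nonneg z)]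
    have hxi : x * (-1 / x) = -1 := by field_simp
    have hyi : (x - 1) / (x + 1) * (-(x + 1) / (x - 1)) = -1 := by field_simp
    have hxs : x + -1 / x = 2 * s := by
      field_simp
      linarith
    have hys : (x - 1) / (x + 1) + -(x + 1) / (x - 1) = -2 / s := by
      field_simp
      linear_combination 2 * hx
    have hd1 : (2 * s) ^ 2 ≤ 2 * (m 1 : ℝ) := by nlinarith
    have hd0 : (-2 / s) ^ 2 ≤ 2 * (m 0 : ℝ) := by
      rw [div_pow, div_le_iff₀ (by positivity)]
      linarith
    refine exists_forall_ricciPositive (by norm_num) hφ ?_ fun i => ?_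
    · have hsum : (m 1 : ℝ) * (-2 / s) = -2 * s * m 0 := by
        field_simp
        linarith
      rw [← hys] at hsum
      simp only [hc, Fin.sum_univ_four, hm2, hm3, Matrix.cons_val]
      linear_combination (m 0 : ℝ) * hxs + hsum
    · rw [hc, Fin.sum_univ_four, hm2, hm3]
      fin_cases i
      · exact hq _ _ _ hxi hxs (.inr hd1)
      · exact hq _ _ _ hyi hys (.inl hd0)
      · exact hq _ _ _ (by rw [mul_comm]; exact hxi) (by rw [add_comm]; exact hxs) (.inr hd1)
      · exact hq _ _ _ (by rw [mul_comm]; exact hyi) (by rw [add_comm]; exact hys) (.inl hd0)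
  · refine ⟨1, one_pos, fun n M κ hM => (hm ?_).elim⟩
    obtain ⟨-, h⟩ := hM.exists_spaced (by norm_num)
    exact ⟨h 0 2 rfl, h 1 3 rfl⟩

theorem IsIsoparametric.not_ricciNonneg_six {n : ℕ} {M : SphereHypersurface.{u} n}
    {κ : Fin 6 → ℝ} {m : Fin 6 → ℕ} (hM : M.IsIsoparametric κ m) (h : m 0 = 1) :
    ¬ M.RicciNonneg := by
  obtain ⟨⟨θ, hθ, hκ⟩, hm⟩ := hM.exists_spaced (by norm_num)
  have hm2 : m 2 = m 0 := hm 0 2 rfl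
  have hm4 : m 4 = m 2 := hm 2 4 rfl
  have hm3 : m 3 = m 1 := hm 1 3 rfl
  have hm5 : m 5 = m 3 := hm 3 5 rfl
  have hb : (0 : ℝ) < m 1 := by exact_mod_cast M.pos_of_isIsoparametric hM 1
  refine hM.not_ricciNonneg (i := 0) ?_
  have hx := cot_pi_div_lt (by norm_num) hθ
  rw [hκ, spacedCurvature_six hθ]
  generalize Real.cot θ = x at hx ⊢
  norm_num at hx
  have h3 : (√3 : ℝ) ^ 2 = 3 := Real.sq_sqrt (by norm_num)
  have h3' : 1 < (√3 : ℝ) := by nlinarith [Real.sqrt_nonneg 3]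
  have hx0 : 0 < x := by linarith
  have hx3 : 0 < x ^ 2 - 3 := by nlinarith
  have hx1 : 0 < √3 * x - 1 := by nlinarith
  have hx2 : 0 < 3 * x ^ 2 - 1 := by nlinarith
  have hT := sum_three_cot_thirds (x := x) (by positivity) hx1.ne'
  have hT' := sum_three_cot_sixths (x := x) hx0.ne' (by positivity) (by linarith)
  simp only [principalRicci, Fin.sum_univ_six, hm2, hm4, hm3, hm5, h, Matrix.cons_val,
    Nat.cast_one, one_mul]
  generalize (m 1 : ℝ) = b at hb ⊢
  -- The right side is below `-8 / 3 - 9 b`, while `n - 1 = 2 + 3 b`.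
  have hH : (3 * x * (x ^ 2 - 3) / (3 * x ^ 2 - 1) +
      b * (-3 * (3 * x ^ 2 - 1) / (x * (x ^ 2 - 3)))) * x - x ^ 2 =
        -(8 / 3 + 8 / 3 / (3 * x ^ 2 - 1)) - b * (9 + 24 / (x ^ 2 - 3)) := by
    field_simp
    ring
  have hp1 : 0 < 8 / 3 / (3 * x ^ 2 - 1) := by positivity
  have hp2 : 0 < b * (24 / (x ^ 2 - 3)) := by positivity
  rw [← hT, ← hT'] at hH
  linarith

theorem exists_forall_not_ricciNonneg_six {m : Fin 6 → ℕ} (h0 : m 0 = 2) :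
    ∃ ε : ℝ, 0 < ε ∧ ∀ (n : ℕ) (M : SphereHypersurface.{u} n) (κ : Fin 6 → ℝ),
      M.IsIsoparametric κ m → ∃ t₀ : M.familyParams, (M.parallel t₀).IsMinimal ∧
        (∀ t : M.familyParams, (M.parallel t).IsMinimal → t = t₀) ∧
        ∀ t : M.familyParams, |(t : ℝ) - t₀| < ε → ¬ (M.parallel t).RicciNonneg := by
  by_cases hm : 0 < m 1 ∧ m 2 = m 0 ∧ m 4 = m 2 ∧ m 3 = m 1 ∧ m 5 = m 3
  · obtain ⟨hm1, hm2, hm4, hm3, hm5⟩ := hm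
    have hb : (1 : ℝ) ≤ m 1 := by exact_mod_cast hm1
    have h3 : (√3 : ℝ) ^ 2 = 3 := Real.sq_sqrt (by norm_num)
    have h3' : 1 < (√3 : ℝ) := by nlinarith [Real.sqrt_nonneg 3]
    -- Here `s` is `cot (3 φ)`: the mean curvature is `6 cot (3 φ) - 3 m₁ tan (3 φ)`.
    set s : ℝ := √((m 1 : ℝ) / 2) with hs
    have hs0 : 0 < s := Real.sqrt_pos.2 (by positivity)
    have hs2 : s ^ 2 = m 1 / 2 := Real.sq_sqrt (by positivity)
    obtain ⟨x, hx3, hx⟩ : ∃ x : ℝ, √3 < x ∧ x * (x ^ 2 - 3) = s * (3 * x ^ 2 - 1) := by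
      -- The function is `-8 s` at `√3`, and at `b = 3 s + 3` it equals `3 b (b - 1) + s`, which is
      -- positive.
      have hivt := intermediate_value_Ioo (a := √3) (b := 3 * s + 3)
        (f := fun x => x * (x ^ 2 - 3) - s * (3 * x ^ 2 - 1)) (by nlinarith) (by fun_prop)
      obtain ⟨x, hx, hx'⟩ := hivt (show (0 : ℝ) ∈ _ from ⟨by
        simp only [h3]
        nlinarith, by
        nlinarith [mul_pos hs0 hs0]⟩)
      exact ⟨x, hx.1, sub_eq_zero.1 hx'⟩
    obtain ⟨φ, hφ, rfl⟩ := exists_cot_eq (g := 6) (x := x) (by norm_num)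
      (by norm_num; linarith)
    have hc := spacedCurvature_six hφ
    generalize Real.cot φ = x at hx3 hx hc
    have hx0 : 0 < x := by linarith
    have hxx : 0 < x ^ 2 - 3 := by nlinarith
    have hx1 : 0 < √3 * x - 1 := by nlinarith
    have hx2 : 0 < 3 * x ^ 2 - 1 := by nlinarith
    have hT := sum_three_cot_thirds (x := x) (by positivity) hx1.ne'
    have hT' := sum_three_cot_sixths (x := x) hx0.ne' (by positivity) (by linarith)
    rw [mul_assoc, hx, ← mul_assoc, mul_div_cancel_right₀ _ hx2.ne'] at hT
    rw [hx, mul_div_mul_right _ _ hx2.ne'] at hT'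
    refine exists_forall_not_ricciNonneg (i := 0) (by norm_num) hφ ?_ ?_
    · have hsum : (m 1 : ℝ) * (-3 / s) = -6 * s := by
        field_simp
        linarith
      rw [← hT'] at hsum
      simp only [hc, Fin.sum_univ_six, hm2, hm4, hm3, hm5, h0, Matrix.cons_val]
      push_cast
      linear_combination 2 * hT + hsum
    · simp only [hc, Fin.sum_univ_six, hm2, hm4, hm3, hm5, h0, Matrix.cons_val]
      push_cast
      have hw : 2 * (x ^ 2) * (x ^ 2 - 3) ^ 2 = m 1 * (3 * x ^ 2 - 1) ^ 2 := by
        linear_combination 2 * (x * (x ^ 2 - 3) + s * (3 * x ^ 2 - 1)) * hx +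
          2 * (3 * x ^ 2 - 1) ^ 2 * hs2
      generalize x ^ 2 = w at hw hxx hx2 ⊢
      generalize (m 1 : ℝ) = b at hw hb ⊢
      have hw7 : 7 < w := by
        by_contra! hle
        -- For `3 < w ≤ 7` one has `2 w (w - 3) ^ 2 < (3 w - 1) ^ 2`, against `hw` and `b ≥ 1`.
        nlinarith [mul_nonneg hxx.le (sub_nonneg.2 hle), sq_nonneg (3 * w - 1),
          mul_nonneg (sub_nonneg.2 hb) (sq_nonneg (3 * w - 1))]
      -- This cubic is `(w - (3 b + 5)) (3 w - 1) ^ 2` with `b` eliminated by `hw`, and `3 b + 5 = n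
      -- - 1`.
      have hp : 0 < 3 * w ^ 3 - 15 * w ^ 2 - 23 * w - 5 := by
        nlinarith [mul_pos (sub_pos.2 hw7) (sub_pos.2 hw7),
          mul_pos (mul_pos (sub_pos.2 hw7) (sub_pos.2 hw7)) (sub_pos.2 hw7)]
      have hq : (3 * b + 5) * (3 * w - 1) ^ 2 < w * (3 * w - 1) ^ 2 := by nlinarith
      have := lt_of_mul_lt_mul_right hq (sq_nonneg _)
      linarith
  · refine ⟨1, one_pos, fun n M κ hM => (hm ?_).elim⟩
    obtain ⟨-, h⟩ := hM.exists_spaced (by norm_num)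
    exact ⟨M.pos_of_isIsoparametric hM 1, h 0 2 rfl, h 2 4 rfl, h 1 3 rfl, h 3 5 rfl⟩

end SphereHypersurface

theorem proposition3p1 :
    -- (i) three distinct principal curvatures
    ((∀ (n : ℕ) (M : SphereHypersurface.{u} n) (κ : Fin 3 → ℝ) (m : Fin 3 → ℕ),
        M.IsIsoparametric κ m → m 0 = 1 → ¬ M.RicciNonneg) ∧
      (∀ m : Fin 3 → ℕ, 1 < m 0 → ∃ ε : ℝ, 0 < ε ∧
        ∀ (n : ℕ) (M : SphereHypersurface.{u} n) (κ : Fin 3 → ℝ), M.IsIsoparametric κ m →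
          ∃ t₀ : M.familyParams, (M.parallel t₀).IsMinimal ∧
            (∀ t : M.familyParams, (M.parallel t).IsMinimal → t = t₀) ∧
            ∀ t : M.familyParams, |(t : ℝ) - t₀| < ε → (M.parallel t).RicciPositive)) ∧
    -- (ii) four distinct principal curvatures
    ((∀ (n : ℕ) (M : SphereHypersurface.{u} n) (κ : Fin 4 → ℝ) (m : Fin 4 → ℕ),
        M.IsIsoparametric κ m → (m 0 = 1 ∨ m 1 = 1) → ¬ M.RicciNonneg) ∧
      (∀ m : Fin 4 → ℕ, 2 ≤ m 0 → 2 ≤ m 1 → ∃ ε : ℝ, 0 < ε ∧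
        ∀ (n : ℕ) (M : SphereHypersurface.{u} n) (κ : Fin 4 → ℝ), M.IsIsoparametric κ m →
          ∃ t₀ : M.familyParams, (M.parallel t₀).IsMinimal ∧
            (∀ t : M.familyParams, (M.parallel t).IsMinimal → t = t₀) ∧
            ∀ t : M.familyParams, |(t : ℝ) - t₀| < ε → (M.parallel t).RicciPositive)) ∧
    -- (iii) six distinct principal curvatures
    ((∀ (n : ℕ) (M : SphereHypersurface.{u} n) (κ : Fin 6 → ℝ) (m : Fin 6 → ℕ),
        M.IsIsoparametric κ m → m 0 = 1 → ¬ M.RicciNonneg) ∧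
      (∀ m : Fin 6 → ℕ, m 0 = 2 → ∃ ε : ℝ, 0 < ε ∧
        ∀ (n : ℕ) (M : SphereHypersurface.{u} n) (κ : Fin 6 → ℝ), M.IsIsoparametric κ m →
          ∃ t₀ : M.familyParams, (M.parallel t₀).IsMinimal ∧
            (∀ t : M.familyParams, (M.parallel t).IsMinimal → t = t₀) ∧
            ∀ t : M.familyParams, |(t : ℝ) - t₀| < ε → ¬ (M.parallel t).RicciNonneg)) := by
  refine ⟨⟨fun n M κ m hM => hM.not_ricciNonneg_three,
    fun m => SphereHypersurface.exists_forall_ricciPositive_three⟩,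
    ⟨fun n M κ m hM => hM.not_ricciNonneg_four,
    fun m => SphereHypersurface.exists_forall_ricciPositive_four⟩,
    fun n M κ m hM => hM.not_ricciNonneg_six,
    fun m => SphereHypersurface.exists_forall_not_ricciNonneg_six⟩
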